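/- Let $n\ge 1$, $r\ge 0$ be integers and $2<p\le\infty$. Let $\mathcal T_h$ be a finite triangulation of a bounded polyhedral domain $\Omega\subset\mathbb R^n$: a finite set of closed nondegenerate $n$-simplices, any two of which meet in a common (possibly empty) face, with $\Omega$ the interior of their union. Write $P_k$ for polynomials of total degree $\le k$ ($P_{-1}=\{0\}$), $H(\operatorname{div},U)=\{u\in L^2(U)^n : \operatorname{div}u\in L^2(U)\}$, $H_0(\operatorname{div},\Omega)=\{u\in H(\operatorname{div},\Omega): u\cdot n|_{\partial\Omega}=0\}$, $V_h^r=\{f\in L^2(\Omega): f|_K\in P_r(K)\ \forall K\in\mathcal T_h\}$ with the $L^2$ inner product $\langle\cdot,\cdot\rangle$, and $$RT_{2r}(K)=P_{2r}(K)^n+x\,P_{2r}(K),\qquad RT_{2r}(\mathcal T_h)=\{u\in H_0(\operatorname{div},\Omega): u|_K\in RT_{2r}(K)\ \forall K\in\mathcal T_h\}.$$ Let $\mathcal E_h^0$ be the set of interior $(n-1)$-simplices, i.e. those shared by two simplices $K_1,K_2\in\mathcal T_h$; on $e=K_1\cap K_2\in\mathcal E_h^0$ put $[\![f]\!]=f_1n_1+f_2n_2$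 and $\{g\}=\frac12(g_1+g_2)$, where $f_i=f|_{K_i}$, $g_i=g|_{K_i}$ and $n_i$ is the unit normal to $e$ pointing out of $K_i$. For a field $u\in H(\operatorname{div},K)\cap L^p(K)^n$ and a face $e$ of $K$, the integral $\int_e(u\cdot n)q\,ds$ is understood in the sense of the normal trace, $\int_e (u\cdot n)q\,ds=\int_K(u\cdot\nabla w+w\operatorname{div}u)\,dx$ with $w$ a bounded lift with gradient in $L^{p'}(K)$, $1/p+1/p'=1$, and with boundary values $q$ on $e$ and $0$ on the other faces of $K$. For $u\in H_0(\operatorname{div},\Omega)\cap L^p(\Omega)^n$ let $A_u$ be the linear operator on $V_h^r$ determined by $$\langle A_uf,g\rangle=\sum_{K\in\mathcal T_h}\int_K(u\cdot\nabla f)\,g\,dx-\sum_{e\in\mathcal E_h^0}\int_e u\cdot[\![f]\!]\,\{g\}\,ds\qquad\forall f,g\in V_h^r .$$ For $K\in\mathcal T_h$ let $\Pi_{2r}^K:H(\operatorname{div},K)\cap L^p(K)^n\to RT_{2r}(K)$ be the map for which $\Pi_{2r}^Ku$ is the unique element of $RT_{2r}(K)$ with $$\int_e\big((u-\Pi_{2r}^Ku)\cdot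 n\big)q\,ds=0\quad\text{for all }q\in P_{2r}(e)\text{ and all faces }e\text{ of }K,\qquad \int_K(u-\Pi_{2r}^Ku)\cdot q\,dx=0\quad\text{for all }q\in P_{2r-1}(K)^n,$$ and let $\Pi_{2r}:H_0(\operatorname{div},\Omega)\cap L^p(\Omega)^n\to RT_{2r}(\mathcal T_h)$, $(\Pi_{2r}u)|_K=\Pi_{2r}^K(u|_K)$. Then $u\mapsto A_u$, $\Pi_{2r}^K$ and $\Pi_{2r}$ are well defined, $\mathsf A:u\mapsto A_u$ and $\Pi_{2r}$ are linear on $H_0(\operatorname{div},\Omega)\cap L^p(\Omega)^n$, and $$\ker\mathsf A=\ker\Pi_{2r}.$$ Consequently, for every $u\in H_0(\operatorname{div},\Omega)\cap L^p(\Omega)^n$ there is a unique $\bar u\in RT_{2r}(\mathcal T_h)$ with $A_{\bar u}=A_u$, namely $\bar u=\Pi_{2r}u$. -/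

import Mathlib

open MeasureTheory Set
open scoped ContDiff

noncomputable section

namespace FEVar

/-- `n`-dimensional Euclidean space. -/
abbrev E (n : ℕ) : Type := EuclideanSpace ℝ (Fin n)

/-! ### Polynomials -/

/-- The function on `ℝⁿ` defined by a polynomial in `n` variables. -/
def evalPoly {n : ℕ} (q : MvPolynomial (Fin n) ℝ) (x : E n) : ℝ :=
  MvPolynomial.eval (fun j => x j) q

/-- The vector field on `ℝⁿ` defined by `n` polynomials in `n` variables. -/
def evalVec {n : ℕ} (W : Fin n → MvPolynomial (Fin n) ℝ) (x : E n) : E n :=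
  WithLp.toLp 2 (fun j => evalPoly (W j) x)

/-- The divergence of a polynomial vector field. -/
def divPoly {n : ℕ} (W : Fin n → MvPolynomial (Fin n) ℝ) : MvPolynomial (Fin n) ℝ :=
  ∑ j, MvPolynomial.pderiv j (W j)

/-- The space `P_k` of polynomials of total degree at most `k`. -/
abbrev polyLE (n k : ℕ) : Submodule ℝ (MvPolynomial (Fin n) ℝ) :=
  MvPolynomial.restrictTotalDegree (Fin n) ℝ k

/-- The map sending a polynomial `b` to the polynomial vector field `x ↦ b(x) x`. -/
def mulPosition (n : ℕ) :
    MvPolynomial (Fin n) ℝ →ₗ[ℝ] (Fin n → MvPolynomial (Fin n) ℝ) where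
  toFun b := fun j => MvPolynomial.X j * b
  map_add' b c := by funext j; simp [mul_add]
  map_smul' t b := by funext j; simp

/-- The local Raviart-Thomas space `RT_k = (P_k)ⁿ + x P_k` of polynomial vector fields. -/
def localRT (n k : ℕ) : Submodule ℝ (Fin n → MvPolynomial (Fin n) ℝ) :=
  Submodule.pi Set.univ (fun _ => polyLE n k) ⊔ (polyLE n k).map (mulPosition n)

lemma continuous_evalPoly {n : ℕ} (q : MvPolynomial (Fin n) ℝ) : Continuous (evalPoly q) :=
  (MvPolynomial.continuous_eval q).comp (by fun_prop)

lemma continuous_evalVec {n : ℕ} (W : Fin n → MvPolynomial (Fin n) ℝ) :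
    Continuous (evalVec W) :=
  (PiLp.continuous_toLp 2 _).comp (continuous_pi fun j => continuous_evalPoly (W j))

/-! ### The spaces `H(div)` and `H₀(div)` -/

/-- `d` is the weak divergence of `u` in the open set `U`: the defining identity is tested
against all smooth functions with compact support in `U`. -/
def HasWeakDiv {n : ℕ} (U : Set (E n)) (u : E n → E n) (d : E n → ℝ) : Prop :=
  ∀ φ : E n → ℝ, ContDiff ℝ ∞ φ → HasCompactSupport φ → tsupport φ ⊆ U →
    ∫ x in U, fderiv ℝ φ x (u x) = - ∫ x in U, d x * φ x

/-- `u ∈ L²(U)ⁿ` and its weak divergence in `U` is `d ∈ L²(U)`, so that `u ∈ H(div, U)`. -/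
def MemHDiv {n : ℕ} (U : Set (E n)) (u : E n → E n) (d : E n → ℝ) : Prop :=
  MemLp u 2 (volume.restrict U) ∧ MemLp d 2 (volume.restrict U) ∧ HasWeakDiv U u d

/-- The normal trace on `∂U` of a field `u` with weak divergence `d` is zero: the boundary term
`∫_{∂U} (u · n) φ = ∫_U (u · ∇φ + φ div u)` of Green's formula vanishes for all `φ` which are
smooth up to the boundary of `U`. -/
def HasZeroNormalTrace {n : ℕ} (U : Set (E n)) (u : E n → E n) (d : E n → ℝ) : Prop :=
  ∀ φ : E n → ℝ, ContDiff ℝ ∞ φ → HasCompactSupport φ →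
    ∫ x in U, (fderiv ℝ φ x (u x) + d x * φ x) = 0

lemma integrable_fderiv_apply {n : ℕ} {U : Set (E n)} {φ : E n → ℝ} (hφ : ContDiff ℝ ∞ φ)
    (hc : HasCompactSupport φ) (u : Lp (E n) 2 (volume.restrict U)) :
    Integrable (fun x => fderiv ℝ φ x (u x)) (volume.restrict U) := by
  have h1 : Continuous (fderiv ℝ φ) := hφ.continuous_fderiv (by simp)
  have h2 : MemLp (fderiv ℝ φ) 2 (volume.restrict U) :=
    (h1.memLp_of_hasCompactSupport (hc.fderiv ℝ)).restrict U
  refine (MemLp.integrable_mul (p := 2) (q := 2) h2.norm (Lp.memLp u).norm).mono ?_ ?_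
  · exact (ContinuousLinearMap.apply ℝ ℝ : E n →L[ℝ] _).flip.aestronglyMeasurable_comp₂
      h1.aestronglyMeasurable (Lp.aestronglyMeasurable u)
  · refine Filter.Eventually.of_forall fun x => ?_
    simpa using (fderiv ℝ φ x).le_opNorm (u x)

lemma integrable_mul_test {n : ℕ} {U : Set (E n)} {φ : E n → ℝ} (hφ : ContDiff ℝ ∞ φ)
    (hc : HasCompactSupport φ) (d : Lp ℝ 2 (volume.restrict U)) :
    Integrable (fun x => d x * φ x) (volume.restrict U) :=
  MemLp.integrable_mul (p := 2) (q := 2) (Lp.memLp d)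
    ((hφ.continuous.memLp_of_hasCompactSupport hc).restrict U)

/-- The space `H₀(div, U)` of the fields in `H(div, U)` with zero normal trace on `∂U`. -/
def H0div {n : ℕ} (U : Set (E n)) : Submodule ℝ (Lp (E n) 2 (volume.restrict U)) where
  carrier := {u | ∃ d : Lp ℝ 2 (volume.restrict U),
    HasWeakDiv U u d ∧ HasZeroNormalTrace U u d}
  zero_mem' := by
    have h1 := Lp.coeFn_zero (E n) 2 (volume.restrict U)
    have h2 := Lp.coeFn_zero ℝ 2 (volume.restrict U)
    refine ⟨0, fun φ _ _ _ => ?_, fun φ _ _ => ?_⟩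
    · rw [integral_eq_zero_of_ae, integral_eq_zero_of_ae, neg_zero]
      · filter_upwards [h2] with x hx
        simp only [hx, Pi.zero_apply, zero_mul]
      · filter_upwards [h1] with x hx
        simp only [hx, Pi.zero_apply, map_zero]
    · refine integral_eq_zero_of_ae ?_
      filter_upwards [h1, h2] with x hx hx'
      simp only [hx, hx', Pi.zero_apply, map_zero, zero_mul, add_zero]
  add_mem' := by
    rintro u v ⟨d, hd, hd'⟩ ⟨e, he, he'⟩
    have h1 := Lp.coeFn_add u v
    have h2 := Lp.coeFn_add d e
    refine ⟨d + e, fun φ h hc hs => ?_, fun φ h hc => ?_⟩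
    · have e1 : ∫ x in U, fderiv ℝ φ x ((u + v) x)
          = ∫ x in U, (fderiv ℝ φ x (u x) + fderiv ℝ φ x (v x)) := by
        refine integral_congr_ae ?_
        filter_upwards [h1] with x hx
        simp only [hx, Pi.add_apply, map_add]
      have e2 : ∫ x in U, (d + e) x * φ x = ∫ x in U, (d x * φ x + e x * φ x) := by
        refine integral_congr_ae ?_
        filter_upwards [h2] with x hx
        simp only [hx, Pi.add_apply, add_mul]
      rw [e1, e2, integral_add (integrable_fderiv_apply h hc u) (integrable_fderiv_apply h hc v),
        integral_add (integrable_mul_test h hc d) (integrable_mul_test h hc e),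
        hd φ h hc hs, he φ h hc hs, neg_add]
    · have e1 : ∫ x in U, (fderiv ℝ φ x ((u + v) x) + (d + e) x * φ x)
          = ∫ x in U, ((fderiv ℝ φ x (u x) + d x * φ x) + (fderiv ℝ φ x (v x) + e x * φ x)) := by
        refine integral_congr_ae ?_
        filter_upwards [h1, h2] with x hx hx'
        simp only [hx, hx', Pi.add_apply, map_add]
        ring
      have i1 : Integrable (fun x => fderiv ℝ φ x (u x) + d x * φ x) (volume.restrict U) :=
        (integrable_fderiv_apply h hc u).add (integrable_mul_test h hc d)
      have i2 : Integrable (fun x => fderiv ℝ φ x (v x) + e x * φ x) (volume.restrict U) :=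
        (integrable_fderiv_apply h hc v).add (integrable_mul_test h hc e)
      rw [e1, integral_add i1 i2, hd' φ h hc, he' φ h hc, add_zero]
  smul_mem' := by
    rintro c u ⟨d, hd, hd'⟩
    have h1 := Lp.coeFn_smul c u
    have h2 := Lp.coeFn_smul c d
    refine ⟨c • d, fun φ h hc hs => ?_, fun φ h hc => ?_⟩
    · have e1 : ∫ x in U, fderiv ℝ φ x ((c • u) x) = ∫ x in U, c * fderiv ℝ φ x (u x) := by
        refine integral_congr_ae ?_
        filter_upwards [h1] with x hx
        simp only [hx, Pi.smul_apply, map_smul, smul_eq_mul]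
      have e2 : ∫ x in U, (c • d) x * φ x = ∫ x in U, c * (d x * φ x) := by
        refine integral_congr_ae ?_
        filter_upwards [h2] with x hx
        simp only [hx, Pi.smul_apply, smul_eq_mul, mul_assoc]
      rw [e1, e2, integral_const_mul, integral_const_mul, hd φ h hc hs, mul_neg]
    · have e1 : ∫ x in U, (fderiv ℝ φ x ((c • u) x) + (c • d) x * φ x)
          = ∫ x in U, c * (fderiv ℝ φ x (u x) + d x * φ x) := by
        refine integral_congr_ae ?_
        filter_upwards [h1, h2] with x hx hx'
        simp only [hx, hx', Pi.smul_apply, map_smul, smul_eq_mul]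
        ring
      rw [e1, integral_const_mul, hd' φ h hc, mul_zero]

/-- The space `H₀(div, U) ∩ L^p(U)ⁿ`. -/
def H0divLp {n : ℕ} (U : Set (E n)) (p : ENNReal) :
    Submodule ℝ (Lp (E n) 2 (volume.restrict U)) where
  carrier := {u | u ∈ H0div U ∧ MemLp u p (volume.restrict U)}
  zero_mem' := ⟨(H0div U).zero_mem,
    (memLp_congr_ae (Lp.coeFn_zero (E n) 2 (volume.restrict U))).2 MemLp.zero⟩
  add_mem' := fun {u v} hu hv => ⟨(H0div U).add_mem hu.1 hv.1,
    (memLp_congr_ae (Lp.coeFn_add u v)).2 (hu.2.add hv.2)⟩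
  smul_mem' := fun c u hu => ⟨(H0div U).smul_mem c hu.1,
    (memLp_congr_ae (Lp.coeFn_smul c u)).2 (hu.2.const_smul c)⟩

open Classical in
/-- The weak divergence `div u ∈ L²(U)` of a field `u` (with value `0` if `u ∉ H(div, U)`). -/
def weakDiv {n : ℕ} (U : Set (E n)) (u : Lp (E n) 2 (volume.restrict U)) :
    Lp ℝ 2 (volume.restrict U) :=
  if h : ∃ d : Lp ℝ 2 (volume.restrict U), HasWeakDiv U u d then h.choose else 0

/-! ### Simplices

An `n`-simplex in `ℝⁿ` is given by its `n + 1` affinely independent vertices, that is, by an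
affine basis `K` of `ℝⁿ`; `K.coord i` is then its `i`-th barycentric coordinate. -/

/-- The closed simplex with vertices `K`. -/
def body {n : ℕ} (K : AffineBasis (Fin (n + 1)) ℝ (E n)) : Set (E n) :=
  convexHull ℝ (Set.range K)

open Classical in
/-- The set of vertices of the `(n-1)`-dimensional face of `K` opposite to the vertex `i`. -/
def facet {n : ℕ} (K : AffineBasis (Fin (n + 1)) ℝ (E n)) (i : Fin (n + 1)) : Finset (E n) :=
  (Finset.univ.erase i).image K

/-- The function `∏_{j ≠ i} λ_j / (λ_j + λ_i)` on the simplex `K`, where `λ` are the barycentric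
coordinates. It is smooth in the interior of `K`, takes values in `[0, 1]`, extends continuously
to the complement in `K` of the relative boundary of the face opposite to the vertex `i`, with
boundary value `1` on (the relative interior of) that face and `0` on all other faces, and its
gradient, being `O(∑_{j ≠ i} 1 / (λ_j + λ_i))`, is in `L^s(K)` for all `s < 2`. -/
def faceLift {n : ℕ} (K : AffineBasis (Fin (n + 1)) ℝ (E n)) (i : Fin (n + 1)) (x : E n) : ℝ :=
  ∏ j ∈ Finset.univ.erase i, K.coord j x / (K.coord j x + K.coord i x)

/-- The integral `∫_e (u · n) q ds` over the face `e` of `K` opposite to the vertex `i`, where `n`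
is the unit normal pointing out of `K`, for a field `u ∈ H(div, K) ∩ L^p(K)ⁿ`, `p > 2`, with weak
divergence `d`, and a smooth function `q`. As usual, the normal trace of such a field on a single
face is defined by Green's formula, `∫_e (u · n) q ds = ∫_K (u · ∇w + w div u) dx`, where `w` is
a bounded lift with gradient in the dual space `L^{p'}(K)`, `p' < 2`, which has boundary values `q`
on `e` and `0` on the other faces. The value is independent of the lift, and we take `q` times
the function `faceLift K i`. -/
def faceFlux {n : ℕ} (K : AffineBasis (Fin (n + 1)) ℝ (E n)) (i : Fin (n + 1))
    (u : E n → E n) (d : E n → ℝ) (q : E n → ℝ) : ℝ :=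
  ∫ x in body K,
    (fderiv ℝ (fun y => faceLift K i y * q y) x (u x) + d x * (faceLift K i x * q x))

lemma faceLift_eq_one {n : ℕ} (K : AffineBasis (Fin (n + 1)) ℝ (E n)) (i : Fin (n + 1)) (x : E n)
    (hi : K.coord i x = 0) (hj : ∀ j, j ≠ i → K.coord j x ≠ 0) : faceLift K i x = 1 :=
  Finset.prod_eq_one fun j h => by
    rw [hi, add_zero, div_self (hj j (Finset.ne_of_mem_erase h))]

lemma faceLift_eq_zero {n : ℕ} (K : AffineBasis (Fin (n + 1)) ℝ (E n)) (i j : Fin (n + 1))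
    (x : E n) (hji : j ≠ i) (hj : K.coord j x = 0) : faceLift K i x = 0 :=
  Finset.prod_eq_zero (Finset.mem_erase.2 ⟨hji, Finset.mem_univ j⟩) (by rw [hj, zero_div])

/-- `W` is the local Raviart-Thomas interpolant of order `k` on the simplex `K` of the field `u`
with weak divergence `d`: it lies in `RT_k(K)`, `∫_e ((u - W) · n) q ds = 0` for all faces `e` of
`K` and `q ∈ P_k(e)`, and `∫_K (u - W) · P dx = 0` for all `P ∈ P_{k-1}(K)ⁿ`
(where `P_{-1} = 0`). -/
def IsLocalInterpolant {n : ℕ} (K : AffineBasis (Fin (n + 1)) ℝ (E n)) (k : ℕ)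
    (u : E n → E n) (d : E n → ℝ) (W : Fin n → MvPolynomial (Fin n) ℝ) : Prop :=
  W ∈ localRT n k ∧
  (∀ i : Fin (n + 1), ∀ q ∈ polyLE n k,
    faceFlux K i (fun x => u x - evalVec W x) (fun x => d x - evalPoly (divPoly W) x)
      (evalPoly q) = 0) ∧
  (∀ P : Fin n → MvPolynomial (Fin n) ℝ, (∀ j, P j = 0 ∨ (P j).totalDegree < k) →
    ∫ x in body K, inner ℝ (u x - evalVec W x) (evalVec P x) = 0)

/-! ### Triangulations -/

/-- A finite family of distinct `n`-simplices in `ℝⁿ`, any two of which meet in a common face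
(possibly empty). -/
structure Triangulation (n : ℕ) (ι : Type*) where
  /-- The simplices. -/
  cell : ι → AffineBasis (Fin (n + 1)) ℝ (E n)
  distinct : ∀ k l, k ≠ l → Set.range (cell k) ≠ Set.range (cell l)
  conforming : ∀ k l, body (cell k) ∩ body (cell l) =
    convexHull ℝ (Set.range (cell k) ∩ Set.range (cell l))

namespace Triangulation

variable {n : ℕ} {ι : Type*}

/-- The triangulated domain: the open set `Ω` whose closure is the union of the simplices. -/
def Ω (T : Triangulation n ι) : Set (E n) := interior (⋃ k, body (T.cell k))

/-- The space `V_h^r` of the functions in `L²(Ω)` that are polynomials of degree at most `r` on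
each simplex. -/
def V (T : Triangulation n ι) (r : ℕ) : Submodule ℝ (Lp ℝ 2 (volume.restrict T.Ω)) where
  carrier := {f | ∀ k, ∃ q ∈ polyLE n r,
    ∀ᵐ x ∂(volume.restrict (T.Ω ∩ body (T.cell k))), f x = evalPoly q x}
  zero_mem' := fun k => ⟨0, Submodule.zero_mem _, by
    filter_upwards [ae_restrict_of_ae_restrict_of_subset inter_subset_left
      (Lp.coeFn_zero ℝ 2 (volume.restrict T.Ω))] with x hx
    simp only [hx, Pi.zero_apply, evalPoly, map_zero]⟩
  add_mem' := fun {f g} hf hg k => by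
    obtain ⟨a, ha, ha'⟩ := hf k
    obtain ⟨b, hb, hb'⟩ := hg k
    refine ⟨a + b, Submodule.add_mem _ ha hb, ?_⟩
    filter_upwards [ha', hb', ae_restrict_of_ae_restrict_of_subset inter_subset_left
      (Lp.coeFn_add f g)] with x h1 h2 h3
    simp only [h3, Pi.add_apply, h1, h2, evalPoly, map_add]
  smul_mem' := fun c f hf k => by
    obtain ⟨a, ha, ha'⟩ := hf k
    refine ⟨c • a, Submodule.smul_mem _ c ha, ?_⟩
    filter_upwards [ha', ae_restrict_of_ae_restrict_of_subset inter_subset_left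
      (Lp.coeFn_smul c f)] with x h1 h3
    simp only [h3, Pi.smul_apply, h1, evalPoly, MvPolynomial.smul_eval, smul_eq_mul]

/-- The polynomials `F k` represent `f` on each simplex. -/
def Represents (T : Triangulation n ι) (F : ι → MvPolynomial (Fin n) ℝ)
    (f : Lp ℝ 2 (volume.restrict T.Ω)) : Prop :=
  ∀ k, ∀ᵐ x ∂(volume.restrict (T.Ω ∩ body (T.cell k))), f x = evalPoly (F k) x

/-- The global Raviart-Thomas space
`RT_k(T) = {u ∈ H₀(div, Ω) | u ∈ (P_k)ⁿ + x P_k on each simplex}`. -/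
def RT (T : Triangulation n ι) (k : ℕ) : Submodule ℝ (Lp (E n) 2 (volume.restrict T.Ω)) where
  carrier := {u | u ∈ H0div T.Ω ∧ ∀ l, ∃ W ∈ localRT n k,
    ∀ᵐ x ∂(volume.restrict (T.Ω ∩ body (T.cell l))), u x = evalVec W x}
  zero_mem' := ⟨Submodule.zero_mem _, fun l => ⟨0, Submodule.zero_mem _, by
    filter_upwards [ae_restrict_of_ae_restrict_of_subset inter_subset_left
      (Lp.coeFn_zero (E n) 2 (volume.restrict T.Ω))] with x hx
    ext j
    simp only [hx, Pi.zero_apply, evalPoly, evalVec, map_zero, PiLp.zero_apply]⟩⟩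
  add_mem' := fun {f g} hf hg => ⟨Submodule.add_mem _ hf.1 hg.1, fun l => by
    obtain ⟨a, ha, ha'⟩ := hf.2 l
    obtain ⟨b, hb, hb'⟩ := hg.2 l
    refine ⟨a + b, Submodule.add_mem _ ha hb, ?_⟩
    filter_upwards [ha', hb', ae_restrict_of_ae_restrict_of_subset inter_subset_left
      (Lp.coeFn_add f g)] with x h1 h2 h3
    ext j
    simp only [h3, Pi.add_apply, h1, h2, evalPoly, evalVec, map_add, PiLp.add_apply]⟩
  smul_mem' := fun c f hf => ⟨Submodule.smul_mem _ c hf.1, fun l => by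
    obtain ⟨a, ha, ha'⟩ := hf.2 l
    refine ⟨c • a, Submodule.smul_mem _ c ha, ?_⟩
    filter_upwards [ha', ae_restrict_of_ae_restrict_of_subset inter_subset_left
      (Lp.coeFn_smul c f)] with x h1 h3
    ext j
    simp only [h3, Pi.smul_apply, h1, evalPoly, evalVec, MvPolynomial.smul_eval, smul_eq_mul,
      PiLp.smul_apply]⟩

lemma isCompact_body (K : AffineBasis (Fin (n + 1)) ℝ (E n)) : IsCompact (body K) :=
  (Set.finite_range K).isCompact_convexHull ℝ

/-- Raviart-Thomas fields are bounded, hence in `L^p` for every `p`. -/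
lemma RT_le [Finite ι] (T : Triangulation n ι) (k : ℕ) (p : ENNReal) :
    T.RT k ≤ H0divLp T.Ω p := by
  rintro u ⟨hu, hW⟩
  refine ⟨hu, ?_⟩
  have hcov : T.Ω = ⋃ l, (T.Ω ∩ body (T.cell l)) := by
    rw [← inter_iUnion]
    exact (inter_eq_left.2 interior_subset).symm
  have hfin : IsFiniteMeasure (volume.restrict T.Ω) := by
    refine isFiniteMeasure_restrict.2 (ne_of_lt ?_)
    exact (measure_mono interior_subset).trans_lt
      (isCompact_iUnion fun l => isCompact_body (T.cell l)).measure_lt_top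
  choose W _ hW using hW
  choose C hC using fun l =>
    (isCompact_body (T.cell l)).exists_bound_of_continuousOn (continuous_evalVec (W l)).continuousOn
  obtain ⟨M, hM⟩ := (Set.finite_range C).bddAbove
  refine MemLp.of_bound (Lp.aestronglyMeasurable u) M ?_
  suffices h : ∀ᵐ x ∂(volume.restrict (⋃ l, (T.Ω ∩ body (T.cell l)))), ‖u x‖ ≤ M by
    rwa [← hcov] at h
  rw [ae_restrict_iUnion_iff]
  intro l
  have hm : MeasurableSet (T.Ω ∩ body (T.cell l)) :=
    isOpen_interior.measurableSet.inter (isCompact_body _).measurableSet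
  filter_upwards [hW l, ae_restrict_mem hm] with x h1 h2
  rw [h1]
  exact (hC l x h2.2).trans (hM (mem_range_self l))

variable [Fintype ι]

open Classical in
/-- The pairs (simplex, vertex) such that the face opposite to the vertex has vertex set `e`. -/
def sides (T : Triangulation n ι) (e : Finset (E n)) : Finset (ι × Fin (n + 1)) :=
  Finset.univ.filter fun s => facet (T.cell s.1) s.2 = e

open Classical in
/-- The set `E_h⁰` of the interior `(n-1)`-simplices (given by their vertex sets), which are those
shared by two simplices. -/
def interiorFaces (T : Triangulation n ι) : Finset (Finset (E n)) :=
  (Finset.univ.image fun s : ι × Fin (n + 1) => facet (T.cell s.1) s.2).filter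
    fun e => (T.sides e).card = 2

/-- The integral `∫_e u · ⟦f⟧ {g} ds` over the interior face `e = K₁ ∩ K₂`, where
`⟦f⟧ = f₁ n₁ + f₂ n₂` and `{g} = (g₁ + g₂) / 2`; here `f` and `g` are given by the polynomials
`F k` and `G k` on the simplices, and `d` is the weak divergence of `u`. -/
def jumpAverage (T : Triangulation n ι) (e : Finset (E n)) (u : E n → E n) (d : E n → ℝ)
    (F G : ι → MvPolynomial (Fin n) ℝ) : ℝ :=
  ∑ s ∈ T.sides e, faceFlux (T.cell s.1) s.2 u d
    (fun x => evalPoly (F s.1) x * ((1 / 2 : ℝ) * ∑ t ∈ T.sides e, evalPoly (G t.1) x))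

/-- The bilinear form
`∑_K ∫_K (u · ∇f) g dx - ∑_{e ∈ E_h⁰} ∫_e u · ⟦f⟧ {g} ds`. -/
def derivForm (T : Triangulation n ι) (u : Lp (E n) 2 (volume.restrict T.Ω))
    (F G : ι → MvPolynomial (Fin n) ℝ) : ℝ :=
  (∑ k, ∫ x in body (T.cell k), fderiv ℝ (evalPoly (F k)) x (u x) * evalPoly (G k) x)
    - ∑ e ∈ T.interiorFaces, T.jumpAverage e u (weakDiv T.Ω u) F G

/-- `B` is the discrete derivative `A_u`, the operator on `V_h^r` with
`⟨A_u f, g⟩ = ∑_K ∫_K (u · ∇f) g dx - ∑_{e ∈ E_h⁰} ∫_e u · ⟦f⟧ {g} ds` for all `f, g ∈ V_h^r`. -/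
def IsDiscreteDerivative (T : Triangulation n ι) (r : ℕ)
    (u : Lp (E n) 2 (volume.restrict T.Ω)) (B : T.V r →ₗ[ℝ] T.V r) : Prop :=
  ∀ (f g : T.V r) (F G : ι → MvPolynomial (Fin n) ℝ), T.Represents F f → T.Represents G g →
    inner ℝ (B f) g = T.derivForm u F G

end Triangulation

end FEVar

end

open MeasureTheory Set
open scoped ContDiff

noncomputable section

namespace FEVar

open Filter Topology

variable {n : ℕ}

/-! The operator `A_u` sees `u` only through the numbers `∫_e (u · n) q` with `q ∈ P_{2r}` and `∫_K
u · P` with `P ∈ (P_{2r-1})ⁿ`, because `f g ∈ P_{2r}` and `g ∇f ∈ (P_{2r-1})ⁿ` for `f, g ∈ P_r`.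
These are exactly the degrees of freedom that define `Π_{2r}`, so `ker Π ⊆ ker A`.

For the converse, all these numbers are recovered from the form (`form_eq_zero_iff`). If `f` lives
on one side of an interior face `e` and `g` on the other, every term vanishes except `-1/2` times
the flux of `f g` through `e`, and such products span `P_{2r}` (`eq_zero_of_forall_mul`). Fluxes
through boundary faces vanish since `u ∈ H₀(div)`. Once all fluxes are zero, only the cell integrals
`∫_K g u · ∇f` remain, and the fields `g ∇f` span `(P_{2r-1})ⁿ` (`eq_zero_of_forall_smul_grad`). The
last claim of the theorem follows since `Π` is the identity on the Raviart-Thomas space.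

The rest shows that the objects exist. Analysis: the gradient of a face lift grows like `1 / (λ_i +
λ_j)`, which is in `L^s` for `s < 2`, so it pairs with `u ∈ L^p` for `p > 2` (`memLp_inv_coord_add`,
`integrable_mul_wt`). Green's formula has no boundary term for a lift `w` as soon as `w dλ_j(u)` is
`O(λ_j)` times an integrable weight, for each `j` (`pair_eq_zero`); every property of single-face
fluxes is deduced from this.

Algebra: the local interpolant exists by unisolvence (`eq_zero_of_dofs_eq_zero`) and a dimension
count (`dofMap_bijective`). Surface integrals are avoided: the field `x - v_i` is tangential to all
faces but the one opposite to `v_i`, so `∫_K div (g (x - v_i))` serves as the integral of `g` over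
that face. Its definiteness on polynomials follows from Euler's identity for polynomials homogeneous
about `v_i` (`lam_dvd_of_faceInt_eq_zero`).

Gluing: the fluxes of an `H₀(div)` field from the two sides of a face cancel
(`sum_faceFlux_sides_eq_zero`). The local interpolants inherit this against `P_{2r}`, which suffices
for piecewise Raviart-Thomas fields (`exists_mem_RT`). -/

/-! ### Barycentric coordinates -/

/-- An `n`-simplex in `ℝⁿ`, given by its vertices. -/
abbrev Simplex (n : ℕ) : Type := AffineBasis (Fin (n + 1)) ℝ (E n)

/-- The differential of the `i`-th barycentric coordinate. -/
def dcoord (K : Simplex n) (i : Fin (n + 1)) : E n →L[ℝ] ℝ :=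
  LinearMap.toContinuousLinearMap (K.coord i).linear

lemma coord_eq (K : Simplex n) (i : Fin (n + 1)) (x y : E n) :
    K.coord i x = dcoord K i (x - y) + K.coord i y := by
  have h := (K.coord i).linearMap_vsub x y
  simp only [vsub_eq_sub] at h
  rw [show dcoord K i (x - y) = (K.coord i).linear (x - y) from rfl, h, sub_add_cancel]

lemma hasFDerivAt_coord (K : Simplex n) (i : Fin (n + 1)) (x : E n) :
    HasFDerivAt (K.coord i) (dcoord K i) x := by
  have h : (K.coord i : E n → ℝ) = fun y => dcoord K i y + K.coord i 0 := by
    funext y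
    simpa using coord_eq K i y 0
  rw [h]
  exact (dcoord K i).hasFDerivAt.add_const _

lemma contDiff_coord (K : Simplex n) (i : Fin (n + 1)) {k : WithTop ℕ∞} :
    ContDiff ℝ k (K.coord i) := by
  have h : (K.coord i : E n → ℝ) = fun y => dcoord K i y + K.coord i 0 := by
    funext y
    simpa using coord_eq K i y 0
  rw [h]
  exact (dcoord K i).contDiff.add contDiff_const

lemma continuous_coord (K : Simplex n) (i : Fin (n + 1)) : Continuous (K.coord i) :=
  (contDiff_coord K i (k := 0)).continuous

lemma sum_coord (K : Simplex n) (x : E n) : ∑ i, K.coord i x = 1 :=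
  K.sum_coord_apply_eq_one x

lemma sum_dcoord (K : Simplex n) : ∑ i, dcoord K i = 0 := by
  ext v
  have h : ∑ i, (K.coord i v - K.coord i 0) = 0 := by
    rw [Finset.sum_sub_distrib, sum_coord, sum_coord, sub_self]
  rw [sum_apply, zero_apply, ← h]
  refine Finset.sum_congr rfl fun i _ => ?_
  rw [coord_eq K i v 0]
  simp

lemma mem_interior_body {K : Simplex n} {x : E n} :
    x ∈ interior (body K) ↔ ∀ i, 0 < K.coord i x := by
  rw [body, K.interior_convexHull]
  rfl

lemma mem_body {K : Simplex n} {x : E n} : x ∈ body K ↔ ∀ i, 0 ≤ K.coord i x := by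
  rw [body, K.convexHull_eq_nonneg_coord]
  rfl

lemma coord_le_one_of_mem_body {K : Simplex n} {x : E n} (hx : x ∈ body K) (i : Fin (n + 1)) :
    K.coord i x ≤ 1 := by
  rw [← sum_coord K x]
  exact Finset.single_le_sum (f := fun i => K.coord i x) (fun j _ => mem_body.1 hx j)
    (Finset.mem_univ i)

lemma isCompact_body (K : Simplex n) : IsCompact (body K) :=
  (Set.finite_range K).isCompact_convexHull ℝ

lemma interior_body_ae_eq (K : Simplex n) : interior (body K) =ᵐ[volume] body K :=
  interior_ae_eq_of_null_frontier ((convex_convexHull ℝ _).addHaar_frontier volume)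

lemma measurableSet_interior_body (K : Simplex n) : MeasurableSet (interior (body K)) :=
  isOpen_interior.measurableSet

instance (K : Simplex n) : IsFiniteMeasure (volume.restrict (interior (body K))) :=
  isFiniteMeasure_restrict.2
    (ne_of_lt ((measure_mono interior_subset).trans_lt (isCompact_body K).measure_lt_top))

/-! ### Lifts with a weak singularity at the skeleton of codimension two -/

/-- The weight `1 + ∑_{i ≠ j} 1 / (λ_i + λ_j)`, which is large only near the skeleton of `K` of
codimension two. -/
def wt (K : Simplex n) (x : E n) : ℝ :=
  1 + ∑ i, ∑ j ∈ Finset.univ.erase i, (K.coord i x + K.coord j x)⁻¹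

lemma wt_summand_nonneg {K : Simplex n} {x : E n} (hx : x ∈ interior (body K))
    (i j : Fin (n + 1)) : 0 ≤ (K.coord i x + K.coord j x)⁻¹ :=
  inv_nonneg.2 (add_nonneg (mem_interior_body.1 hx i).le (mem_interior_body.1 hx j).le)

lemma one_le_wt {K : Simplex n} {x : E n} (hx : x ∈ interior (body K)) : 1 ≤ wt K x :=
  le_add_of_nonneg_right (Finset.sum_nonneg fun i _ => Finset.sum_nonneg fun j _ =>
    wt_summand_nonneg hx i j)

lemma sum_inv_le_wt {K : Simplex n} {x : E n} (hx : x ∈ interior (body K)) (i : Fin (n + 1)) :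
    ∑ j ∈ Finset.univ.erase i, (K.coord i x + K.coord j x)⁻¹ ≤ wt K x := by
  have := Finset.single_le_sum
    (f := fun i => ∑ j ∈ Finset.univ.erase i, (K.coord i x + K.coord j x)⁻¹)
    (fun i _ => Finset.sum_nonneg fun j _ => wt_summand_nonneg hx i j) (Finset.mem_univ i)
  rw [wt]
  linarith

lemma inv_le_wt {K : Simplex n} {x : E n} (hx : x ∈ interior (body K)) {i j : Fin (n + 1)}
    (hij : j ≠ i) : (K.coord i x + K.coord j x)⁻¹ ≤ wt K x :=
  (Finset.single_le_sum (f := fun j => (K.coord i x + K.coord j x)⁻¹)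
    (fun j _ => wt_summand_nonneg hx i j) (Finset.mem_erase.2 ⟨hij, Finset.mem_univ j⟩)).trans
    (sum_inv_le_wt hx i)

lemma continuousOn_wt (K : Simplex n) : ContinuousOn (wt K) (interior (body K)) := by
  refine continuousOn_const.add (continuousOn_finsetSum _ fun i _ =>
    continuousOn_finsetSum _ fun j _ => ContinuousOn.inv₀
      ((continuous_coord K i).add (continuous_coord K j)).continuousOn fun x hx => ?_)
  exact (add_pos (mem_interior_body.1 hx i) (mem_interior_body.1 hx j)).ne'

/-- A bounded smooth function in the interior of `K` whose gradient is bounded by a multiple of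
the weight `wt K`. -/
structure Lift (K : Simplex n) (w : E n → ℝ) : Prop where
  contDiffOn : ContDiffOn ℝ ∞ w (interior (body K))
  bound : ∃ C, 0 ≤ C ∧ ∀ x ∈ interior (body K), |w x| ≤ C ∧ ‖fderiv ℝ w x‖ ≤ C * wt K x

/-! ### Algebra of lifts. -/

namespace Lift

variable {K : Simplex n} {v w : E n → ℝ}

lemma differentiableAt (hw : Lift K w) {x : E n} (hx : x ∈ interior (body K)) :
    DifferentiableAt ℝ w x :=
  (hw.contDiffOn.contDiffAt (isOpen_interior.mem_nhds hx)).differentiableAt (by simp)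

lemma add (hv : Lift K v) (hw : Lift K w) : Lift K (fun x => v x + w x) := by
  obtain ⟨C, hC, hC'⟩ := hv.bound
  obtain ⟨D, hD, hD'⟩ := hw.bound
  refine ⟨hv.contDiffOn.add hw.contDiffOn, C + D, add_nonneg hC hD, fun x hx => ⟨?_, ?_⟩⟩
  · exact (abs_add_le _ _).trans (add_le_add (hC' x hx).1 (hD' x hx).1)
  · rw [fderiv_fun_add (hv.differentiableAt hx) (hw.differentiableAt hx), add_mul]
    exact (norm_add_le _ _).trans (add_le_add (hC' x hx).2 (hD' x hx).2)

lemma mul (hv : Lift K v) (hw : Lift K w) : Lift K (fun x => v x * w x) := by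
  obtain ⟨C, hC, hC'⟩ := hv.bound
  obtain ⟨D, hD, hD'⟩ := hw.bound
  refine ⟨hv.contDiffOn.mul hw.contDiffOn, 2 * (C * D), by positivity, fun x hx => ⟨?_, ?_⟩⟩
  · rw [abs_mul]
    have := mul_le_mul (hC' x hx).1 (hD' x hx).1 (abs_nonneg _) hC
    nlinarith [mul_nonneg hC hD]
  · rw [fderiv_fun_mul (hv.differentiableAt hx) (hw.differentiableAt hx)]
    refine (norm_add_le _ _).trans ?_
    rw [norm_smul, norm_smul, Real.norm_eq_abs, Real.norm_eq_abs]
    have h1 := mul_le_mul (hC' x hx).1 (hD' x hx).2 (norm_nonneg _) hC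
    have h2 := mul_le_mul (hD' x hx).1 (hC' x hx).2 (norm_nonneg _) hD
    calc _ ≤ C * (D * wt K x) + D * (C * wt K x) := add_le_add h1 h2
      _ = _ := by ring

lemma of_contDiff (hw : ContDiff ℝ ∞ w) : Lift K w := by
  obtain ⟨C, hC⟩ := (isCompact_body K).exists_bound_of_continuousOn hw.continuous.continuousOn
  obtain ⟨D, hD⟩ := (isCompact_body K).exists_bound_of_continuousOn
    (hw.continuous_fderiv (by simp)).continuousOn
  refine ⟨hw.contDiffOn, max (max C D) 0, le_max_right _ _, fun x hx => ⟨?_, ?_⟩⟩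
  · exact (hC x (interior_subset hx)).trans ((le_max_left _ _).trans (le_max_left _ _))
  · have h1 := (hD x (interior_subset hx)).trans
      ((le_max_right C D).trans (le_max_left (max C D) 0))
    exact h1.trans (le_mul_of_one_le_right (le_max_right _ _) (one_le_wt hx))

lemma const_mul (c : ℝ) (hw : Lift K w) : Lift K (fun x => c * w x) :=
  (of_contDiff contDiff_const).mul hw

lemma sub (hv : Lift K v) (hw : Lift K w) : Lift K (fun x => v x - w x) := by
  have := hv.add (hw.const_mul (-1))
  refine (funext fun x => ?_ : (fun x => v x - w x) = _) ▸ this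
  ring

lemma one : Lift K (fun _ => 1) := of_contDiff contDiff_const

lemma zero : Lift K (fun _ => 0) := of_contDiff contDiff_const

lemma sum {ι : Type*} (s : Finset ι) {w : ι → E n → ℝ} (h : ∀ i ∈ s, Lift K (w i)) :
    Lift K (fun x => ∑ i ∈ s, w i x) := by
  classical
  induction s using Finset.induction_on with
  | empty => simpa using zero
  | insert a s ha ih =>
    simp only [Finset.sum_insert ha]
    exact (h a (Finset.mem_insert_self _ _)).add
      (ih fun i hi => h i (Finset.mem_insert_of_mem hi))

lemma prod {ι : Type*} (s : Finset ι) {w : ι → E n → ℝ} (h : ∀ i ∈ s, Lift K (w i)) :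
    Lift K (fun x => ∏ i ∈ s, w i x) := by
  classical
  induction s using Finset.induction_on with
  | empty => simpa using one
  | insert a s ha ih =>
    simp only [Finset.prod_insert ha]
    exact (h a (Finset.mem_insert_self _ _)).mul
      (ih fun i hi => h i (Finset.mem_insert_of_mem hi))

end Lift

lemma ratio_nonneg {K : Simplex n} {x : E n} (hx : x ∈ interior (body K)) (i j : Fin (n + 1)) :
    0 ≤ K.coord j x / (K.coord j x + K.coord i x) := by
  have h1 := mem_interior_body.1 hx i
  have h2 := mem_interior_body.1 hx j
  positivity

lemma ratio_le_one {K : Simplex n} {x : E n} (hx : x ∈ interior (body K)) (i j : Fin (n + 1)) :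
    K.coord j x / (K.coord j x + K.coord i x) ≤ 1 := by
  have h1 := mem_interior_body.1 hx i
  have h2 := mem_interior_body.1 hx j
  rw [div_le_one (by positivity)]
  linarith

/-- The differential is `(λ_i dλ_j - λ_j dλ_i) / (λ_j + λ_i)²`. One power of the denominator is
absorbed by the numerator, and the other one is a summand of `wt`. -/
lemma lift_ratio (K : Simplex n) {i j : Fin (n + 1)} (hij : j ≠ i) :
    Lift K (fun x => K.coord j x / (K.coord j x + K.coord i x)) := by
  have hne : ∀ x ∈ interior (body K), K.coord j x + K.coord i x ≠ 0 := fun x hx =>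
    (add_pos (mem_interior_body.1 hx j) (mem_interior_body.1 hx i)).ne'
  refine ⟨(contDiff_coord K j).contDiffOn.div
    ((contDiff_coord K j).add (contDiff_coord K i)).contDiffOn hne, 1 +
    (‖dcoord K j‖ + ‖dcoord K i‖), by positivity, fun x hx => ⟨?_, ?_⟩⟩
  · rw [abs_of_nonneg (ratio_nonneg hx i j)]
    have := ratio_le_one hx i j
    have h1 := norm_nonneg (dcoord K j)
    have h2 := norm_nonneg (dcoord K i)
    linarith
  · have hi := mem_interior_body.1 hx i
    have hj := mem_interior_body.1 hx j
    have hd : HasFDerivAt (fun x => K.coord j x / (K.coord j x + K.coord i x)) _ x :=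
      (hasFDerivAt_coord K j x).mul (HasDerivAt.comp_hasFDerivAt x
        (hasDerivAt_inv (hne x hx)) ((hasFDerivAt_coord K j x).add (hasFDerivAt_coord K i x)))
    rw [hd.fderiv]
    have key : K.coord j x • (-((K.coord j x + K.coord i x) ^ 2)⁻¹) • (dcoord K j + dcoord K i) +
        (K.coord j x + K.coord i x)⁻¹ • dcoord K j =
        (K.coord j x + K.coord i x)⁻¹ • ((K.coord i x / (K.coord j x + K.coord i x)) • dcoord K j
          - (K.coord j x / (K.coord j x + K.coord i x)) • dcoord K i) := by
      ext v
      have := hne x hx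
      simp only [add_apply, smul_apply,
        sub_apply, smul_eq_mul]
      field_simp
      ring
    refine (le_of_eq (congrArg norm key)).trans ?_
    rw [norm_smul, Real.norm_eq_abs, abs_of_nonneg (by positivity), mul_comm]
    refine mul_le_mul ?_ (inv_le_wt hx hij.symm) (by positivity) (by positivity)
    refine (norm_sub_le _ _).trans ?_
    rw [norm_smul, norm_smul, Real.norm_eq_abs, Real.norm_eq_abs,
      abs_of_nonneg (by positivity), abs_of_nonneg (by positivity)]
    have h1 : K.coord i x / (K.coord j x + K.coord i x) ≤ 1 := by
      rw [div_le_one (by positivity)]; linarith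
    have h2 := ratio_le_one hx i j
    have h3 := mul_le_of_le_one_left (norm_nonneg (dcoord K j)) h1
    have h4 := mul_le_of_le_one_left (norm_nonneg (dcoord K i)) h2
    linarith

lemma lift_faceLift (K : Simplex n) (i : Fin (n + 1)) : Lift K (faceLift K i) :=
  Lift.prod _ fun _ hj => lift_ratio K (Finset.ne_of_mem_erase hj)

/-! ### Boundary behaviour of the face lifts. -/

section bounds

variable {K : Simplex n} {x : E n}

lemma faceLift_nonneg (hx : x ∈ interior (body K)) (i : Fin (n + 1)) : 0 ≤ faceLift K i x :=
  Finset.prod_nonneg fun j _ => ratio_nonneg hx i j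

lemma faceLift_le_one (hx : x ∈ interior (body K)) (i : Fin (n + 1)) : faceLift K i x ≤ 1 :=
  Finset.prod_le_one (fun j _ => ratio_nonneg hx i j) fun j _ => ratio_le_one hx i j

lemma faceLift_le_ratio (hx : x ∈ interior (body K)) {i j : Fin (n + 1)} (hij : j ≠ i) :
    faceLift K i x ≤ K.coord j x / (K.coord j x + K.coord i x) := by
  rw [faceLift, ← Finset.mul_prod_erase _ _ (Finset.mem_erase.2 ⟨hij, Finset.mem_univ j⟩)]
  exact mul_le_of_le_one_right (ratio_nonneg hx i j)
    (Finset.prod_le_one (fun j _ => ratio_nonneg hx i j) fun j _ => ratio_le_one hx i j)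

lemma faceLift_le_coord_mul_wt (hx : x ∈ interior (body K)) {i j : Fin (n + 1)} (hij : j ≠ i) :
    faceLift K i x ≤ K.coord j x * wt K x := by
  refine (faceLift_le_ratio hx hij).trans ?_
  rw [div_eq_mul_inv]
  exact mul_le_mul_of_nonneg_left (inv_le_wt hx hij.symm) (mem_interior_body.1 hx j).le

/-- Here no weight is lost, since `λ_j λ_i / (λ_j + λ_i) ≤ λ_j`. Hence a function that is `O(λ_i)`
becomes, after multiplication by the face lift, `O(λ_j)` for every `j`. -/
lemma faceLift_mul_coord_le (hx : x ∈ interior (body K)) {i j : Fin (n + 1)} (hij : j ≠ i) :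
    faceLift K i x * K.coord i x ≤ K.coord j x := by
  have hi := mem_interior_body.1 hx i
  have hj := mem_interior_body.1 hx j
  refine (mul_le_mul_of_nonneg_right (faceLift_le_ratio hx hij) hi.le).trans ?_
  rw [div_mul_eq_mul_div, div_le_iff₀ (by positivity)]
  nlinarith [mul_pos hj hj]

lemma one_sub_prod_le {ι : Type*} (s : Finset ι) (a : ι → ℝ) (h0 : ∀ i ∈ s, 0 ≤ a i)
    (h1 : ∀ i ∈ s, a i ≤ 1) : 1 - ∏ i ∈ s, a i ≤ ∑ i ∈ s, (1 - a i) := by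
  classical
  induction s using Finset.induction_on with
  | empty => simp
  | insert i s hi ih =>
    rw [Finset.prod_insert hi, Finset.sum_insert hi]
    have := ih (fun j hj => h0 j (Finset.mem_insert_of_mem hj))
      (fun j hj => h1 j (Finset.mem_insert_of_mem hj))
    have hp : ∏ i ∈ s, a i ≤ 1 := Finset.prod_le_one
      (fun j hj => h0 j (Finset.mem_insert_of_mem hj))
      (fun j hj => h1 j (Finset.mem_insert_of_mem hj))
    nlinarith [h0 i (Finset.mem_insert_self _ _), h1 i (Finset.mem_insert_self _ _)]

/-- Each factor of the lift differs from `1` by `λ_i / (λ_j + λ_i)`, and by `one_sub_prod_le` these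
deficits add up. -/
lemma one_sub_faceLift_le (hx : x ∈ interior (body K)) (i : Fin (n + 1)) :
    1 - faceLift K i x ≤ K.coord i x * wt K x := by
  have hi := mem_interior_body.1 hx i
  refine (one_sub_prod_le _ _ (fun j _ => ratio_nonneg hx i j)
    fun j _ => ratio_le_one hx i j).trans ?_
  refine le_trans (le_of_eq ?_) (mul_le_mul_of_nonneg_left (sum_inv_le_wt hx i) hi.le)
  rw [Finset.mul_sum]
  refine Finset.sum_congr rfl fun j _ => ?_
  have hj := mem_interior_body.1 hx j
  field_simp
  ring

lemma abs_one_sub_faceLift_le (hx : x ∈ interior (body K)) (i : Fin (n + 1)) :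
    |1 - faceLift K i x| ≤ K.coord i x * wt K x := by
  rw [abs_of_nonneg (sub_nonneg.2 (faceLift_le_one hx i))]
  exact one_sub_faceLift_le hx i

/-- The face lifts form a partition of unity on the boundary: close to face `i` the `i`-th lift is
close to `1` and the `n` others are small. -/
lemma abs_one_sub_sum_faceLift_le (hx : x ∈ interior (body K)) (i : Fin (n + 1)) :
    |1 - ∑ j, faceLift K j x| ≤ (n + 1) * K.coord i x * wt K x := by
  have hi := mem_interior_body.1 hx i
  rw [← Finset.add_sum_erase _ _ (Finset.mem_univ i), ← sub_sub]
  refine (abs_sub _ _).trans ?_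
  have h1 := abs_one_sub_faceLift_le hx i
  have h2 : |∑ j ∈ Finset.univ.erase i, faceLift K j x| ≤ n * (K.coord i x * wt K x) := by
    refine (Finset.abs_sum_le_sum_abs _ _).trans ?_
    refine (Finset.sum_le_card_nsmul _ _ (K.coord i x * wt K x) fun j hj => ?_).trans ?_
    · rw [abs_of_nonneg (faceLift_nonneg hx j)]
      exact faceLift_le_coord_mul_wt hx (Finset.ne_of_mem_erase hj).symm
    · rw [Finset.card_erase_of_mem (Finset.mem_univ i), Finset.card_univ, Fintype.card_fin,
        nsmul_eq_mul]
      simp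
  linarith

end bounds

/-! ### Fields with normal traces on single faces -/

/-- A field `u` on `K` with integrable weak divergence `d` which is integrable against the
gradients of all lifts in the sense of `Lift`. -/
structure HasTraces (K : Simplex n) (u : E n → E n) (d : E n → ℝ) : Prop where
  hasWeakDiv : HasWeakDiv (interior (body K)) u d
  aestronglyMeasurable : AEStronglyMeasurable u (volume.restrict (interior (body K)))
  integrable_mul_wt : Integrable (fun x => (1 + ‖u x‖) * wt K x)
    (volume.restrict (interior (body K)))
  integrable_div : Integrable d (volume.restrict (interior (body K)))

/-- The integral `∫_K (u · ∇w + w div u)` of Green's formula. -/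
def pair (K : Simplex n) (u : E n → E n) (d w : E n → ℝ) : ℝ :=
  ∫ x in interior (body K), (fderiv ℝ w x (u x) + d x * w x)

lemma faceFlux_eq_pair (K : Simplex n) (i : Fin (n + 1)) (u : E n → E n) (d q : E n → ℝ) :
    faceFlux K i u d q = pair K u d (fun x => faceLift K i x * q x) :=
  (setIntegral_congr_set (interior_body_ae_eq K)).symm

lemma aesm_clm_apply {μ : Measure (E n)} {f : E n → (E n →L[ℝ] ℝ)} {u : E n → E n}
    (hf : AEStronglyMeasurable f μ) (hu : AEStronglyMeasurable u μ) :
    AEStronglyMeasurable (fun x => f x (u x)) μ :=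
  (ContinuousLinearMap.apply ℝ ℝ : E n →L[ℝ] _).flip.aestronglyMeasurable_comp₂ hf hu

/-! ### Integrability and bilinearity of Green's pairing. -/

section

variable {K : Simplex n} {u v : E n → E n} {d e w : E n → ℝ}

lemma Lift.aestronglyMeasurable (hw : Lift K w) :
    AEStronglyMeasurable w (volume.restrict (interior (body K))) :=
  hw.contDiffOn.continuousOn.aestronglyMeasurable (measurableSet_interior_body K)

lemma Lift.continuousOn_fderiv (hw : Lift K w) :
    ContinuousOn (fderiv ℝ w) (interior (body K)) :=
  hw.contDiffOn.continuousOn_fderiv_of_isOpen isOpen_interior (by simp)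

lemma HasTraces.integrable_fderiv (hu : HasTraces K u d) (hw : Lift K w) :
    Integrable (fun x => fderiv ℝ w x (u x)) (volume.restrict (interior (body K))) := by
  obtain ⟨C, hC, h⟩ := hw.bound
  refine (hu.integrable_mul_wt.const_mul C).mono' (aesm_clm_apply
    (hw.continuousOn_fderiv.aestronglyMeasurable (measurableSet_interior_body K))
    hu.aestronglyMeasurable) ?_
  filter_upwards [ae_restrict_mem (measurableSet_interior_body K)] with x hx
  refine ((fderiv ℝ w x).le_opNorm (u x)).trans ?_
  have h1 := (h x hx).2
  have h2 := one_le_wt hx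
  have h3 : 0 ≤ C * wt K x := by positivity
  nlinarith [mul_le_mul_of_nonneg_right h1 (norm_nonneg (u x))]

lemma HasTraces.integrable_mul (hu : HasTraces K u d) (hw : Lift K w) :
    Integrable (fun x => d x * w x) (volume.restrict (interior (body K))) := by
  obtain ⟨C, hC, h⟩ := hw.bound
  refine (hu.integrable_div.norm.const_mul C).mono'
    (hu.integrable_div.aestronglyMeasurable.mul hw.aestronglyMeasurable) ?_
  filter_upwards [ae_restrict_mem (measurableSet_interior_body K)] with x hx
  rw [norm_mul, mul_comm]
  exact mul_le_mul_of_nonneg_right (h x hx).1 (norm_nonneg _)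

lemma HasTraces.integrable_pair (hu : HasTraces K u d) (hw : Lift K w) :
    Integrable (fun x => fderiv ℝ w x (u x) + d x * w x)
      (volume.restrict (interior (body K))) :=
  (hu.integrable_fderiv hw).add (hu.integrable_mul hw)

lemma pair_congr_ae {K : Simplex n} {u v : E n → E n} {d e w : E n → ℝ}
    (h : u =ᵐ[volume.restrict (interior (body K))] v)
    (h' : d =ᵐ[volume.restrict (interior (body K))] e) : pair K u d w = pair K v e w := by
  refine integral_congr_ae ?_
  filter_upwards [h, h'] with x hx hx'
  rw [hx, hx']

lemma pair_congr_right {w z : E n → ℝ} (h : ∀ x ∈ interior (body K), w x = z x) :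
    pair K u d w = pair K u d z := by
  refine setIntegral_congr_fun (measurableSet_interior_body K) fun x hx => ?_
  have : w =ᶠ[𝓝 x] z := by
    filter_upwards [isOpen_interior.mem_nhds hx] with y hy using h y hy
  simp only [this.fderiv_eq, h x hx]

lemma pair_add_left (hu : HasTraces K u d) (hv : HasTraces K v e) (hw : Lift K w) :
    pair K (fun x => u x + v x) (fun x => d x + e x) w = pair K u d w + pair K v e w := by
  rw [pair, pair, pair, ← integral_add (hu.integrable_pair hw) (hv.integrable_pair hw)]
  refine integral_congr_ae (Eventually.of_forall fun x => ?_)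
  simp only [map_add]
  ring

lemma pair_smul_left (c : ℝ) : pair K (fun x => c • u x) (fun x => c * d x) w
    = c * pair K u d w := by
  rw [pair, pair, ← integral_const_mul]
  refine integral_congr_ae (Eventually.of_forall fun x => ?_)
  simp only [map_smul, smul_eq_mul]
  ring

lemma pair_add_right (hu : HasTraces K u d) {w z : E n → ℝ} (hw : Lift K w) (hz : Lift K z) :
    pair K u d (fun x => w x + z x) = pair K u d w + pair K u d z := by
  rw [pair, pair, pair, ← integral_add (hu.integrable_pair hw) (hu.integrable_pair hz)]
  refine setIntegral_congr_fun (measurableSet_interior_body K) fun x hx => ?_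
  simp only [fderiv_fun_add (hw.differentiableAt hx) (hz.differentiableAt hx), add_apply]
  ring

lemma pair_mul_right (hw : Lift K w) (c : ℝ) :
    pair K u d (fun x => c * w x) = c * pair K u d w := by
  rw [pair, pair, ← integral_const_mul]
  refine setIntegral_congr_fun (measurableSet_interior_body K) fun x hx => ?_
  simp only [fderiv_const_mul (hw.differentiableAt hx), smul_apply, smul_eq_mul]
  ring

lemma pair_sub_right (hu : HasTraces K u d) {w z : E n → ℝ} (hw : Lift K w) (hz : Lift K z) :
    pair K u d (fun x => w x - z x) = pair K u d w - pair K u d z := by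
  have h := pair_add_right hu hw (hz.const_mul (-1))
  rw [pair_mul_right hz] at h
  rw [sub_eq_add_neg, ← neg_one_mul (pair K u d z), ← h]
  exact pair_congr_right fun x _ => by ring

lemma pair_sum_right (hu : HasTraces K u d) {ι : Type*} (s : Finset ι) {w : ι → E n → ℝ}
    (hw : ∀ i ∈ s, Lift K (w i)) :
    pair K u d (fun x => ∑ i ∈ s, w i x) = ∑ i ∈ s, pair K u d (w i) := by
  classical
  induction s using Finset.induction_on with
  | empty => simp [pair]
  | insert a s ha ih =>
    simp only [Finset.sum_insert ha]
    rw [pair_add_right hu (hw a (Finset.mem_insert_self _ _))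
      (Lift.sum _ fun i hi => hw i (Finset.mem_insert_of_mem hi)),
      ih fun i hi => hw i (Finset.mem_insert_of_mem hi)]

end

/-! ### Cutoff near the boundary -/

/-- A smooth function which vanishes where `m λ_j ≤ 1` for some `j ∈ J`, and is `1` where
`m λ_j ≥ 2` for all `j ∈ J`. -/
def cutoff (K : Simplex n) (J : Finset (Fin (n + 1))) (m : ℕ) (x : E n) : ℝ :=
  ∏ j ∈ J, Real.smoothTransition (m * K.coord j x - 1)

lemma contDiff_cutoff (K : Simplex n) (J : Finset (Fin (n + 1))) (m : ℕ) :
    ContDiff ℝ ∞ (cutoff K J m) :=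
  contDiff_prod fun j _ => Real.smoothTransition.contDiff.comp
    ((contDiff_const.mul (contDiff_coord K j)).sub contDiff_const)

lemma cutoff_mem_Icc (K : Simplex n) (J : Finset (Fin (n + 1))) (m : ℕ) (x : E n) :
    cutoff K J m x ∈ Icc (0 : ℝ) 1 :=
  ⟨Finset.prod_nonneg fun _ _ => Real.smoothTransition.nonneg _,
    Finset.prod_le_one (fun _ _ => Real.smoothTransition.nonneg _)
      fun _ _ => Real.smoothTransition.le_one _⟩

lemma cutoff_eq_zero {K : Simplex n} {J : Finset (Fin (n + 1))} {m : ℕ} {x : E n}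
    {j : Fin (n + 1)} (hj : j ∈ J) (h : m * K.coord j x ≤ 1) : cutoff K J m x = 0 :=
  Finset.prod_eq_zero hj (Real.smoothTransition.zero_of_nonpos (by linarith))

lemma cutoff_eq_one {K : Simplex n} {J : Finset (Fin (n + 1))} {m : ℕ} {x : E n}
    (h : ∀ j ∈ J, 2 ≤ m * K.coord j x) : cutoff K J m x = 1 :=
  Finset.prod_eq_one fun j hj => Real.smoothTransition.one_of_one_le (by linarith [h j hj])

/-- The transition is constant for arguments above `1`, so only `t ≤ 2` matters. With `t = m λ_j`
this bounds `λ_j` times the gradient of the cutoff independently of `m`. -/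
lemma exists_abs_deriv_smoothTransition_mul_le :
    ∃ B : ℝ, 0 ≤ B ∧ ∀ t : ℝ, 0 ≤ t → |deriv Real.smoothTransition (t - 1)| * t ≤ B := by
  have hc : Continuous (deriv Real.smoothTransition) :=
    (Real.smoothTransition.contDiff (n := 1)).continuous_deriv le_rfl
  obtain ⟨B, hB⟩ := (isCompact_Icc (a := (-1 : ℝ)) (b := 1)).exists_bound_of_continuousOn
    hc.continuousOn
  have hB0 : 0 ≤ B := (norm_nonneg _).trans (hB 0 (by norm_num))
  refine ⟨B * 2, by positivity, fun t ht => ?_⟩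
  rcases le_or_gt t 2 with h | h
  · exact mul_le_mul (hB _ ⟨by linarith, by linarith⟩) h ht hB0
  · have : Real.smoothTransition =ᶠ[𝓝 (t - 1)] fun _ => 1 := by
      filter_upwards [lt_mem_nhds (show (1 : ℝ) < t - 1 by linarith)] with s hs
      exact Real.smoothTransition.one_of_one_le hs.le
    rw [this.deriv_eq]
    simp only [deriv_const, abs_zero, zero_mul]
    positivity

/-- The coefficient of `dcoord K j` in the differential of `cutoff K J m`. -/
def cutoffCoeff (K : Simplex n) (J : Finset (Fin (n + 1))) (m : ℕ) (j : Fin (n + 1)) (x : E n) :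
    ℝ :=
  (∏ k ∈ J.erase j, Real.smoothTransition (m * K.coord k x - 1)) *
    (deriv Real.smoothTransition (m * K.coord j x - 1) * m)

lemma continuous_cutoffCoeff (K : Simplex n) (J : Finset (Fin (n + 1))) (m : ℕ)
    (j : Fin (n + 1)) : Continuous (cutoffCoeff K J m j) := by
  have hc : Continuous (deriv Real.smoothTransition) :=
    (Real.smoothTransition.contDiff (n := 1)).continuous_deriv le_rfl
  have h : ∀ k, Continuous fun x => (m : ℝ) * K.coord k x - 1 := fun k =>
    (continuous_const.mul (continuous_coord K k)).sub continuous_const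
  exact (continuous_finsetProd _ fun k _ => Real.smoothTransition.continuous.comp (h k)).mul
    ((hc.comp (h j)).mul continuous_const)

lemma hasFDerivAt_cutoff (K : Simplex n) (J : Finset (Fin (n + 1))) (m : ℕ) (x : E n) :
    HasFDerivAt (cutoff K J m) (∑ j ∈ J, cutoffCoeff K J m j x • dcoord K j) x := by
  have h : ∀ j ∈ J, HasFDerivAt (fun y => Real.smoothTransition (m * K.coord j y - 1))
      ((deriv Real.smoothTransition (m * K.coord j x - 1)) • ((m : ℝ) • dcoord K j)) x :=
    fun j _ => HasDerivAt.comp_hasFDerivAt x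
      ((Real.smoothTransition.contDiff (n := 1)).differentiable (by simp) _).hasDerivAt
      (((hasFDerivAt_coord K j x).const_mul (m : ℝ)).sub_const 1)
  refine (HasFDerivAt.finsetProd h).congr_fderiv ?_
  refine Finset.sum_congr rfl fun j _ => ?_
  rw [cutoffCoeff, smul_smul, smul_smul, mul_assoc]

lemma abs_cutoffCoeff_mul_le {B : ℝ}
    (hB : ∀ t : ℝ, 0 ≤ t → |deriv Real.smoothTransition (t - 1)| * t ≤ B)
    {K : Simplex n} (J : Finset (Fin (n + 1))) (m : ℕ) (j : Fin (n + 1)) {x : E n}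
    (hx : x ∈ interior (body K)) : |cutoffCoeff K J m j x| * K.coord j x ≤ B := by
  have hj := mem_interior_body.1 hx j
  have h0 : 0 ≤ ∏ k ∈ J.erase j, Real.smoothTransition (m * K.coord k x - 1) :=
    Finset.prod_nonneg fun _ _ => Real.smoothTransition.nonneg _
  have h1 : ∏ k ∈ J.erase j, Real.smoothTransition (m * K.coord k x - 1) ≤ 1 :=
    Finset.prod_le_one (fun _ _ => Real.smoothTransition.nonneg _)
      fun _ _ => Real.smoothTransition.le_one _
  rw [cutoffCoeff, abs_mul, abs_mul, abs_of_nonneg h0, Nat.abs_cast, mul_assoc, mul_assoc]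
  have h2 := hB (m * K.coord j x) (by positivity)
  refine (mul_le_of_le_one_left (by positivity) h1).trans h2

lemma cutoffCoeff_eq_zero {K : Simplex n} {J : Finset (Fin (n + 1))} {m : ℕ} {x : E n}
    {j : Fin (n + 1)} (h : 2 < m * K.coord j x) : cutoffCoeff K J m j x = 0 := by
  have : Real.smoothTransition =ᶠ[𝓝 (m * K.coord j x - 1)] fun _ => 1 := by
    filter_upwards [lt_mem_nhds (show (1 : ℝ) < m * K.coord j x - 1 by linarith)] with s hs
    exact Real.smoothTransition.one_of_one_le hs.le
  rw [cutoffCoeff, this.deriv_eq]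
  simp

/-! ### Green's formula by removal of cutoffs. -/

section

variable {K : Simplex n} {u : E n → E n} {d w : E n → ℝ}

/-- The cutoff near the faces opposite to the vertices in `J` is negligible if the normal
component of `w u` vanishes on these faces. -/
lemma tendsto_pair_mul_cutoff (hu : HasTraces K u d) (hw : Lift K w) (J : Finset (Fin (n + 1)))
    (h : ∀ j ∈ J, ∃ C, ∀ x ∈ interior (body K),
      |w x * dcoord K j (u x)| ≤ C * K.coord j x * ((1 + ‖u x‖) * wt K x)) :
    Tendsto (fun m => pair K u d (fun x => w x * cutoff K J m x)) atTop
      (𝓝 (pair K u d w)) := by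
  obtain ⟨B, hB0, hB⟩ := exists_abs_deriv_smoothTransition_mul_le
  have h : ∀ j : Fin (n + 1), ∃ C, j ∈ J → ∀ x ∈ interior (body K),
      |w x * dcoord K j (u x)| ≤ C * K.coord j x * ((1 + ‖u x‖) * wt K x) := fun j => by
    by_cases hj : j ∈ J
    · exact (h j hj).imp fun C hC _ => hC
    · exact ⟨0, fun hj' => absurd hj' hj⟩
  choose C hC using h
  have hfd : ∀ m : ℕ, ∀ x ∈ interior (body K),
      fderiv ℝ (fun x => w x * cutoff K J m x) x (u x) + d x * (w x * cutoff K J m x)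
        = cutoff K J m x * (fderiv ℝ w x (u x) + d x * w x)
          + ∑ j ∈ J, cutoffCoeff K J m j x * (w x * dcoord K j (u x)) := by
    intro m x hx
    rw [fderiv_fun_mul (hw.differentiableAt hx) (hasFDerivAt_cutoff K J m x).differentiableAt,
      (hasFDerivAt_cutoff K J m x).fderiv]
    simp only [add_apply, smul_apply, smul_eq_mul, sum_apply, Finset.mul_sum]
    have : ∑ j ∈ J, w x * (cutoffCoeff K J m j x * dcoord K j (u x))
        = ∑ j ∈ J, cutoffCoeff K J m j x * (w x * dcoord K j (u x)) :=
      Finset.sum_congr rfl fun j _ => by ring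
    rw [this]
    ring
  have hpair : ∀ m : ℕ, pair K u d (fun x => w x * cutoff K J m x)
      = ∫ x in interior (body K), (cutoff K J m x * (fderiv ℝ w x (u x) + d x * w x)
          + ∑ j ∈ J, cutoffCoeff K J m j x * (w x * dcoord K j (u x))) := fun m =>
    setIntegral_congr_fun (measurableSet_interior_body K) fun x hx => hfd m x hx
  simp only [hpair]
  -- The factor `λ_j` granted by `h` compensates the size `1 / λ_j` of the gradient of the cutoff,
  -- so the majorant does not depend on `m`.
  refine tendsto_integral_of_dominated_convergence
    (fun x => ‖fderiv ℝ w x (u x) + d x * w x‖ + ∑ j ∈ J, B * C j * ((1 + ‖u x‖) * wt K x))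
    (fun m => ?_) ?_ (fun m => ?_) ?_
  · refine ((contDiff_cutoff K J m).continuous.aestronglyMeasurable.mul
      (hu.integrable_pair hw).aestronglyMeasurable).add
      (Finset.aestronglyMeasurable_fun_sum _ fun j _ =>
      (continuous_cutoffCoeff K J m j).aestronglyMeasurable.mul
      (hw.aestronglyMeasurable.mul
        ((dcoord K j).continuous.comp_aestronglyMeasurable hu.aestronglyMeasurable)))
  · exact (hu.integrable_pair hw).norm.add
      (integrable_finsetSum _ fun j _ => hu.integrable_mul_wt.const_mul _)
  · filter_upwards [ae_restrict_mem (measurableSet_interior_body K)] with x hx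
    refine (norm_add_le _ _).trans (add_le_add ?_ ((norm_sum_le _ _).trans
      (Finset.sum_le_sum fun j hj => ?_)))
    · rw [norm_mul]
      refine mul_le_of_le_one_left (norm_nonneg _) ?_
      have := cutoff_mem_Icc K J m x
      rw [Real.norm_eq_abs, abs_of_nonneg this.1]
      exact this.2
    · rw [norm_mul, Real.norm_eq_abs, Real.norm_eq_abs]
      have h1 := hC j hj x hx
      have h2 := abs_cutoffCoeff_mul_le hB J m j hx
      have hj' := mem_interior_body.1 hx j
      have h3 : 0 ≤ C j * ((1 + ‖u x‖) * wt K x) := by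
        have h4 := (abs_nonneg _).trans h1
        have : C j * K.coord j x * ((1 + ‖u x‖) * wt K x)
          = K.coord j x * (C j * ((1 + ‖u x‖) * wt K x)) := by ring
        rw [this] at h4
        exact nonneg_of_mul_nonneg_right h4 hj'
      calc _ ≤ |cutoffCoeff K J m j x| * (C j * K.coord j x * ((1 + ‖u x‖) * wt K x)) :=
            mul_le_mul_of_nonneg_left h1 (abs_nonneg _)
        _ = (|cutoffCoeff K J m j x| * K.coord j x) * (C j * ((1 + ‖u x‖) * wt K x)) := by ring
        _ ≤ B * (C j * ((1 + ‖u x‖) * wt K x)) := mul_le_mul_of_nonneg_right h2 h3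
        _ = _ := by ring
  · filter_upwards [ae_restrict_mem (measurableSet_interior_body K)] with x hx
    refine tendsto_const_nhds.congr' ?_
    -- At a fixed interior point all `λ_j` are positive, so for large `m` the cutoff equals `1` and
    -- its gradient vanishes.
    have : ∀ᶠ m : ℕ in atTop, ∀ j : Fin (n + 1), 2 < m * K.coord j x := by
      rw [eventually_all]
      intro j
      have hj := mem_interior_body.1 hx j
      exact (tendsto_natCast_atTop_atTop.atTop_mul_const hj).eventually_gt_atTop 2
    filter_upwards [this] with m hm
    rw [cutoff_eq_one fun j _ => (hm j).le, Finset.sum_eq_zero fun j _ => by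
      rw [cutoffCoeff_eq_zero (hm j), zero_mul]]
    ring

/-- With the cutoff near all faces, `w` becomes a smooth function with compact support in the
interior, which is an admissible test function for the weak divergence. -/
lemma pair_mul_cutoff_univ (hu : HasWeakDiv (interior (body K)) u d)
    (hw : ContDiffOn ℝ ∞ w (interior (body K)))
    (hi : ∀ z : E n → ℝ, ContDiff ℝ ∞ z → Integrable (fun x => fderiv ℝ z x (u x))
      (volume.restrict (interior (body K))))
    (hi' : ∀ z : E n → ℝ, ContDiff ℝ ∞ z → Integrable (fun x => d x * z x)
      (volume.restrict (interior (body K)))) (m : ℕ) :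
    pair K u d (fun x => w x * cutoff K Finset.univ m x) = 0 := by
  set φ : E n → ℝ := fun x => w x * cutoff K Finset.univ m x with hφ
  -- Outside this closed subset of the interior some factor of the cutoff is zero. For `m = 0` the
  -- set is empty.
  set F : Set (E n) := {x | ∀ j, 1 ≤ m * K.coord j x} with hF
  have hFc : IsClosed F := by
    rw [hF, ofPred_forall]
    exact isClosed_iInter fun j =>
      isClosed_le continuous_const (continuous_const.mul (continuous_coord K j))
  have hFU : F ⊆ interior (body K) := fun x hx => mem_interior_body.2 fun j => by
    have := hx j
    by_contra hc
    nlinarith [(Nat.cast_nonneg m : (0 : ℝ) ≤ m)]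
  have hsupp : Function.support φ ⊆ F := fun x hx j => by
    by_contra hc
    exact hx (by simp only [hφ, cutoff_eq_zero (Finset.mem_univ j) (not_le.1 hc).le, mul_zero])
  have hts : tsupport φ ⊆ F := closure_minimal hsupp hFc
  have hcomp : HasCompactSupport φ :=
    HasCompactSupport.of_support_subset_isCompact (isCompact_body K)
      (hsupp.trans (hFU.trans interior_subset))
  have hsm : ContDiff ℝ ∞ φ := by
    rw [contDiff_iff_contDiffAt]
    intro x
    by_cases hx : x ∈ F
    · exact (hw.contDiffAt (isOpen_interior.mem_nhds (hFU hx))).mul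
        (contDiff_cutoff K _ m).contDiffAt
    · refine ContDiffAt.congr_of_eventuallyEq (f := fun _ => 0) contDiffAt_const ?_
      filter_upwards [hFc.isOpen_compl.mem_nhds hx] with y hy
      by_contra hc
      exact hy (hsupp hc)
  have h := hu φ hsm hcomp (hts.trans hFU)
  rw [pair, integral_add (hi φ hsm) (hi' φ hsm), h]
  ring

/-- Green's formula without boundary term, for a lift `w` such that the normal component of
`w u` vanishes on the boundary. -/
lemma pair_eq_zero (hu : HasTraces K u d) (hw : Lift K w)
    (h : ∀ j, ∃ C, ∀ x ∈ interior (body K),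
      |w x * dcoord K j (u x)| ≤ C * K.coord j x * ((1 + ‖u x‖) * wt K x)) :
    pair K u d w = 0 := by
  refine tendsto_nhds_unique (tendsto_pair_mul_cutoff hu hw Finset.univ fun j _ => h j) ?_
  simp only [pair_mul_cutoff_univ hu.hasWeakDiv hw.contDiffOn
    (fun z hz => hu.integrable_fderiv (Lift.of_contDiff hz))
    (fun z hz => hu.integrable_mul (Lift.of_contDiff hz))]
  exact tendsto_const_nhds

/-- This and the next lemma are the two ways to meet the hypothesis of `pair_eq_zero` at face `j`:
either the lift is small there, or the normal component of `u` is. -/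
lemma abs_mul_dcoord_le {C a : ℝ} {x : E n} (j : Fin (n + 1)) (hx : x ∈ interior (body K))
    (h : |a| ≤ C * K.coord j x * wt K x) :
    |a * dcoord K j (u x)| ≤ C * ‖dcoord K j‖ * K.coord j x * ((1 + ‖u x‖) * wt K x) := by
  have hw := one_le_wt hx
  have h0 := (abs_nonneg a).trans h
  have h1 : |dcoord K j (u x)| ≤ ‖dcoord K j‖ * (1 + ‖u x‖) :=
    ((dcoord K j).le_opNorm (u x)).trans
      (mul_le_mul_of_nonneg_left (by linarith) (norm_nonneg _))
  rw [abs_mul]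
  refine (mul_le_mul h h1 (abs_nonneg _) h0).trans (le_of_eq (by ring))

lemma abs_mul_dcoord_le' {C D a : ℝ} {x : E n} (j : Fin (n + 1)) (hx : x ∈ interior (body K))
    (ha : |a| ≤ D) (h : |dcoord K j (u x)| ≤ C * K.coord j x) :
    |a * dcoord K j (u x)| ≤ D * C * K.coord j x * ((1 + ‖u x‖) * wt K x) := by
  have hw := one_le_wt hx
  have h0 := (abs_nonneg _).trans h
  have hD := (abs_nonneg _).trans ha
  rw [abs_mul]
  calc _ ≤ D * (C * K.coord j x) := mul_le_mul ha h (abs_nonneg _) hD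
    _ ≤ D * (C * K.coord j x) * ((1 + ‖u x‖) * wt K x) := by
      refine le_mul_of_one_le_right (mul_nonneg hD h0) ?_
      nlinarith [norm_nonneg (u x)]
    _ = _ := by ring

end

/-! ### Fluxes through single faces -/

section

variable {K : Simplex n} {u v : E n → E n} {d e g : E n → ℝ}

lemma exists_abs_le_of_continuous (K : Simplex n) (hg : Continuous g) :
    ∃ C, 0 ≤ C ∧ ∀ x ∈ interior (body K), |g x| ≤ C := by
  obtain ⟨C, hC⟩ := (isCompact_body K).exists_bound_of_continuousOn hg.continuousOn
  exact ⟨max C 0, le_max_right _ _, fun x hx =>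
    (hC x (interior_subset hx)).trans (le_max_left _ _)⟩

/-- A smooth function which vanishes on a face is bounded by a multiple of the corresponding
barycentric coordinate. -/
lemma exists_abs_le_mul_coord (hn : 1 ≤ n) (hg : ContDiff ℝ ∞ g) (i : Fin (n + 1))
    (h : ∀ x ∈ body K, K.coord i x = 0 → g x = 0) :
    ∃ C, 0 ≤ C ∧ ∀ x ∈ interior (body K), |g x| ≤ C * K.coord i x := by
  obtain ⟨j, hj⟩ : ∃ j, j ≠ i := by
    have : Nontrivial (Fin (n + 1)) := Fin.nontrivial_iff_two_le.2 (by omega)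
    exact exists_ne i
  obtain ⟨D, hD⟩ := (isCompact_body K).exists_bound_of_continuousOn
    (hg.continuous_fderiv (by simp)).continuousOn
  refine ⟨max D 0 * ‖K j - K i‖, by positivity, fun x hx => ?_⟩
  have hx' := mem_interior_body.1 hx
  -- The point `x` is pushed parallel to the edge from `v_i` to `v_j` until `λ_i = 0`. The gain goes
  -- to `λ_j`, so `y` stays in the simplex, and the mean value inequality applies on a segment of
  -- length `λ_i(x) ‖v_j - v_i‖`.
  set y : E n := x + K.coord i x • (K j - K i) with hy
  have hcoord : ∀ k, K.coord k y = K.coord k x + K.coord i x *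
      ((if k = j then 1 else 0) - (if k = i then 1 else 0)) := fun k => by
    rw [coord_eq K k y x, hy, add_sub_cancel_left, map_smul, smul_eq_mul, add_comm]
    congr 2
    have := coord_eq K k (K j) (K i)
    rw [K.coord_apply, K.coord_apply] at this
    linarith
  have hyi : K.coord i y = 0 := by
    rw [hcoord, if_neg hj.symm, if_pos rfl]; ring
  have hyb : y ∈ body K := mem_body.2 fun k => by
    by_cases hk : k = i
    · rw [hk, hyi]
    · rw [hcoord, if_neg hk]
      have h1 := (hx' k).le
      have h2 := (hx' i).le
      split_ifs <;> nlinarith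
  have := (convex_convexHull ℝ (Set.range K)).norm_image_sub_le_of_norm_fderiv_le
    (f := g) (C := max D 0) (x := y) (y := x)
    (fun z _ => (hg.differentiable (by simp)).differentiableAt)
    (fun z hz => (hD z hz).trans (le_max_left _ _)) hyb (interior_subset hx)
  rw [h y hyb hyi, sub_zero] at this
  refine this.trans (le_of_eq ?_)
  rw [hy, sub_add_cancel_left, norm_neg, norm_smul, Real.norm_eq_abs, abs_of_pos (hx' i)]
  ring

/-- The product of the lift and `g` tends to zero at every face: at face `i` because of `g`, at the
others because of the lift. So the flux depends only on the values of the test function on the face.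
-/
lemma faceFlux_eq_zero (hn : 1 ≤ n) (hu : HasTraces K u d) (hg : ContDiff ℝ ∞ g)
    (i : Fin (n + 1)) (h : ∀ x ∈ body K, K.coord i x = 0 → g x = 0) :
    faceFlux K i u d g = 0 := by
  obtain ⟨C, hC, hgC⟩ := exists_abs_le_mul_coord hn hg i h
  rw [faceFlux_eq_pair]
  refine pair_eq_zero hu ((lift_faceLift K i).mul (Lift.of_contDiff hg)) fun j =>
    ⟨C * ‖dcoord K j‖, fun x hx => abs_mul_dcoord_le j hx ?_⟩
  have hw := one_le_wt hx
  have h1 := mem_interior_body.1 hx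
  have h2 : |faceLift K i x * g x| ≤ C * K.coord j x := by
    rw [abs_mul, abs_of_nonneg (faceLift_nonneg hx i)]
    refine (mul_le_mul_of_nonneg_left (hgC x hx) (faceLift_nonneg hx i)).trans ?_
    rw [mul_left_comm]
    refine mul_le_mul_of_nonneg_left ?_ hC
    by_cases hij : j = i
    · rw [hij]
      exact mul_le_of_le_one_left (h1 i).le (faceLift_le_one hx i)
    · exact faceLift_mul_coord_le hx hij
  exact h2.trans (le_mul_of_one_le_right (mul_nonneg hC (h1 j).le) hw)

/-- By `abs_one_sub_sum_faceLift_le` the function `g - ∑ faceLift · g` vanishes on the boundary, so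
Green's formula has no boundary term for it. -/
lemma sum_faceFlux (hu : HasTraces K u d) (hg : ContDiff ℝ ∞ g) :
    ∑ i, faceFlux K i u d g = pair K u d g := by
  obtain ⟨C, hC, hgC⟩ := exists_abs_le_of_continuous K hg.continuous
  have hl : Lift K fun x => ∑ i, faceLift K i x * g x :=
    Lift.sum _ fun i _ => (lift_faceLift K i).mul (Lift.of_contDiff hg)
  have h : pair K u d (fun x => g x - ∑ i, faceLift K i x * g x) = 0 := by
    refine pair_eq_zero hu ((Lift.of_contDiff hg).sub hl) fun j =>
      ⟨C * (n + 1) * ‖dcoord K j‖, fun x hx => abs_mul_dcoord_le j hx ?_⟩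
    rw [← Finset.sum_mul, ← one_sub_mul, abs_mul, mul_comm, mul_assoc, mul_assoc, ← mul_assoc _ _ (wt K x)]
    exact mul_le_mul (hgC x hx) (abs_one_sub_sum_faceLift_le hx j) (abs_nonneg _) hC
  rw [pair_sub_right hu (Lift.of_contDiff hg) hl, pair_sum_right hu _
    fun i _ => (lift_faceLift K i).mul (Lift.of_contDiff hg), sub_eq_zero] at h
  rw [h]
  exact Finset.sum_congr rfl fun i _ => faceFlux_eq_pair K i u d g

/-- If the normal component of `g u` vanishes on all faces but one, then the flux of `g u` through
this face is the flux through the whole boundary. -/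
lemma faceFlux_eq_pair_of_le (hu : HasTraces K u d) (hg : ContDiff ℝ ∞ g) (i : Fin (n + 1))
    (h : ∀ j, j ≠ i → ∃ C, ∀ x ∈ interior (body K),
      |g x| ≤ C * K.coord j x ∨ |dcoord K j (u x)| ≤ C * K.coord j x) :
    faceFlux K i u d g = pair K u d g := by
  obtain ⟨C, hC, hgC⟩ := exists_abs_le_of_continuous K hg.continuous
  have hl := (lift_faceLift K i).mul (Lift.of_contDiff (K := K) hg)
  have h : pair K u d (fun x => g x - faceLift K i x * g x) = 0 := by
    refine pair_eq_zero hu ((Lift.of_contDiff hg).sub hl) fun j => ?_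
    have habs : ∀ x ∈ interior (body K), |1 - faceLift K i x| ≤ 1 := fun x hx => by
      rw [abs_of_nonneg (sub_nonneg.2 (faceLift_le_one hx i))]
      linarith [faceLift_nonneg hx i]
    by_cases hj : j = i
    · subst hj
      refine ⟨C * ‖dcoord K j‖, fun x hx => abs_mul_dcoord_le j hx ?_⟩
      rw [← one_sub_mul, abs_mul, mul_comm, mul_assoc]
      exact mul_le_mul (hgC x hx) (abs_one_sub_faceLift_le hx j) (abs_nonneg _) hC
    · obtain ⟨D, hD⟩ := h j hj
      refine ⟨max (D * ‖dcoord K j‖) (C * D), fun x hx => ?_⟩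
      have hj' := mem_interior_body.1 hx j
      have hw := one_le_wt hx
      have hfac : 0 ≤ K.coord j x * ((1 + ‖u x‖) * wt K x) := by positivity
      have hmul : ∀ a b : ℝ, a * K.coord j x * ((1 + ‖u x‖) * wt K x) ≤
          max a b * K.coord j x * ((1 + ‖u x‖) * wt K x) ∧
          b * K.coord j x * ((1 + ‖u x‖) * wt K x) ≤
          max a b * K.coord j x * ((1 + ‖u x‖) * wt K x) := fun a b => by
        rw [mul_assoc, mul_assoc, mul_assoc]
        exact ⟨mul_le_mul_of_nonneg_right (le_max_left _ _) hfac,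
          mul_le_mul_of_nonneg_right (le_max_right _ _) hfac⟩
      have hle : |g x - faceLift K i x * g x| ≤ |g x| := by
        rw [← one_sub_mul, abs_mul]
        exact mul_le_of_le_one_left (abs_nonneg _) (habs x hx)
      rcases hD x hx with h1 | h1
      · refine (abs_mul_dcoord_le j hx ((hle.trans h1).trans
          (le_mul_of_one_le_right ((abs_nonneg _).trans h1) hw))).trans (hmul _ _).1
      · exact (abs_mul_dcoord_le' j hx (hle.trans (hgC x hx)) h1).trans (hmul _ _).2
  rw [pair_sub_right hu (Lift.of_contDiff hg) hl, sub_eq_zero] at h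
  rw [h, faceFlux_eq_pair]

/-- At face `i` the normal component of the field vanishes, at the other faces the lift does. -/
lemma faceFlux_eq_zero_of_normal (hu : HasTraces K u d) (hg : ContDiff ℝ ∞ g) (i : Fin (n + 1))
    (h : ∃ C, ∀ x ∈ interior (body K), |dcoord K i (u x)| ≤ C * K.coord i x) :
    faceFlux K i u d g = 0 := by
  obtain ⟨C, hC, hgC⟩ := exists_abs_le_of_continuous K hg.continuous
  obtain ⟨D, hD⟩ := h
  have hle : ∀ x ∈ interior (body K), |faceLift K i x * g x| ≤ C := fun x hx => by
    rw [abs_mul, abs_of_nonneg (faceLift_nonneg hx i)]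
    exact (mul_le_of_le_one_left (abs_nonneg _) (faceLift_le_one hx i)).trans (hgC x hx)
  rw [faceFlux_eq_pair]
  refine pair_eq_zero hu ((lift_faceLift K i).mul (Lift.of_contDiff hg)) fun j => ?_
  by_cases hj : j = i
  · subst hj
    exact ⟨C * D, fun x hx => abs_mul_dcoord_le' j hx (hle x hx) (hD x hx)⟩
  · refine ⟨C * ‖dcoord K j‖, fun x hx => abs_mul_dcoord_le j hx ?_⟩
    rw [abs_mul, abs_of_nonneg (faceLift_nonneg hx i), mul_comm, mul_assoc]
    exact mul_le_mul (hgC x hx) (faceLift_le_coord_mul_wt hx hj) (faceLift_nonneg hx i) hC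

/-- The lift already vanishes on the faces where the cutoff acts. This reduces statements about
fluxes to test functions supported away from the relative boundary of the face, which can be
extended to neighbouring cells. -/
lemma tendsto_faceFlux_cutoff (hu : HasTraces K u d) (hg : ContDiff ℝ ∞ g) (i : Fin (n + 1)) :
    Tendsto (fun m => faceFlux K i u d (fun x => g x * cutoff K (Finset.univ.erase i) m x)) atTop
      (𝓝 (faceFlux K i u d g)) := by
  obtain ⟨C, hC, hgC⟩ := exists_abs_le_of_continuous K hg.continuous
  simp only [faceFlux_eq_pair, ← mul_assoc]
  refine tendsto_pair_mul_cutoff hu ((lift_faceLift K i).mul (Lift.of_contDiff hg)) _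
    fun j hj => ⟨C * ‖dcoord K j‖, fun x hx => abs_mul_dcoord_le j hx ?_⟩
  rw [abs_mul, abs_of_nonneg (faceLift_nonneg hx i), mul_comm, mul_assoc]
  exact mul_le_mul (hgC x hx) (faceLift_le_coord_mul_wt hx (Finset.ne_of_mem_erase hj))
    (faceLift_nonneg hx i) hC

/-! ### Linearity of the flux -/

lemma faceFlux_congr_ae {K : Simplex n} {u v : E n → E n} {d e g : E n → ℝ} (i : Fin (n + 1))
    (h : u =ᵐ[volume.restrict (interior (body K))] v)
    (h' : d =ᵐ[volume.restrict (interior (body K))] e) :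
    faceFlux K i u d g = faceFlux K i v e g := by
  rw [faceFlux_eq_pair, faceFlux_eq_pair, pair_congr_ae h h']

lemma faceFlux_add_left (hu : HasTraces K u d) (hv : HasTraces K v e) (hg : ContDiff ℝ ∞ g)
    (i : Fin (n + 1)) :
    faceFlux K i (fun x => u x + v x) (fun x => d x + e x) g
      = faceFlux K i u d g + faceFlux K i v e g := by
  simp only [faceFlux_eq_pair]
  exact pair_add_left hu hv ((lift_faceLift K i).mul (Lift.of_contDiff hg))

lemma faceFlux_smul_left (c : ℝ) (i : Fin (n + 1)) :
    faceFlux K i (fun x => c • u x) (fun x => c * d x) g = c * faceFlux K i u d g := by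
  simp only [faceFlux_eq_pair]
  exact pair_smul_left c

lemma faceFlux_add_right (hu : HasTraces K u d) {f g : E n → ℝ} (hf : ContDiff ℝ ∞ f)
    (hg : ContDiff ℝ ∞ g) (i : Fin (n + 1)) :
    faceFlux K i u d (fun x => f x + g x) = faceFlux K i u d f + faceFlux K i u d g := by
  simp only [faceFlux_eq_pair, mul_add]
  exact pair_add_right hu ((lift_faceLift K i).mul (Lift.of_contDiff hf))
    ((lift_faceLift K i).mul (Lift.of_contDiff hg))

lemma faceFlux_mul_right (hg : ContDiff ℝ ∞ g) (c : ℝ) (i : Fin (n + 1)) :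
    faceFlux K i u d (fun x => c * g x) = c * faceFlux K i u d g := by
  simp only [faceFlux_eq_pair, mul_left_comm _ c]
  exact pair_mul_right ((lift_faceLift K i).mul (Lift.of_contDiff hg)) c

end

/-! ### Integrability of the weight -/

lemma eq_zero_of_dcoord_eq_zero (K : Simplex n) {v : E n} (h : ∀ i, dcoord K i v = 0) : v = 0 :=
  K.ext_elem fun i => by simpa [h i] using coord_eq K i v 0

lemma eq_zero_of_dcoord_eq_zero_of_ne (K : Simplex n) (i : Fin (n + 1)) {v : E n}
    (h : ∀ j, j ≠ i → dcoord K j v = 0) : v = 0 := by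
  refine eq_zero_of_dcoord_eq_zero K fun j => ?_
  by_cases hj : j = i
  · have h1 := congrArg (fun f => f v) (sum_dcoord K)
    simp only [sum_apply, zero_apply] at h1
    rw [← Finset.add_sum_erase _ _ (Finset.mem_univ i),
      Finset.sum_eq_zero fun j hj => h j (Finset.ne_of_mem_erase hj), add_zero] at h1
    rw [hj, h1]
  · exact h j hj

/-- The barycentric coordinates with one index left out, as linear coordinates. -/
def dcoordEquiv (K : Simplex n) (m : Fin (n + 1)) : E n ≃L[ℝ] ({k : Fin (n + 1) // k ≠ m} → ℝ) :=
  (LinearEquiv.ofInjectiveOfFinrankEq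
    (LinearMap.pi fun k : {k : Fin (n + 1) // k ≠ m} => (dcoord K k.1 : E n →ₗ[ℝ] ℝ))
    (by
      rw [← LinearMap.ker_eq_bot, LinearMap.ker_eq_bot']
      intro v hv
      exact eq_zero_of_dcoord_eq_zero_of_ne K m fun j hj => congrFun hv ⟨j, hj⟩)
    (by simp)).toContinuousLinearEquiv

/-- With one index left out, the barycentric coordinates are affine coordinates on `ℝⁿ`, and the
claim is Fubini's theorem in these coordinates. -/
lemma integrable_prod_coord (K : Simplex n) (m : Fin (n + 1))
    {h : {k : Fin (n + 1) // k ≠ m} → ℝ → ℝ} (hh : ∀ k, Integrable (h k)) :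
    Integrable (fun x : E n => ∏ k, h k (K.coord k.1 x)) := by
  have h1 : Integrable (fun y : {k : Fin (n + 1) // k ≠ m} → ℝ => ∏ k, h k (y k)) volume :=
    Integrable.fintype_prod hh
  have h2 := h1.comp_add_right (fun k => K.coord k.1 0)
  set L := dcoordEquiv K m
  have hL : (Measure.map L (volume : Measure (E n))).IsAddHaarMeasure :=
    L.isAddHaarMeasure_map volume
  have h3 := h2.smul_measure_nnreal (c := Measure.addHaarScalarFactor (Measure.map L volume)
    (volume : Measure ({k : Fin (n + 1) // k ≠ m} → ℝ)))
  -- The image of Lebesgue measure under a linear isomorphism is a Haar measure, hence a multiple of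
  -- Lebesgue measure.
  rw [← Measure.isAddLeftInvariant_eq_smul] at h3
  have h4 := (integrable_map_equiv L.toHomeomorph.toMeasurableEquiv _).1 h3
  refine h4.congr (Eventually.of_forall fun x => ?_)
  refine Finset.prod_congr rfl fun k _ => ?_
  have := coord_eq K k.1 x 0
  rw [sub_zero] at this
  rw [this]
  rfl

/-- Since `(λ_i + λ_j)² ≥ λ_i λ_j`, the `s`-th power is at most `λ_i^(-s/2) λ_j^(-s/2)`. In
coordinates that include `λ_i` and `λ_j`, this is a product of functions integrable on `(0, 1]`
because `s / 2 < 1`. -/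
lemma memLp_inv_coord_add (K : Simplex n) {i j : Fin (n + 1)} (hij : j ≠ i) {s : ℝ} (hs : 1 ≤ s)
    (hs' : s < 2) : MemLp (fun x => (K.coord i x + K.coord j x)⁻¹) (ENNReal.ofReal s)
      (volume.restrict (interior (body K))) := by
  have hmeas : AEStronglyMeasurable (fun x => (K.coord i x + K.coord j x)⁻¹)
      (volume.restrict (interior (body K))) :=
    (((continuous_coord K i).add (continuous_coord K j)).measurable.inv).aestronglyMeasurable
  -- A third index is needed as the one left out. Without it `n = 1`, and `λ_i + λ_j` is identically
  -- `1`.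
  by_cases hm : ∃ m, m ≠ i ∧ m ≠ j
  · obtain ⟨m, hmi, hmj⟩ := hm
    rw [← integrable_norm_rpow_iff hmeas (by simp; linarith) (by simp),
      ENNReal.toReal_ofReal (by linarith)]
    set h : {k : Fin (n + 1) // k ≠ m} → ℝ → ℝ := fun k =>
      (Ioc 0 1).indicator fun t => if k.1 = i ∨ k.1 = j then t ^ (-s / 2) else 1 with hh
    have hint : ∀ k, Integrable (h k) := fun k => by
      rw [hh, integrable_indicator_iff measurableSet_Ioc]
      have h1 : IntegrableOn (fun t : ℝ => t ^ (-s / 2)) (Ioc 0 1) := by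
        rw [← intervalIntegrable_iff_integrableOn_Ioc_of_le zero_le_one]
        exact intervalIntegral.intervalIntegrable_rpow' (by linarith)
      by_cases hk : k.1 = i ∨ k.1 = j
      · simpa only [hk, if_true] using h1
      · simp only [hk, if_false]
        exact integrableOn_const (by simp)
    have hp := (integrable_prod_coord K m hint).integrableOn (s := interior (body K))
    refine hp.mono' (hmeas.norm.aemeasurable.pow_const s).aestronglyMeasurable ?_
    filter_upwards [ae_restrict_mem (measurableSet_interior_body K)] with x hx
    have hx' := mem_interior_body.1 hx
    have hi := hx' i
    have hj := hx' j
    have hval : ∀ k : {k : Fin (n + 1) // k ≠ m}, h k (K.coord k.1 x)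
        = if k.1 = i ∨ k.1 = j then K.coord k.1 x ^ (-s / 2) else 1 := fun k => by
      rw [hh]
      simp only
      rw [indicator_of_mem]
      exact ⟨hx' k.1, coord_le_one_of_mem_body (interior_subset hx) k.1⟩
    have hprod : ∏ k, h k (K.coord k.1 x)
        = K.coord i x ^ (-s / 2) * K.coord j x ^ (-s / 2) := by
      have hne : (⟨i, hmi.symm⟩ : {k : Fin (n + 1) // k ≠ m}) ≠ ⟨j, hmj.symm⟩ :=
        fun hc => hij (congrArg Subtype.val hc).symm
      rw [Finset.prod_eq_mul _ _ hne (fun k _ hk => ?_) (by simp) (by simp), hval, hval]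
      · simp
      · rw [hval, if_neg]
        rintro (hk' | hk')
        · exact hk.1 (Subtype.ext hk')
        · exact hk.2 (Subtype.ext hk')
    have hinv : 0 ≤ (K.coord i x + K.coord j x)⁻¹ := by positivity
    rw [hprod, ← Real.mul_rpow hi.le hj.le, Real.norm_eq_abs, Real.norm_eq_abs,
      abs_of_nonneg hinv, abs_of_nonneg (Real.rpow_nonneg hinv s), Real.inv_rpow (by positivity),
      ← Real.rpow_neg (by positivity), show -s = 2 * (-s / 2) by ring,
      Real.rpow_mul (by positivity), show 2 * (-s / 2) / 2 = -s / 2 by ring]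
    refine (Real.rpow_le_rpow_iff_of_neg (by positivity) (by positivity) (by linarith)).2 ?_
    rw [Real.rpow_two]
    nlinarith [mul_pos hi hj, mul_pos hi hi, mul_pos hj hj]
  · push Not at hm
    refine MemLp.of_bound hmeas 1 (Eventually.of_forall fun x => ?_)
    have huniv : (Finset.univ : Finset (Fin (n + 1))) = {i, j} := by
      ext k
      simp only [Finset.mem_univ, Finset.mem_insert, Finset.mem_singleton, true_iff]
      by_cases hk : k = i
      · exact Or.inl hk
      · exact Or.inr (hm k hk)
    have := sum_coord K x
    rw [huniv, Finset.sum_pair hij.symm] at this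
    rw [this]
    simp

lemma memLp_wt (K : Simplex n) {s : ℝ} (hs : 1 ≤ s) (hs' : s < 2) :
    MemLp (wt K) (ENNReal.ofReal s) (volume.restrict (interior (body K))) :=
  MemLp.add (f := fun _ => (1 : ℝ)) (memLp_const (1 : ℝ))
    (memLp_finsetSum _ fun _ _ => memLp_finsetSum _ fun _ hj =>
      memLp_inv_coord_add K (Finset.ne_of_mem_erase hj) hs hs')

lemma integrable_mul_wt (K : Simplex n) {u : E n → E n} {p : ENNReal} (hp : 2 < p)
    (hu : MemLp u p (volume.restrict (interior (body K)))) :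
    Integrable (fun x => (1 + ‖u x‖) * wt K x) (volume.restrict (interior (body K))) := by
  -- As `p` may be infinite, Hölder's inequality is used with a finite exponent `q` between `2` and
  -- `p`. Its conjugate exponent is less than `2`.
  obtain ⟨q, hq, hqp⟩ := ENNReal.lt_iff_exists_nnreal_btwn.1 hp
  have hq2 : (2 : ℝ) < q := by exact_mod_cast hq
  have hconj : (q : ℝ).HolderConjugate (Real.conjExponent q) :=
    Real.HolderConjugate.conjExponent (by linarith)
  have h1 := hconj.ennrealOfReal
  have h2 : MemLp (fun x => 1 + ‖u x‖) (ENNReal.ofReal q)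
      (volume.restrict (interior (body K))) := by
    rw [ENNReal.ofReal_coe_nnreal]
    exact MemLp.add (f := fun _ => (1 : ℝ)) (memLp_const (1 : ℝ)) (hu.mono_exponent hqp.le).norm
  have h3 : Real.conjExponent q < 2 := by
    rw [Real.conjExponent, div_lt_iff₀ (by linarith)]
    linarith
  have h4 := memLp_wt K hconj.symm.lt.le h3
  exact MemLp.integrable_mul h2 h4

lemma hasTraces_of_memHDiv {K : Simplex n} {u : E n → E n} {d : E n → ℝ} {p : ENNReal}
    (hp : 2 < p) (h : MemHDiv (interior (body K)) u d)
    (hu : MemLp u p (volume.restrict (interior (body K)))) : HasTraces K u d :=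
  ⟨h.2.2, h.1.aestronglyMeasurable, integrable_mul_wt K hp hu, h.2.1.integrable (by norm_num)⟩

/-! ### Polynomial fields -/

section

variable (p q : MvPolynomial (Fin n) ℝ) (x : E n)

@[simp] lemma evalPoly_add : evalPoly (p + q) x = evalPoly p x + evalPoly q x := by
  simp [evalPoly]

@[simp] lemma evalPoly_sub : evalPoly (p - q) x = evalPoly p x - evalPoly q x := by
  simp [evalPoly]

@[simp] lemma evalPoly_mul : evalPoly (p * q) x = evalPoly p x * evalPoly q x := by
  simp [evalPoly]

@[simp] lemma evalPoly_zero : evalPoly (0 : MvPolynomial (Fin n) ℝ) x = 0 := by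
  simp [evalPoly]

@[simp] lemma evalPoly_one : evalPoly (1 : MvPolynomial (Fin n) ℝ) x = 1 := by
  simp [evalPoly]

@[simp] lemma evalPoly_C (c : ℝ) : evalPoly (MvPolynomial.C c) x = c := by
  simp [evalPoly]

@[simp] lemma evalPoly_X (j : Fin n) : evalPoly (MvPolynomial.X j) x = x j := by
  simp [evalPoly]

@[simp] lemma evalPoly_smul (c : ℝ) : evalPoly (c • p) x = c * evalPoly p x := by
  simp [evalPoly]

@[simp] lemma evalPoly_sum {ι : Type*} (s : Finset ι) (f : ι → MvPolynomial (Fin n) ℝ) :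
    evalPoly (∑ i ∈ s, f i) x = ∑ i ∈ s, evalPoly (f i) x := by
  simp [evalPoly]

@[simp] lemma evalVec_apply (W : Fin n → MvPolynomial (Fin n) ℝ) (j : Fin n) :
    evalVec W x j = evalPoly (W j) x := rfl

end

lemma evalPoly_pderiv_mul_X (p : MvPolynomial (Fin n) ℝ) (i j : Fin n) (x : E n) :
    evalPoly (MvPolynomial.pderiv j (p * MvPolynomial.X i)) x
      = evalPoly (MvPolynomial.pderiv j p) x * x i + if j = i then evalPoly p x else 0 := by
  rw [Derivation.leibniz, MvPolynomial.pderiv_X, Pi.single_apply]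
  by_cases hj : j = i
  · rw [if_pos hj.symm, if_pos hj]
    simp only [smul_eq_mul, evalPoly_add, evalPoly_mul, evalPoly_one, evalPoly_X]
    ring
  · rw [if_neg (Ne.symm hj), if_neg hj]
    simp only [smul_eq_mul, evalPoly_add, evalPoly_mul, evalPoly_zero, evalPoly_X]
    ring

lemma hasFDerivAt_evalPoly (q : MvPolynomial (Fin n) ℝ) (x : E n) :
    HasFDerivAt (evalPoly q) (∑ j, evalPoly (MvPolynomial.pderiv j q) x •
      (EuclideanSpace.proj j : E n →L[ℝ] ℝ)) x := by
  induction q using MvPolynomial.induction_on with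
  | C a =>
    have : evalPoly (MvPolynomial.C a : MvPolynomial (Fin n) ℝ) = fun _ => a := by
      funext y; simp
    rw [this]
    simpa using hasFDerivAt_const a x
  | add p q hp hq =>
    have : evalPoly (p + q) = fun y => evalPoly p y + evalPoly q y := by
      funext y; simp
    rw [this]
    refine (hp.add hq).congr_fderiv ?_
    simp [add_smul, Finset.sum_add_distrib]
  | mul_X p i hp =>
    have : evalPoly (p * MvPolynomial.X i) = fun y => evalPoly p y * y i := by
      funext y; simp
    rw [this]
    refine (hp.mul (EuclideanSpace.proj i : E n →L[ℝ] ℝ).hasFDerivAt).congr_fderiv ?_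
    ext v
    simp only [evalPoly_pderiv_mul_X, add_apply, smul_apply, sum_apply, smul_eq_mul, PiLp.proj_apply, add_mul,
      Finset.sum_add_distrib, ite_mul, zero_mul, Finset.sum_ite_eq', Finset.mem_univ, if_true,
      Finset.mul_sum]
    rw [add_comm]
    congr 1
    exact Finset.sum_congr rfl fun j _ => by ring

lemma contDiff_evalPoly (q : MvPolynomial (Fin n) ℝ) : ContDiff ℝ ∞ (evalPoly q) := by
  induction q using MvPolynomial.induction_on with
  | C a =>
    have : evalPoly (MvPolynomial.C a : MvPolynomial (Fin n) ℝ) = fun _ => a := by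
      funext y; simp
    rw [this]
    exact contDiff_const
  | add p q hp hq =>
    have : evalPoly (p + q) = fun y => evalPoly p y + evalPoly q y := by
      funext y; simp
    rw [this]
    exact hp.add hq
  | mul_X p i hp =>
    have : evalPoly (p * MvPolynomial.X i) = fun y => evalPoly p y * y i := by
      funext y; simp
    rw [this]
    exact hp.mul (EuclideanSpace.proj i : E n →L[ℝ] ℝ).contDiff

lemma fderiv_evalPoly (q : MvPolynomial (Fin n) ℝ) (x v : E n) :
    fderiv ℝ (evalPoly q) x v = ∑ j, evalPoly (MvPolynomial.pderiv j q) x * v j := by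
  rw [(hasFDerivAt_evalPoly q x).fderiv]
  simp

lemma clm_apply_eq_sum (f : E n →L[ℝ] ℝ) (v : E n) :
    f v = ∑ j, v j * f (EuclideanSpace.single j 1) := by
  conv_lhs => rw [← (EuclideanSpace.basisFun (Fin n) ℝ).sum_repr v, map_sum]
  simp

lemma hasWeakDiv_evalVec {U : Set (E n)} (W : Fin n → MvPolynomial (Fin n) ℝ) :
    HasWeakDiv U (evalVec W) (evalPoly (divPoly W)) := by
  intro φ hφ hc hs
  have h0 : ∀ x, x ∉ U → φ x = 0 := fun x hx => image_eq_zero_of_notMem_tsupport fun h => hx (hs h)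
  have h0' : ∀ x, x ∉ U → fderiv ℝ φ x = 0 := fun x hx =>
    image_eq_zero_of_notMem_tsupport fun h => hx (hs (tsupport_fderiv_subset ℝ h))
  rw [setIntegral_eq_integral_of_forall_compl_eq_zero fun x hx => by rw [h0' x hx, zero_apply],
    setIntegral_eq_integral_of_forall_compl_eq_zero fun x hx => by rw [h0 x hx, mul_zero]]
  have hφ' : Continuous (fderiv ℝ φ) := hφ.continuous_fderiv (by simp)
  have hint1 : ∀ j, Integrable (fun x => evalPoly (W j) x *
      fderiv ℝ φ x (EuclideanSpace.single j 1)) := fun j => by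
    refine ((continuous_evalPoly _).mul (hφ'.clm_apply continuous_const)).integrable_of_hasCompactSupport ?_
    exact ((hc.fderiv ℝ).comp_left (g := fun f : E n →L[ℝ] ℝ => f (EuclideanSpace.single j 1))
      (by simp)).mul_left
  have hint2 : ∀ j, Integrable (fun x => evalPoly (MvPolynomial.pderiv j (W j)) x * φ x) :=
    fun j => ((continuous_evalPoly _).mul hφ.continuous).integrable_of_hasCompactSupport hc.mul_left
  have e1 : ∀ x, fderiv ℝ φ x (evalVec W x)
      = ∑ j, evalPoly (W j) x * fderiv ℝ φ x (EuclideanSpace.single j 1) := fun x =>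
    clm_apply_eq_sum _ _
  have e2 : ∀ x, evalPoly (divPoly W) x * φ x
      = ∑ j, evalPoly (MvPolynomial.pderiv j (W j)) x * φ x := fun x => by
    rw [divPoly, evalPoly_sum, Finset.sum_mul]
  simp only [e1, e2]
  rw [integral_finsetSum _ fun j _ => hint1 j, integral_finsetSum _ fun j _ => hint2 j,
    ← Finset.sum_neg_distrib]
  refine Finset.sum_congr rfl fun j _ => ?_
  have hfd : ∀ x, fderiv ℝ (evalPoly (W j)) x (EuclideanSpace.single j 1)
      = evalPoly (MvPolynomial.pderiv j (W j)) x := fun x => by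
    rw [fderiv_evalPoly]
    simp
  have := integral_mul_fderiv_eq_neg_fderiv_mul_of_integrable (μ := (volume : Measure (E n)))
    (f := evalPoly (W j)) (g := φ) (v := EuclideanSpace.single j 1)
    (by simpa only [hfd] using hint2 j) (hint1 j)
    (((continuous_evalPoly _).mul hφ.continuous).integrable_of_hasCompactSupport hc.mul_left)
    (fun x _ => ((contDiff_evalPoly _).differentiable (by simp)).differentiableAt)
    (fun x _ => (hφ.differentiable (by simp)).differentiableAt)
  simpa only [hfd] using this

lemma memLp_evalVec (K : Simplex n) (W : Fin n → MvPolynomial (Fin n) ℝ) (p : ENNReal) :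
    MemLp (evalVec W) p (volume.restrict (interior (body K))) := by
  obtain ⟨C, hC⟩ := (isCompact_body K).exists_bound_of_continuousOn
    (continuous_evalVec W).continuousOn
  refine MemLp.of_bound (continuous_evalVec W).aestronglyMeasurable C ?_
  filter_upwards [ae_restrict_mem (measurableSet_interior_body K)] with x hx
  exact hC x (interior_subset hx)

lemma memLp_evalPoly (K : Simplex n) (q : MvPolynomial (Fin n) ℝ) (p : ENNReal) :
    MemLp (evalPoly q) p (volume.restrict (interior (body K))) := by
  obtain ⟨C, hC⟩ := (isCompact_body K).exists_bound_of_continuousOn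
    (continuous_evalPoly q).continuousOn
  refine MemLp.of_bound (continuous_evalPoly q).aestronglyMeasurable C ?_
  filter_upwards [ae_restrict_mem (measurableSet_interior_body K)] with x hx
  exact hC x (interior_subset hx)

lemma hasTraces_evalVec (K : Simplex n) (W : Fin n → MvPolynomial (Fin n) ℝ) :
    HasTraces K (evalVec W) (evalPoly (divPoly W)) :=
  hasTraces_of_memHDiv (p := 3) (by norm_num)
    ⟨memLp_evalVec K W 2, memLp_evalPoly K _ 2, hasWeakDiv_evalVec W⟩ (memLp_evalVec K W 3)

lemma HasTraces.integrable {K : Simplex n} {u : E n → E n} {d : E n → ℝ} (hu : HasTraces K u d) :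
    Integrable u (volume.restrict (interior (body K))) := by
  refine hu.integrable_mul_wt.mono' hu.aestronglyMeasurable ?_
  filter_upwards [ae_restrict_mem (measurableSet_interior_body K)] with x hx
  have := one_le_wt hx
  nlinarith [norm_nonneg (u x)]

lemma HasTraces.add {K : Simplex n} {u v : E n → E n} {d e : E n → ℝ} (hu : HasTraces K u d)
    (hv : HasTraces K v e) : HasTraces K (fun x => u x + v x) (fun x => d x + e x) := by
  refine ⟨fun φ hφ hc hs => ?_, hu.aestronglyMeasurable.add hv.aestronglyMeasurable, ?_,
    hu.integrable_div.add hv.integrable_div⟩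
  · simp only [map_add, add_mul]
    rw [integral_add (hu.integrable_fderiv (Lift.of_contDiff hφ))
      (hv.integrable_fderiv (Lift.of_contDiff hφ)),
      integral_add (hu.integrable_mul (Lift.of_contDiff hφ))
      (hv.integrable_mul (Lift.of_contDiff hφ)), hu.hasWeakDiv φ hφ hc hs,
      hv.hasWeakDiv φ hφ hc hs, neg_add]
  · refine (hu.integrable_mul_wt.add hv.integrable_mul_wt).mono'
      ((aestronglyMeasurable_const.add (hu.aestronglyMeasurable.add
        hv.aestronglyMeasurable).norm).mul
        ((continuousOn_wt K).aestronglyMeasurable (measurableSet_interior_body K))) ?_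
    filter_upwards [ae_restrict_mem (measurableSet_interior_body K)] with x hx
    have h1 := one_le_wt hx
    have h2 := norm_add_le (u x) (v x)
    rw [Real.norm_eq_abs, abs_of_nonneg (by positivity)]
    simp only [Pi.add_apply]
    nlinarith

lemma HasTraces.smul {K : Simplex n} {u : E n → E n} {d : E n → ℝ} (hu : HasTraces K u d)
    (c : ℝ) : HasTraces K (fun x => c • u x) (fun x => c * d x) := by
  refine ⟨fun φ hφ hc hs => ?_, hu.aestronglyMeasurable.const_smul c, ?_,
    hu.integrable_div.const_mul c⟩
  · simp only [map_smul, smul_eq_mul, mul_assoc]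
    rw [integral_const_mul, integral_const_mul, hu.hasWeakDiv φ hφ hc hs, mul_neg]
  · refine (hu.integrable_mul_wt.const_mul (1 + |c|)).mono'
      ((aestronglyMeasurable_const.add (hu.aestronglyMeasurable.const_smul c).norm).mul
        ((continuousOn_wt K).aestronglyMeasurable (measurableSet_interior_body K))) ?_
    filter_upwards [ae_restrict_mem (measurableSet_interior_body K)] with x hx
    have h1 := one_le_wt hx
    rw [Real.norm_eq_abs, abs_of_nonneg (by positivity), ← mul_assoc]
    refine mul_le_mul_of_nonneg_right ?_ (by linarith)
    simp only [norm_smul, Real.norm_eq_abs]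
    nlinarith [abs_nonneg c, norm_nonneg (u x)]

lemma faceFlux_sub_left {K : Simplex n} {u v : E n → E n} {d e g : E n → ℝ}
    (hu : HasTraces K u d) (hv : HasTraces K v e) (hg : ContDiff ℝ ∞ g) (i : Fin (n + 1)) :
    faceFlux K i (fun x => u x - v x) (fun x => d x - e x) g
      = faceFlux K i u d g - faceFlux K i v e g := by
  have h := faceFlux_add_left hu (hv.smul (-1)) hg i
  rw [faceFlux_smul_left] at h
  simpa only [neg_one_smul, neg_one_mul, ← sub_eq_add_neg] using h

/-! ### Polynomials as functions -/

lemma eq_zero_of_evalPoly_eq_zero {U : Set (E n)} (hU : IsOpen U) (hne : U.Nonempty)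
    {q : MvPolynomial (Fin n) ℝ} (h : ∀ x ∈ U, evalPoly q x = 0) : q = 0 := by
  obtain ⟨x, hx⟩ := hne
  have hU' : IsOpen ((fun y : Fin n → ℝ => (WithLp.toLp 2 y : E n)) ⁻¹' U) :=
    hU.preimage (PiLp.continuous_toLp 2 _)
  obtain ⟨ε, hε, hb⟩ := Metric.isOpen_iff.1 hU' (fun j => x j) hx
  refine MvPolynomial.funext_set (fun j => Metric.ball (x j) ε) (fun j => ?_) fun y hy => ?_
  · rw [Real.ball_eq_Ioo]
    exact Ioo_infinite (by linarith)
  · rw [← ball_pi _ hε] at hy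
    simpa [evalPoly] using h _ (hb hy)

lemma evalPoly_injective : Function.Injective (evalPoly (n := n)) := fun p q h =>
  sub_eq_zero.1 (eq_zero_of_evalPoly_eq_zero isOpen_univ univ_nonempty fun x _ => by
    rw [evalPoly_sub, h, sub_self])

lemma evalVec_injective : Function.Injective (evalVec (n := n)) := fun V W h => by
  funext j
  refine evalPoly_injective ?_
  funext x
  rw [← evalVec_apply, ← evalVec_apply, h]

lemma interior_body_nonempty (K : Simplex n) : (interior (body K)).Nonempty :=
  (interior_convexHull_nonempty_iff_affineSpan_eq_top).2 K.tot

lemma eqOn_zero_of_integral_eq_zero (K : Simplex n) {f : E n → ℝ} (hf : Continuous f)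
    (h0 : ∀ x ∈ interior (body K), 0 ≤ f x) (h : ∫ x in interior (body K), f x = 0) :
    ∀ x ∈ interior (body K), f x = 0 := by
  have hint : IntegrableOn f (interior (body K)) :=
    (hf.continuousOn.integrableOn_compact (isCompact_body K)).mono_set interior_subset
  have h1 := (setIntegral_eq_zero_iff_of_nonneg_ae
    ((ae_restrict_mem (measurableSet_interior_body K)).mono h0) hint).1 h
  exact Measure.eqOn_open_of_ae_eq h1 isOpen_interior hf.continuousOn continuousOn_const

lemma eq_zero_of_integral_sq_eq_zero (K : Simplex n) {q : MvPolynomial (Fin n) ℝ}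
    (h : ∫ x in interior (body K), evalPoly q x * evalPoly q x = 0) : q = 0 :=
  eq_zero_of_evalPoly_eq_zero isOpen_interior (interior_body_nonempty K) fun x hx =>
    mul_self_eq_zero.1 (eqOn_zero_of_integral_eq_zero K
      ((continuous_evalPoly q).mul (continuous_evalPoly q)) (fun _ _ => mul_self_nonneg _) h x hx)

/-- The derivation with `X_j ↦ W_j` is differentiation along the field `W`. For `W = x - v_i` it is
the Euler operator about `v_i`. -/
lemma evalPoly_mkDerivation (W : Fin n → MvPolynomial (Fin n) ℝ) (q : MvPolynomial (Fin n) ℝ)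
    (x : E n) : evalPoly (MvPolynomial.mkDerivation ℝ W q) x
      = fderiv ℝ (evalPoly q) x (evalVec W x) := by
  rw [fderiv_evalPoly]
  induction q using MvPolynomial.induction_on with
  | C a => simp
  | add p q hp hq => simp [hp, hq, add_mul, Finset.sum_add_distrib]
  | mul_X p i hp =>
    rw [Derivation.leibniz, MvPolynomial.mkDerivation_X]
    simp only [evalPoly_pderiv_mul_X, smul_eq_mul, evalPoly_add, evalPoly_mul, hp, evalPoly_X, add_mul,
      Finset.sum_add_distrib, ite_mul, zero_mul, Finset.sum_ite_eq', Finset.mem_univ, if_true,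
      Finset.mul_sum, evalVec_apply]
    rw [add_comm]
    congr 1
    exact Finset.sum_congr rfl fun j _ => by ring

/-- `1` or a variable. -/
def padVar : Option (Fin n) → MvPolynomial (Fin n) ℝ
  | none => 1
  | some j => MvPolynomial.X j

/-- Padding with factors `1` turns every monomial of degree at most `k` into a product of exactly
`k` factors, so that later arguments can split or homogenize it factor by factor. -/
lemma exists_prod_padVar_eq_monomial (k : ℕ) (s : Fin n →₀ ℕ) (hs : s.degree ≤ k) :
    ∃ l : Fin k → Option (Fin n), ∏ i, padVar (l i) = MvPolynomial.monomial s (1 : ℝ) := by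
  induction k generalizing s with
  | zero =>
    have : s = 0 := (Finsupp.degree_eq_zero_iff s).1 (Nat.le_zero.1 hs)
    exact ⟨fun _ => none, by simp [this]⟩
  | succ k ih =>
    by_cases h0 : s = 0
    · exact ⟨fun _ => none, by simp [h0, padVar]⟩
    · obtain ⟨j, hj⟩ := Finsupp.ne_iff.1 h0
      have hle : Finsupp.single j 1 ≤ s := Finsupp.single_le_iff.2 (Nat.one_le_iff_ne_zero.2 hj)
      have hsum := add_tsub_cancel_of_le hle
      obtain ⟨l, hl⟩ := ih (s - Finsupp.single j 1) (by
        have := congrArg Finsupp.degree hsum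
        rw [map_add, Finsupp.degree_single] at this
        omega)
      refine ⟨Fin.cons (some j) l, ?_⟩
      rw [Fin.prod_univ_succ]
      simp only [Fin.cons_zero, Fin.cons_succ, hl]
      conv_rhs => rw [← hsum]
      simp [padVar, MvPolynomial.X, MvPolynomial.monomial_mul]

/-- `P_k` is spanned by the products of `k` factors each of which is `1` or a variable. -/
lemma polyLE_le_span (k : ℕ) : polyLE n k ≤ Submodule.span ℝ
    (range fun l : Fin k → Option (Fin n) => ∏ i, padVar (l i)) := by
  intro q hq
  rw [MvPolynomial.mem_restrictTotalDegree] at hq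
  rw [MvPolynomial.as_sum q]
  refine Submodule.sum_mem _ fun s hs => ?_
  have hd : s.degree ≤ k := by
    refine le_trans ?_ hq
    have := MvPolynomial.le_totalDegree hs
    simpa [Finsupp.degree_eq_sum, Finsupp.sum_fintype] using this
  obtain ⟨l, hl⟩ := exists_prod_padVar_eq_monomial k s hd
  have : MvPolynomial.monomial s (MvPolynomial.coeff s q)
      = MvPolynomial.coeff s q • MvPolynomial.monomial s (1 : ℝ) := by
    rw [MvPolynomial.smul_monomial, smul_eq_mul, mul_one]
  rw [this, ← hl]
  exact Submodule.smul_mem _ _ (Submodule.subset_span ⟨l, rfl⟩)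

lemma mul_mem_polyLE {k l : ℕ} {p q : MvPolynomial (Fin n) ℝ} (hp : p ∈ polyLE n k)
    (hq : q ∈ polyLE n l) : p * q ∈ polyLE n (k + l) := by
  rw [MvPolynomial.mem_restrictTotalDegree] at *
  exact (MvPolynomial.totalDegree_mul _ _).trans (add_le_add hp hq)

lemma C_mem_polyLE (k : ℕ) (c : ℝ) : (MvPolynomial.C c : MvPolynomial (Fin n) ℝ) ∈ polyLE n k := by
  rw [MvPolynomial.mem_restrictTotalDegree, MvPolynomial.totalDegree_C]
  exact Nat.zero_le _

lemma one_mem_polyLE (k : ℕ) : (1 : MvPolynomial (Fin n) ℝ) ∈ polyLE n k := by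
  simpa using C_mem_polyLE k (1 : ℝ)

lemma X_mem_polyLE (j : Fin n) : (MvPolynomial.X j : MvPolynomial (Fin n) ℝ) ∈ polyLE n 1 := by
  rw [MvPolynomial.mem_restrictTotalDegree, MvPolynomial.totalDegree_X]

lemma padVar_mem_polyLE (l : Option (Fin n)) : padVar l ∈ polyLE n 1 := by
  cases l with
  | none => exact one_mem_polyLE 1
  | some j => exact X_mem_polyLE j

lemma prod_mem_polyLE {ι : Type*} (s : Finset ι) {f : ι → MvPolynomial (Fin n) ℝ}
    (h : ∀ i ∈ s, f i ∈ polyLE n 1) : ∏ i ∈ s, f i ∈ polyLE n s.card := by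
  classical
  induction s using Finset.induction_on with
  | empty => simpa using one_mem_polyLE 0
  | insert a s ha ih =>
    rw [Finset.prod_insert ha, Finset.card_insert_of_notMem ha, add_comm]
    exact mul_mem_polyLE (h a (Finset.mem_insert_self _ _))
      (ih fun i hi => h i (Finset.mem_insert_of_mem hi))

/-! ### Barycentric coordinates as polynomials -/

/-- The normal component of a polynomial field with respect to the face opposite to the vertex
`i`, up to a constant factor. -/
def ncomp (K : Simplex n) (i : Fin (n + 1)) (W : Fin n → MvPolynomial (Fin n) ℝ) :
    MvPolynomial (Fin n) ℝ :=
  ∑ j, MvPolynomial.C (dcoord K i (EuclideanSpace.single j 1)) * W j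

lemma evalPoly_ncomp (K : Simplex n) (i : Fin (n + 1)) (W : Fin n → MvPolynomial (Fin n) ℝ)
    (x : E n) : evalPoly (ncomp K i W) x = dcoord K i (evalVec W x) := by
  rw [clm_apply_eq_sum (dcoord K i), ncomp, evalPoly_sum]
  simp [mul_comm]

/-- The polynomial with values `λ_i`. -/
def lam (K : Simplex n) (i : Fin (n + 1)) : MvPolynomial (Fin n) ℝ :=
  MvPolynomial.C (K.coord i 0) + ncomp K i MvPolynomial.X

lemma evalPoly_lam (K : Simplex n) (i : Fin (n + 1)) (x : E n) :
    evalPoly (lam K i) x = K.coord i x := by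
  have h := coord_eq K i x 0
  rw [sub_zero] at h
  rw [lam, evalPoly_add, evalPoly_ncomp, evalPoly_C, h, add_comm]
  congr 2
  ext j
  simp

lemma ncomp_mem_polyLE (K : Simplex n) (i : Fin (n + 1)) {W : Fin n → MvPolynomial (Fin n) ℝ}
    {k : ℕ} (h : ∀ j, W j ∈ polyLE n k) : ncomp K i W ∈ polyLE n k :=
  Submodule.sum_mem _ fun j _ => by
    simpa using mul_mem_polyLE (C_mem_polyLE 0 _) (h j)

lemma lam_mem_polyLE (K : Simplex n) (i : Fin (n + 1)) : lam K i ∈ polyLE n 1 :=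
  Submodule.add_mem _ (C_mem_polyLE 1 _) (ncomp_mem_polyLE K i X_mem_polyLE)

lemma lam_ne_zero (K : Simplex n) (i : Fin (n + 1)) : lam K i ≠ 0 := fun h => by
  have := evalPoly_lam K i (K i)
  simp [h, K.coord_apply] at this

/-- The polynomial field `x ↦ x - v_i`. -/
def pos (K : Simplex n) (i : Fin (n + 1)) (j : Fin n) : MvPolynomial (Fin n) ℝ :=
  MvPolynomial.X j - MvPolynomial.C (K i j)

lemma evalVec_pos (K : Simplex n) (i : Fin (n + 1)) (x : E n) : evalVec (pos K i) x = x - K i := by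
  ext j
  simp [pos]

/-- The field `x - v_i` is tangential to the faces through `v_i`, where `dλ_j` of it is `λ_j`. On
the opposite face its value under `dλ_i` is the constant `-1`. -/
lemma dcoord_evalVec_pos (K : Simplex n) (i j : Fin (n + 1)) (x : E n) :
    dcoord K j (evalVec (pos K i) x) = K.coord j x - if j = i then 1 else 0 := by
  rw [evalVec_pos, coord_eq K j x (K i), K.coord_apply]
  ring

lemma evalPoly_divPoly_pos (K : Simplex n) (i : Fin (n + 1)) (x : E n) :
    evalPoly (divPoly (pos K i)) x = n := by
  simp [divPoly, pos, MvPolynomial.pderiv_X, evalPoly]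

/-! ### The surface integral over a face -/

/-- The integral over the face opposite to the vertex `i`, up to a constant factor, written as
`∫_K div (g (x - v_i)) dx`. -/
def faceInt (K : Simplex n) (i : Fin (n + 1)) (g : E n → ℝ) : ℝ :=
  pair K (evalVec (pos K i)) (evalPoly (divPoly (pos K i))) g

/-- Only the face opposite to `v_i` carries a normal component of `x - v_i`. Therefore `faceInt`,
although defined by an integral over `K`, depends only on the values of `g` on that face. -/
lemma faceFlux_pos (K : Simplex n) (i : Fin (n + 1)) {g : E n → ℝ} (hg : ContDiff ℝ ∞ g) :
    faceFlux K i (evalVec (pos K i)) (evalPoly (divPoly (pos K i))) g = faceInt K i g :=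
  faceFlux_eq_pair_of_le (hasTraces_evalVec K _) hg i fun j hj => ⟨1, fun x hx => Or.inr (by
    rw [dcoord_evalVec_pos, if_neg hj, sub_zero, one_mul, abs_of_pos (mem_interior_body.1 hx j)])⟩

lemma faceInt_eq_zero (hn : 1 ≤ n) (K : Simplex n) (i : Fin (n + 1)) {g : E n → ℝ}
    (hg : ContDiff ℝ ∞ g) (h : ∀ x ∈ body K, K.coord i x = 0 → g x = 0) : faceInt K i g = 0 := by
  rw [← faceFlux_pos K i hg, faceFlux_eq_zero hn (hasTraces_evalVec K _) hg i h]

lemma faceInt_add (K : Simplex n) (i : Fin (n + 1)) {f g : E n → ℝ} (hf : ContDiff ℝ ∞ f)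
    (hg : ContDiff ℝ ∞ g) :
    faceInt K i (fun x => f x + g x) = faceInt K i f + faceInt K i g :=
  pair_add_right (hasTraces_evalVec K _) (Lift.of_contDiff hf) (Lift.of_contDiff hg)

lemma faceInt_const_mul (K : Simplex n) (i : Fin (n + 1)) {g : E n → ℝ} (hg : ContDiff ℝ ∞ g)
    (c : ℝ) : faceInt K i (fun x => c * g x) = c * faceInt K i g :=
  pair_mul_right (Lift.of_contDiff hg) c

lemma faceInt_sum (K : Simplex n) (i : Fin (n + 1)) {ι : Type*} (s : Finset ι) {g : ι → E n → ℝ}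
    (hg : ∀ a ∈ s, ContDiff ℝ ∞ (g a)) :
    faceInt K i (fun x => ∑ a ∈ s, g a x) = ∑ a ∈ s, faceInt K i (g a) :=
  pair_sum_right (hasTraces_evalVec K _) s fun a ha => Lift.of_contDiff (hg a ha)

lemma faceInt_congr (hn : 1 ≤ n) (K : Simplex n) (i : Fin (n + 1)) {f g : E n → ℝ}
    (hf : ContDiff ℝ ∞ f) (hg : ContDiff ℝ ∞ g)
    (h : ∀ x ∈ body K, K.coord i x = 0 → f x = g x) : faceInt K i f = faceInt K i g := by
  have h1 := faceInt_eq_zero hn K i (g := fun x => f x + -1 * g x)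
    (hf.add (contDiff_const.mul hg)) fun x hx hi => by rw [h x hx hi]; ring
  rw [faceInt_add K i hf (contDiff_const.mul hg), faceInt_const_mul K i hg] at h1
  linarith

lemma divPoly_mul (m : MvPolynomial (Fin n) ℝ) (W : Fin n → MvPolynomial (Fin n) ℝ) :
    divPoly (fun j => m * W j) = m * divPoly W + MvPolynomial.mkDerivation ℝ W m := by
  refine evalPoly_injective (funext fun x => ?_)
  rw [evalPoly_add, evalPoly_mkDerivation, fderiv_evalPoly]
  simp [divPoly, Derivation.leibniz, Finset.sum_add_distrib, Finset.mul_sum, mul_comm]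

lemma pair_evalPoly_mul (K : Simplex n) (m : MvPolynomial (Fin n) ℝ)
    (W : Fin n → MvPolynomial (Fin n) ℝ) {w : E n → ℝ} (hw : Lift K w) :
    pair K (evalVec fun j => m * W j) (evalPoly (divPoly fun j => m * W j)) w
      = pair K (evalVec W) (evalPoly (divPoly W)) (fun x => evalPoly m x * w x) := by
  refine setIntegral_congr_fun (measurableSet_interior_body K) fun x hx => ?_
  have h1 : evalVec (fun j => m * W j) x = evalPoly m x • evalVec W x := by
    ext j; simp
  simp only
  rw [fderiv_fun_mul ((contDiff_evalPoly m).differentiable (by simp)).differentiableAt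
    (hw.differentiableAt hx), divPoly_mul, h1, evalPoly_add, evalPoly_mul, evalPoly_mkDerivation]
  simp only [add_apply, smul_apply, smul_eq_mul, map_smul]
  ring

lemma evalVec_add (V W : Fin n → MvPolynomial (Fin n) ℝ) (x : E n) :
    evalVec (fun j => V j + W j) x = evalVec V x + evalVec W x := by
  ext j; simp

lemma evalPoly_divPoly_add (V W : Fin n → MvPolynomial (Fin n) ℝ) (x : E n) :
    evalPoly (divPoly fun j => V j + W j) x = evalPoly (divPoly V) x + evalPoly (divPoly W) x := by
  simp [divPoly, Finset.sum_add_distrib]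

/-- The flux of a polynomial field through a face is the integral of its normal component. -/
lemma faceFlux_evalVec (K : Simplex n) (i : Fin (n + 1)) (W : Fin n → MvPolynomial (Fin n) ℝ)
    {m c : MvPolynomial (Fin n) ℝ} (h : ncomp K i W = m + lam K i * c) {g : E n → ℝ}
    (hg : ContDiff ℝ ∞ g) :
    faceFlux K i (evalVec W) (evalPoly (divPoly W)) g
      = -faceInt K i (fun x => evalPoly m x * g x) := by
  -- On face `i` one has `dλ_i(W) = m` and `dλ_i(x - v_i) = -1`, so adding `m (x - v_i)` cancels the
  -- normal component there.
  have hnorm : faceFlux K i (evalVec fun j => W j + m * pos K i j)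
      (evalPoly (divPoly fun j => W j + m * pos K i j)) g = 0 := by
    refine faceFlux_eq_zero_of_normal (hasTraces_evalVec K _) hg i ?_
    obtain ⟨D, _, hD⟩ := exists_abs_le_of_continuous K (continuous_evalPoly (c + m))
    refine ⟨D, fun x hx => ?_⟩
    have h1 : dcoord K i (evalVec (fun j => W j + m * pos K i j) x)
        = evalPoly (c + m) x * K.coord i x := by
      have h2 : evalVec (fun j => m * pos K i j) x = evalPoly m x • evalVec (pos K i) x := by
        ext j; simp
      rw [evalVec_add, map_add, ← evalPoly_ncomp, h, h2, map_smul, dcoord_evalVec_pos, if_pos rfl]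
      simp only [evalPoly_add, evalPoly_mul, evalPoly_lam, smul_eq_mul]
      ring
    rw [h1, abs_mul, abs_of_pos (mem_interior_body.1 hx i)]
    exact mul_le_mul_of_nonneg_right (hD x hx) (mem_interior_body.1 hx i).le
  have hsum := faceFlux_add_left (hasTraces_evalVec K W)
    (hasTraces_evalVec K fun j => m * pos K i j) hg i
  simp only [← evalVec_add, ← evalPoly_divPoly_add] at hsum
  have hm : faceFlux K i (evalVec fun j => m * pos K i j)
      (evalPoly (divPoly fun j => m * pos K i j)) g
      = faceInt K i (fun x => evalPoly m x * g x) := by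
    rw [faceFlux_eq_pair, pair_evalPoly_mul K m _ ((lift_faceLift K i).mul (Lift.of_contDiff hg)),
      ← faceFlux_pos K i ((contDiff_evalPoly m).mul hg), faceFlux_eq_pair]
    simp only [mul_left_comm]
  have hsum' := hnorm.symm.trans hsum
  rw [hm] at hsum'
  linarith

/-! ### Homogenization about a vertex -/

/-- `M` is homogeneous of degree `k` with respect to the vertex `i`. -/
def IsHomogAt (K : Simplex n) (i : Fin (n + 1)) (k : ℕ) (M : MvPolynomial (Fin n) ℝ) : Prop :=
  MvPolynomial.mkDerivation ℝ (pos K i) M = (k : ℝ) • M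

lemma isHomogAt_one_sub_lam (K : Simplex n) (i : Fin (n + 1)) : IsHomogAt K i 1 (1 - lam K i) := by
  refine evalPoly_injective (funext fun x => ?_)
  have h1 : evalPoly (1 - lam K i) = fun y => 1 - K.coord i y := by
    funext y
    simp [evalPoly_lam]
  rw [evalPoly_mkDerivation, h1, ((hasFDerivAt_coord K i x).const_sub 1).fderiv, evalPoly_smul, h1,
    neg_apply, dcoord_evalVec_pos]
  simp

lemma isHomogAt_pos (K : Simplex n) (i : Fin (n + 1)) (j : Fin n) :
    IsHomogAt K i 1 (pos K i j) := by
  rw [IsHomogAt]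
  conv_lhs => rw [pos, map_sub, MvPolynomial.mkDerivation_X, MvPolynomial.derivation_C, sub_zero]
  simp

lemma IsHomogAt.add {K : Simplex n} {i : Fin (n + 1)} {k : ℕ} {p q : MvPolynomial (Fin n) ℝ}
    (hp : IsHomogAt K i k p) (hq : IsHomogAt K i k q) : IsHomogAt K i k (p + q) := by
  rw [IsHomogAt, map_add, hp, hq, smul_add]

lemma IsHomogAt.smul {K : Simplex n} {i : Fin (n + 1)} {k : ℕ} {p : MvPolynomial (Fin n) ℝ}
    (hp : IsHomogAt K i k p) (c : ℝ) : IsHomogAt K i k (c • p) := by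
  rw [IsHomogAt, Derivation.map_smul, hp, smul_comm]

lemma IsHomogAt.mul {K : Simplex n} {i : Fin (n + 1)} {k l : ℕ} {p q : MvPolynomial (Fin n) ℝ}
    (hp : IsHomogAt K i k p) (hq : IsHomogAt K i l q) : IsHomogAt K i (k + l) (p * q) := by
  rw [IsHomogAt, Derivation.leibniz, hp, hq]
  simp only [smul_eq_mul, Nat.cast_add, add_smul, mul_smul_comm]
  rw [mul_comm q p]
  ring

lemma IsHomogAt.prod {K : Simplex n} {i : Fin (n + 1)} {k : ℕ}
    {f : Fin k → MvPolynomial (Fin n) ℝ} (h : ∀ a, IsHomogAt K i 1 (f a)) :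
    IsHomogAt K i k (∏ a, f a) := by
  induction k with
  | zero => simp [IsHomogAt]
  | succ k ih =>
    rw [Fin.prod_univ_castSucc]
    exact (ih fun a => h a.castSucc).mul (h (Fin.last k))

/-- On the face `λ_i = 0` the constant `1` agrees with `1 - λ_i`, which is linear in `x - v_i`. For
a variable, `X_j = (X_j - v_{i,j}) + v_{i,j}`, and the constant `v_{i,j}` is treated likewise. -/
lemma exists_homog_padVar (K : Simplex n) (i : Fin (n + 1)) (l : Option (Fin n)) :
    ∃ M ∈ polyLE n 1, IsHomogAt K i 1 M ∧ lam K i ∣ padVar l - M := by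
  cases l with
  | none =>
    exact ⟨1 - lam K i, Submodule.sub_mem _ (one_mem_polyLE 1) (lam_mem_polyLE K i),
      isHomogAt_one_sub_lam K i, 1, by simp [padVar]⟩
  | some j =>
    refine ⟨(K i j) • (1 - lam K i) + pos K i j, Submodule.add_mem _ (Submodule.smul_mem _ _
      (Submodule.sub_mem _ (one_mem_polyLE 1) (lam_mem_polyLE K i)))
      (Submodule.sub_mem _ (X_mem_polyLE j) (C_mem_polyLE 1 _)),
      ((isHomogAt_one_sub_lam K i).smul _).add (isHomogAt_pos K i j), MvPolynomial.C (K i j), ?_⟩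
    rw [padVar, pos, MvPolynomial.smul_eq_C_mul]
    ring

lemma dvd_prod_sub_prod {R : Type*} [CommRing R] {a : R} {k : ℕ} {f g : Fin k → R}
    (h : ∀ i, a ∣ f i - g i) : a ∣ ∏ i, f i - ∏ i, g i := by
  induction k with
  | zero => simp
  | succ k ih =>
    rw [Fin.prod_univ_succ, Fin.prod_univ_succ]
    have h1 := ih fun i => h i.succ
    have : f 0 * ∏ i, f (Fin.succ i) - g 0 * ∏ i, g (Fin.succ i)
        = (f 0 - g 0) * ∏ i, f (Fin.succ i)
          + g 0 * (∏ i, f (Fin.succ i) - ∏ i, g (Fin.succ i)) := by ring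
    rw [this]
    exact dvd_add (dvd_mul_of_dvd_left (h 0) _) (dvd_mul_of_dvd_right h1 _)

/-- Every polynomial in `P_k` coincides on a face with a polynomial in `P_k` which is homogeneous
of degree `k` with respect to the opposite vertex. -/
lemma exists_homog (K : Simplex n) (i : Fin (n + 1)) {k : ℕ} {m : MvPolynomial (Fin n) ℝ}
    (hm : m ∈ polyLE n k) :
    ∃ M ∈ polyLE n k, IsHomogAt K i k M ∧ lam K i ∣ m - M := by
  have hm' := polyLE_le_span k hm
  induction hm' using Submodule.span_induction with
  | mem q hq =>
    obtain ⟨l, rfl⟩ := hq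
    choose M h1 h2 h3 using fun a => exists_homog_padVar K i (l a)
    refine ⟨∏ a, M a, ?_, IsHomogAt.prod h2, dvd_prod_sub_prod h3⟩
    simpa using prod_mem_polyLE Finset.univ fun a _ => h1 a
  | zero => exact ⟨0, Submodule.zero_mem _, by simp [IsHomogAt], by simp⟩
  | add p q hp' hq' hp hq =>
    have hle : Submodule.span ℝ (range fun l : Fin k → Option (Fin n) => ∏ i, padVar (l i))
        ≤ polyLE n k := by
      rw [Submodule.span_le]
      rintro _ ⟨l, rfl⟩
      simpa using prod_mem_polyLE Finset.univ fun a _ => padVar_mem_polyLE (l a)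
    obtain ⟨M, h1, h2, h3⟩ := hp (hle hp')
    obtain ⟨N, h4, h5, h6⟩ := hq (hle hq')
    refine ⟨M + N, Submodule.add_mem _ h1 h4, h2.add h5, ?_⟩
    rw [add_sub_add_comm]
    exact dvd_add h3 h6
  | smul c p hp' hp =>
    have hle : Submodule.span ℝ (range fun l : Fin k → Option (Fin n) => ∏ i, padVar (l i))
        ≤ polyLE n k := by
      rw [Submodule.span_le]
      rintro _ ⟨l, rfl⟩
      simpa using prod_mem_polyLE Finset.univ fun a _ => padVar_mem_polyLE (l a)
    obtain ⟨M, h1, h2, h3⟩ := hp (hle hp')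
    refine ⟨c • M, Submodule.smul_mem _ _ h1, h2.smul c, ?_⟩
    rw [← smul_sub, MvPolynomial.smul_eq_C_mul]
    exact dvd_mul_of_dvd_right h3 _

/-- The integral over a face is positive definite on the traces of polynomials. -/
lemma lam_dvd_of_faceInt_eq_zero (hn : 1 ≤ n) (K : Simplex n) (i : Fin (n + 1)) {k : ℕ}
    {m : MvPolynomial (Fin n) ℝ} (hm : m ∈ polyLE n k)
    (h : ∀ q ∈ polyLE n k, faceInt K i (fun x => evalPoly m x * evalPoly q x) = 0) :
    lam K i ∣ m := by
  -- The homogeneous representative `M` of `m` on the face is also taken as the test polynomial,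
  -- which turns the hypothesis into a vanishing face integral of `M²`.
  obtain ⟨M, hM, hM', hdvd⟩ := exists_homog K i hm
  have h1 := h M hM
  rw [faceInt_congr hn K i ((contDiff_evalPoly m).mul (contDiff_evalPoly M))
    (g := evalPoly (M * M)) (contDiff_evalPoly _) fun x _ hx => by
      obtain ⟨c, hc⟩ := hdvd
      have : evalPoly (m - M) x = 0 := by
        rw [hc, evalPoly_mul, evalPoly_lam, hx, zero_mul]
      rw [evalPoly_sub, sub_eq_zero] at this
      rw [evalPoly_mul, this]] at h1
  -- Euler's identity for `M²`, homogeneous of degree `2k`, together with `div (x - v_i) = n`, gives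
  -- `div (M² (x - v_i)) = (2k + n) M²`.
  have h2 : faceInt K i (evalPoly (M * M))
      = ((k + k : ℕ) + n : ℝ) * ∫ x in interior (body K), evalPoly M x * evalPoly M x := by
    rw [faceInt, pair, ← integral_const_mul]
    refine setIntegral_congr_fun (measurableSet_interior_body K) fun x _ => ?_
    rw [← evalPoly_mkDerivation, hM'.mul hM', evalPoly_divPoly_pos, evalPoly_smul, evalPoly_mul]
    ring
  rw [h2] at h1
  have h3 : ((k + k : ℕ) + n : ℝ) ≠ 0 := by
    have : (0 : ℝ) < n := by exact_mod_cast hn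
    positivity
  have h4 := eq_zero_of_integral_sq_eq_zero K ((mul_eq_zero.1 h1).resolve_left h3)
  rwa [h4, sub_zero] at hdvd

/-! ### Polynomials of degree less than `k` -/

/-- The space `P_{k-1}`, with `P_{-1} = 0`. -/
def polyLT (n : ℕ) : ℕ → Submodule ℝ (MvPolynomial (Fin n) ℝ)
  | 0 => ⊥
  | k + 1 => polyLE n k

lemma mem_polyLT {k : ℕ} {q : MvPolynomial (Fin n) ℝ} :
    q ∈ polyLT n k ↔ q = 0 ∨ q.totalDegree < k := by
  cases k with
  | zero => simp [polyLT]
  | succ k =>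
    rw [polyLT, MvPolynomial.mem_restrictTotalDegree, Nat.lt_succ_iff]
    refine ⟨Or.inr, ?_⟩
    rintro (h | h)
    · rw [h, MvPolynomial.totalDegree_zero]; exact Nat.zero_le _
    · exact h

lemma polyLT_le_polyLE (k : ℕ) : polyLT n k ≤ polyLE n k := fun q hq => by
  rw [MvPolynomial.mem_restrictTotalDegree]
  rcases mem_polyLT.1 hq with h | h
  · simp [h]
  · exact h.le

lemma mul_mem_polyLE_of_mem_polyLT {k : ℕ} {p q : MvPolynomial (Fin n) ℝ} (hp : p ∈ polyLE n 1)
    (hq : q ∈ polyLT n k) : p * q ∈ polyLE n k := by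
  cases k with
  | zero =>
    have : q = 0 := hq
    rw [this, mul_zero]
    exact Submodule.zero_mem _
  | succ k =>
    have := mul_mem_polyLE hp hq
    rwa [add_comm] at this

lemma mul_mem_polyLT {k l : ℕ} {p q : MvPolynomial (Fin n) ℝ} (hp : p ∈ polyLE n k)
    (hq : q ∈ polyLT n l) : p * q ∈ polyLT n (k + l) := by
  cases l with
  | zero =>
    have : q = 0 := hq
    rw [this, mul_zero]
    exact Submodule.zero_mem _
  | succ l => exact mul_mem_polyLE hp hq

lemma totalDegree_mul_of_degree_one {p q : MvPolynomial (Fin n) ℝ} (hp : p.totalDegree = 1)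
    {k : ℕ} (h : p * q ∈ polyLE n k) : q ∈ polyLT n k := by
  rw [mem_polyLT]
  by_cases hq : q = 0
  · exact Or.inl hq
  · rw [MvPolynomial.mem_restrictTotalDegree, MvPolynomial.totalDegree_mul_of_isDomain
      (fun h0 => by simp [h0] at hp) hq, hp] at h
    exact Or.inr (by omega)

lemma degree_le_of_mem_polyLE {k : ℕ} {q : MvPolynomial (Fin n) ℝ} (hq : q ∈ polyLE n k)
    {s : Fin n →₀ ℕ} (hs : MvPolynomial.coeff s q ≠ 0) : s.degree ≤ k := by
  rw [MvPolynomial.mem_restrictTotalDegree] at hq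
  refine le_trans ?_ hq
  have := MvPolynomial.le_totalDegree (MvPolynomial.mem_support_iff.2 hs)
  simpa [Finsupp.degree_eq_sum, Finsupp.sum_fintype] using this

lemma mem_polyLE_of_degree_le {k : ℕ} {q : MvPolynomial (Fin n) ℝ}
    (h : ∀ s, MvPolynomial.coeff s q ≠ 0 → s.degree ≤ k) : q ∈ polyLE n k := by
  rw [MvPolynomial.mem_restrictTotalDegree]
  refine Finset.sup_le fun s hs => ?_
  have := h s (MvPolynomial.mem_support_iff.1 hs)
  simpa [Finsupp.degree_eq_sum, Finsupp.sum_fintype] using this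

lemma mem_polyLT_of_degree_lt {k : ℕ} {q : MvPolynomial (Fin n) ℝ}
    (h : ∀ s, MvPolynomial.coeff s q ≠ 0 → s.degree < k) : q ∈ polyLT n k := by
  cases k with
  | zero =>
    have : q = 0 := by
      ext s
      by_contra hs
      exact absurd (h s hs) (Nat.not_lt_zero _)
    rw [this]
    exact Submodule.zero_mem _
  | succ k => exact mem_polyLE_of_degree_le fun s hs => Nat.lt_succ_iff.1 (h s hs)

lemma pderiv_mem_polyLT {k : ℕ} {q : MvPolynomial (Fin n) ℝ} (hq : q ∈ polyLE n k) (j : Fin n) :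
    MvPolynomial.pderiv j q ∈ polyLT n k := by
  refine mem_polyLT_of_degree_lt fun s hs => ?_
  rw [MvPolynomial.coeff_pderiv] at hs
  have := degree_le_of_mem_polyLE hq (left_ne_zero_of_mul hs)
  rw [map_add, Finsupp.degree_single] at this
  omega

/-! ### The local Raviart-Thomas space -/

lemma mem_localRT {k : ℕ} {W : Fin n → MvPolynomial (Fin n) ℝ} :
    W ∈ localRT n k ↔ ∃ A : Fin n → MvPolynomial (Fin n) ℝ, (∀ j, A j ∈ polyLE n k) ∧
      ∃ b ∈ polyLE n k, W = fun j => A j + MvPolynomial.X j * b := by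
  rw [localRT, Submodule.mem_sup]
  constructor
  · rintro ⟨A, hA, _, ⟨b, hb, rfl⟩, rfl⟩
    exact ⟨A, fun j => hA j (mem_univ j), b, hb, rfl⟩
  · rintro ⟨A, hA, b, hb, rfl⟩
    exact ⟨A, fun j _ => hA j, _, ⟨b, hb, rfl⟩, rfl⟩

lemma totalDegree_lam (hn : 1 ≤ n) (K : Simplex n) (i : Fin (n + 1)) :
    (lam K i).totalDegree = 1 := by
  refine le_antisymm ((MvPolynomial.mem_restrictTotalDegree _ _ _).1 (lam_mem_polyLE K i)) ?_
  by_contra hc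
  obtain ⟨c, hc⟩ : ∃ c, lam K i = MvPolynomial.C c :=
    ⟨_, MvPolynomial.totalDegree_eq_zero_iff_eq_C.1 (by omega)⟩
  have : Nontrivial (Fin (n + 1)) := Fin.nontrivial_iff_two_le.2 (by omega)
  obtain ⟨j, hj⟩ := exists_ne i
  have h1 := evalPoly_lam K i (K i)
  have h2 := evalPoly_lam K i (K j)
  rw [hc, evalPoly_C, K.coord_apply_eq] at h1
  rw [hc, evalPoly_C, K.coord_apply_ne hj.symm] at h2
  linarith

/-- The normal components of fields in `RT_k` on a face are in `P_k`. -/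
lemma exists_ncomp_eq (K : Simplex n) (i : Fin (n + 1)) {k : ℕ}
    {W : Fin n → MvPolynomial (Fin n) ℝ} (hW : W ∈ localRT n k) :
    ∃ m ∈ polyLE n k, ∃ c, ncomp K i W = m + lam K i * c := by
  obtain ⟨A, hA, b, hb, rfl⟩ := mem_localRT.1 hW
  -- The linear part of `λ_i` applied to `x` is `λ_i - λ_i(0)`, so the summand `x b` contributes
  -- `λ_i b`, which vanishes on the face, and `-λ_i(0) b ∈ P_k`.
  refine ⟨ncomp K i A - MvPolynomial.C (K.coord i 0) * b, Submodule.sub_mem _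
    (ncomp_mem_polyLE K i hA) ?_, b, ?_⟩
  · simpa using mul_mem_polyLE (C_mem_polyLE 0 _) hb
  · simp only [lam, ncomp, mul_add, Finset.sum_add_distrib, add_mul, Finset.sum_mul, mul_assoc]
    ring

lemma divPoly_mem_polyLE {k : ℕ} {W : Fin n → MvPolynomial (Fin n) ℝ} (hW : W ∈ localRT n k) :
    divPoly W ∈ polyLE n k := by
  obtain ⟨A, hA, b, hb, rfl⟩ := mem_localRT.1 hW
  refine Submodule.sum_mem _ fun j _ => ?_
  rw [map_add, Derivation.leibniz, MvPolynomial.pderiv_X_self, smul_eq_mul, smul_eq_mul, mul_one]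
  exact Submodule.add_mem _ (polyLT_le_polyLE k (pderiv_mem_polyLT (hA j) j))
    (Submodule.add_mem _
      (mul_mem_polyLE_of_mem_polyLT (X_mem_polyLE j) (pderiv_mem_polyLT hb j)) hb)

/-- Divergence free fields in `RT_k` are in `P_k`. -/
lemma mem_polyLE_of_divPoly_eq_zero (hn : 1 ≤ n) {k : ℕ} {W : Fin n → MvPolynomial (Fin n) ℝ}
    (hW : W ∈ localRT n k) (h : divPoly W = 0) (j : Fin n) : W j ∈ polyLE n k := by
  obtain ⟨A, hA, b, hb, rfl⟩ := mem_localRT.1 hW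
  refine Submodule.add_mem _ (hA j) (mul_mem_polyLE_of_mem_polyLT (X_mem_polyLE j) ?_)
  refine mem_polyLT_of_degree_lt fun s hs => lt_of_le_of_ne (degree_le_of_mem_polyLE hb hs) ?_
  intro hsk
  have h1 := congrArg (MvPolynomial.coeff s) h
  rw [divPoly, MvPolynomial.coeff_sum, MvPolynomial.coeff_zero] at h1
  -- A coefficient of degree `k` of the divergence comes from degree `k + 1` of the field, where `A`
  -- has none. Summed over `j`, it is a positive multiple of the coefficient of `b`.
  have h2 : ∀ j, MvPolynomial.coeff s (MvPolynomial.pderiv j (A j + MvPolynomial.X j * b))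
      = (s j + 1 : ℝ) * MvPolynomial.coeff s b := fun j => by
    rw [map_add, MvPolynomial.coeff_add, MvPolynomial.coeff_pderiv, MvPolynomial.coeff_pderiv,
      add_comm s, MvPolynomial.coeff_X_mul]
    have : MvPolynomial.coeff (Finsupp.single j 1 + s) (A j) = 0 := by
      by_contra hc
      have := degree_le_of_mem_polyLE (hA j) hc
      rw [map_add, Finsupp.degree_single] at this
      omega
    rw [this]
    ring
  simp only [h2] at h1
  rw [← Finset.sum_mul] at h1
  refine hs ((mul_eq_zero.1 h1).resolve_left (ne_of_gt ?_))
  have : Nonempty (Fin n) := ⟨⟨0, hn⟩⟩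
  exact Finset.sum_pos (fun j _ => by positivity) Finset.univ_nonempty

lemma inner_evalVec (u : E n) (P : Fin n → MvPolynomial (Fin n) ℝ) (x : E n) :
    inner ℝ u (evalVec P x) = ∑ j, evalPoly (P j) x * u j := by
  simp [PiLp.inner_apply]

/-- Unisolvence of the degrees of freedom of the local Raviart-Thomas space. -/
lemma eq_zero_of_dofs_eq_zero (hn : 1 ≤ n) (K : Simplex n) {k : ℕ}
    {W : Fin n → MvPolynomial (Fin n) ℝ} (hW : W ∈ localRT n k)
    (h1 : ∀ i, ∀ q ∈ polyLE n k,
      faceFlux K i (evalVec W) (evalPoly (divPoly W)) (evalPoly q) = 0)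
    (h2 : ∀ P : Fin n → MvPolynomial (Fin n) ℝ, (∀ j, P j ∈ polyLT n k) →
      ∫ x in interior (body K), inner ℝ (evalVec W x) (evalVec P x) = 0) : W = 0 := by
  -- The face moments determine the normal component on each face, as it is in `P_k` there.
  have hdvd : ∀ i, lam K i ∣ ncomp K i W := fun i => by
    obtain ⟨m, hm, c, hc⟩ := exists_ncomp_eq K i hW
    rw [hc]
    refine dvd_add (lam_dvd_of_faceInt_eq_zero hn K i hm fun q hq => ?_) (dvd_mul_right _ _)
    have := h1 i q hq
    rwa [faceFlux_evalVec K i W hc (contDiff_evalPoly q), neg_eq_zero] at this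
  -- In Green's formula tested with `q = div W ∈ P_k`, the boundary terms vanish by `h1` and `∫ W ·
  -- ∇q` by `h2`. What remains is `∫ (div W)² = 0`.
  have hdiv : divPoly W = 0 := by
    refine eq_zero_of_integral_sq_eq_zero K ?_
    have hq := divPoly_mem_polyLE hW
    have h3 := sum_faceFlux (hasTraces_evalVec K W) (contDiff_evalPoly (divPoly W))
    rw [Finset.sum_eq_zero fun i _ => h1 i _ hq, pair, integral_add
      ((hasTraces_evalVec K W).integrable_fderiv (Lift.of_contDiff (contDiff_evalPoly _)))
      ((hasTraces_evalVec K W).integrable_mul (Lift.of_contDiff (contDiff_evalPoly _)))] at h3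
    have h4 := h2 (fun j => MvPolynomial.pderiv j (divPoly W)) fun j => pderiv_mem_polyLT hq j
    simp only [inner_evalVec, ← fderiv_evalPoly] at h4
    rw [h4, zero_add] at h3
    exact h3.symm
  have hWk := mem_polyLE_of_divPoly_eq_zero hn hW hdiv
  choose c hc using hdvd
  have hcd : ∀ i, c i ∈ polyLT n k := fun i =>
    totalDegree_mul_of_degree_one (totalDegree_lam hn K i) (by
      rw [← hc i]; exact ncomp_mem_polyLE K i hWk)
  -- With `dλ_i(W) = λ_i c_i` and `P = ∑ c_i ∇λ_i`, the product `W · P` is `∑ λ_i c_i²`, a sum of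
  -- nonnegative terms. Leaving out one index is harmless, since the other `dλ_i` separate vectors.
  set P : Fin n → MvPolynomial (Fin n) ℝ := fun j => ∑ i ∈ Finset.univ.erase (0 : Fin (n + 1)),
    dcoord K i (EuclideanSpace.single j 1) • c i with hP
  have h3 := h2 P fun j => Submodule.sum_mem _ fun i _ => Submodule.smul_mem _ _ (hcd i)
  have h4 : ∀ x, inner ℝ (evalVec W x) (evalVec P x)
      = ∑ i ∈ Finset.univ.erase (0 : Fin (n + 1)), K.coord i x * evalPoly (c i) x ^ 2 := fun x => by
    simp only [inner_evalVec, hP, evalPoly_sum, evalPoly_smul, Finset.sum_mul]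
    rw [Finset.sum_comm]
    refine Finset.sum_congr rfl fun i _ => ?_
    have h5 : dcoord K i (evalVec W x) = K.coord i x * evalPoly (c i) x := by
      rw [← evalPoly_ncomp, hc, evalPoly_mul, evalPoly_lam]
    rw [sq, ← mul_assoc, ← h5, clm_apply_eq_sum, Finset.sum_mul]
    exact Finset.sum_congr rfl fun j _ => by ring
  simp only [h4] at h3
  have hnn : ∀ x ∈ interior (body K), ∀ i, 0 ≤ K.coord i x * evalPoly (c i) x ^ 2 :=
    fun x hx i => mul_nonneg (mem_interior_body.1 hx i).le (sq_nonneg _)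
  have h5 := eqOn_zero_of_integral_eq_zero K (continuous_finsetSum _ fun i _ =>
    (continuous_coord K i).mul ((continuous_evalPoly (c i)).pow 2))
    (fun x hx => Finset.sum_nonneg fun i _ => hnn x hx i) h3
  have hc0 : ∀ i, i ≠ 0 → c i = 0 := fun i hi =>
    eq_zero_of_evalPoly_eq_zero isOpen_interior (interior_body_nonempty K) fun x hx => by
      have := (Finset.sum_eq_zero_iff_of_nonneg fun i _ => hnn x hx i).1 (h5 x hx) i
        (Finset.mem_erase.2 ⟨hi, Finset.mem_univ i⟩)
      exact pow_eq_zero_iff two_ne_zero |>.1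
        ((mul_eq_zero.1 this).resolve_left (mem_interior_body.1 hx i).ne')
  refine evalVec_injective (funext fun x => ?_)
  have : evalVec W x = 0 := eq_zero_of_dcoord_eq_zero_of_ne K 0 fun i hi => by
    rw [← evalPoly_ncomp, hc, hc0 i hi, mul_zero, evalPoly_zero]
  rw [this]
  ext j
  simp

/-! ### Existence of the local interpolant -/

instance (k : ℕ) : FiniteDimensional ℝ (polyLE n k) :=
  have : FiniteDimensional ℝ (Submodule.span ℝ
      (range fun l : Fin k → Option (Fin n) => ∏ i, padVar (l i))) :=
    FiniteDimensional.span_of_finite ℝ (finite_range _)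
  Submodule.finiteDimensional_of_le (polyLE_le_span k)

instance (k : ℕ) : FiniteDimensional ℝ (polyLT n k) :=
  Submodule.finiteDimensional_of_le (polyLT_le_polyLE k)

lemma mulPosition_injective (hn : 1 ≤ n) : Function.Injective (mulPosition n) := fun b c h => by
  have := congrFun h ⟨0, hn⟩
  exact mul_left_cancel₀ (MvPolynomial.X_ne_zero _) this

instance (k : ℕ) : FiniteDimensional ℝ (Submodule.pi Set.univ (fun _ : Fin n => polyLE n k)) := by
  refine Module.Finite.of_injective (M := Submodule.pi Set.univ (fun _ : Fin n => polyLE n k))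
    (N := Fin n → polyLE n k) (LinearMap.pi fun j => LinearMap.codRestrict _
      ((LinearMap.proj j).comp (Submodule.subtype _)) fun f => f.2 j (mem_univ j)) ?_
  intro f g h
  ext1
  funext j
  exact congrArg Subtype.val (congrFun h j)

instance (k : ℕ) : FiniteDimensional ℝ (localRT n k) := by
  unfold localRT
  infer_instance

/-- This is the dimension formula for a sum of subspaces: the intersection of `(P_k)ⁿ` with `x P_k`
is contained in `x P_{k-1}`. The lower bound is enough for the count in `dofMap_bijective`. -/
lemma le_finrank_localRT (hn : 1 ≤ n) (k : ℕ) :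
    (n + 1) * Module.finrank ℝ (polyLE n k)
      ≤ Module.finrank ℝ (localRT n k) + Module.finrank ℝ (polyLT n k) := by
  have h1 := Submodule.finrank_sup_add_finrank_inf_eq
    (Submodule.pi Set.univ (fun _ : Fin n => polyLE n k)) ((polyLE n k).map (mulPosition n))
  have h2 : Module.finrank ℝ ((polyLE n k).map (mulPosition n)) = Module.finrank ℝ (polyLE n k) :=
    (Submodule.equivMapOfInjective _ (mulPosition_injective hn) _).finrank_eq.symm
  have h3 : n * Module.finrank ℝ (polyLE n k)
      ≤ Module.finrank ℝ (Submodule.pi Set.univ (fun _ : Fin n => polyLE n k)) := by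
    have h4 : Function.Injective (LinearMap.codRestrict
        (Submodule.pi Set.univ (fun _ : Fin n => polyLE n k))
        (LinearMap.pi fun j => (Submodule.subtype _).comp
          (LinearMap.proj (φ := fun _ : Fin n => polyLE n k) j)) fun f j _ => (f j).2) := by
      intro f g h
      funext j
      exact Subtype.ext (congrFun (congrArg Subtype.val h) j)
    have := LinearMap.finrank_le_finrank_of_injective h4
    simpa [Module.finrank_pi_fintype] using this
  have h5 : Module.finrank ℝ ↥(Submodule.pi Set.univ (fun _ : Fin n => polyLE n k) ⊓
      (polyLE n k).map (mulPosition n)) ≤ Module.finrank ℝ (polyLT n k) := by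
    refine le_trans (Submodule.finrank_mono (t := (polyLT n k).map (mulPosition n)) ?_)
      (Submodule.finrank_map_le _ _)
    rintro _ ⟨hW, b, hb, rfl⟩
    exact ⟨b, totalDegree_mul_of_degree_one (MvPolynomial.totalDegree_X (⟨0, hn⟩ : Fin n))
      (hW ⟨0, hn⟩ (mem_univ _)), rfl⟩
  rw [← localRT] at h1
  rw [h2] at h1
  linarith [h1, h3, h5]

/-- The polynomials in `P_k` vanishing on the face opposite to the vertex `i`. -/
def vanishing (K : Simplex n) (i : Fin (n + 1)) (k : ℕ) : Submodule ℝ (polyLE n k) :=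
  ((polyLT n k).map (LinearMap.mulLeft ℝ (lam K i))).comap (polyLE n k).subtype

/-- Multiplication by `λ_i` is injective on `P_{k-1}`. The face moments annihilate this subspace, so
each face accounts for only `dim P_k - dim P_{k-1}` conditions. -/
lemma finrank_vanishing (K : Simplex n) (i : Fin (n + 1)) (k : ℕ) :
    Module.finrank ℝ (vanishing K i k) = Module.finrank ℝ (polyLT n k) := by
  have hle : (polyLT n k).map (LinearMap.mulLeft ℝ (lam K i)) ≤ polyLE n k := by
    rintro _ ⟨q, hq, rfl⟩
    exact mul_mem_polyLE_of_mem_polyLT (lam_mem_polyLE K i) hq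
  have hinj : Function.Injective (LinearMap.mulLeft ℝ (lam K i)) := fun p q h =>
    mul_left_cancel₀ (lam_ne_zero K i) h
  rw [vanishing, (Submodule.comapSubtypeEquivOfLe hle).finrank_eq,
    ← (Submodule.equivMapOfInjective _ hinj _).finrank_eq]

lemma evalVec_smul (c : ℝ) (W : Fin n → MvPolynomial (Fin n) ℝ) (x : E n) :
    evalVec (c • W) x = c • evalVec W x := by
  ext j; simp

lemma evalPoly_divPoly_smul (c : ℝ) (W : Fin n → MvPolynomial (Fin n) ℝ) (x : E n) :
    evalPoly (divPoly (c • W)) x = c * evalPoly (divPoly W) x := by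
  simp [divPoly, Finset.mul_sum]

lemma HasTraces.integrable_inner {K : Simplex n} {u : E n → E n} {d : E n → ℝ}
    (hu : HasTraces K u d) (P : Fin n → MvPolynomial (Fin n) ℝ) :
    Integrable (fun x => inner ℝ (u x) (evalVec P x)) (volume.restrict (interior (body K))) := by
  obtain ⟨C, hC⟩ := (isCompact_body K).exists_bound_of_continuousOn
    (continuous_evalVec P).continuousOn
  refine (hu.integrable.norm.mul_const C).mono'
    (hu.aestronglyMeasurable.inner (continuous_evalVec P).aestronglyMeasurable) ?_
  filter_upwards [ae_restrict_mem (measurableSet_interior_body K)] with x hx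
  exact (norm_inner_le_norm _ _).trans
    (mul_le_mul_of_nonneg_left (hC x (interior_subset hx)) (norm_nonneg _))

/-! ### Face and interior moments as linear functionals. -/

namespace HasTraces

variable {K : Simplex n} {u : E n → E n} {d : E n → ℝ}

/-- The functional `q ↦ ∫_e (u · n) q ds` on polynomials. -/
def flux (hu : HasTraces K u d) (i : Fin (n + 1)) : MvPolynomial (Fin n) ℝ →ₗ[ℝ] ℝ where
  toFun q := faceFlux K i u d (evalPoly q)
  map_add' p q := by
    rw [← faceFlux_add_right hu (contDiff_evalPoly _) (contDiff_evalPoly _)]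
    congr 1
    funext x
    exact evalPoly_add _ _ _
  map_smul' c p := by
    rw [RingHom.id_apply, smul_eq_mul, ← faceFlux_mul_right (contDiff_evalPoly _)]
    congr 1
    funext x
    exact evalPoly_smul _ _ _

lemma flux_apply (hu : HasTraces K u d) (i : Fin (n + 1)) (q : MvPolynomial (Fin n) ℝ) :
    hu.flux i q = faceFlux K i u d (evalPoly q) := rfl

/-- The functional `P ↦ ∫_K u · P dx` on polynomial vector fields. -/
def moment (hu : HasTraces K u d) : (Fin n → MvPolynomial (Fin n) ℝ) →ₗ[ℝ] ℝ where
  toFun P := ∫ x in interior (body K), inner ℝ (u x) (evalVec P x)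
  map_add' P Q := by
    rw [← integral_add (hu.integrable_inner _) (hu.integrable_inner _)]
    refine integral_congr_ae (Eventually.of_forall fun x => ?_)
    simp only [← inner_add_right, ← evalVec_add]
    rfl
  map_smul' c P := by
    rw [RingHom.id_apply, smul_eq_mul, ← integral_const_mul]
    simp only [← inner_smul_right, evalVec_smul]

lemma moment_apply (hu : HasTraces K u d) (P : Fin n → MvPolynomial (Fin n) ℝ) :
    hu.moment P = ∫ x in interior (body K), inner ℝ (u x) (evalVec P x) := rfl

end HasTraces

/-- The moments on the face opposite to the vertex `i`. -/
def faceDof {K : Simplex n} {u : E n → E n} {d : E n → ℝ} (hn : 1 ≤ n) (k : ℕ)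
    (hu : HasTraces K u d) (i : Fin (n + 1)) : (vanishing K i k).dualAnnihilator :=
  ⟨hu.flux i ∘ₗ (polyLE n k).subtype, by
    rw [Submodule.mem_dualAnnihilator]
    rintro q ⟨c, _, hc⟩
    refine faceFlux_eq_zero hn hu (contDiff_evalPoly _) i fun x _ hx => ?_
    have : q.1 = lam K i * c := hc.symm
    change evalPoly q.1 x = 0
    rw [this, evalPoly_mul, evalPoly_lam, hx, zero_mul]⟩

/-- The moments in the interior. -/
def interiorDof {K : Simplex n} {u : E n → E n} {d : E n → ℝ} (k : ℕ) (hu : HasTraces K u d) :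
    Module.Dual ℝ (Fin n → polyLT n k) :=
  hu.moment ∘ₗ LinearMap.pi fun j => (polyLT n k).subtype ∘ₗ LinearMap.proj j

lemma interiorDof_apply {K : Simplex n} {u : E n → E n} {d : E n → ℝ} (k : ℕ)
    (hu : HasTraces K u d) (P : Fin n → polyLT n k) : interiorDof k hu P
      = ∫ x in interior (body K), inner ℝ (u x) (evalVec (fun j => (P j).1) x) := rfl

lemma isLocalInterpolant_iff {K : Simplex n} {u : E n → E n} {d : E n → ℝ} (hn : 1 ≤ n) {k : ℕ}
    (hu : HasTraces K u d) {W : Fin n → MvPolynomial (Fin n) ℝ} :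
    IsLocalInterpolant K k u d W ↔ W ∈ localRT n k ∧
      (∀ i, faceDof hn k (hasTraces_evalVec K W) i = faceDof hn k hu i) ∧
      interiorDof k (hasTraces_evalVec K W) = interiorDof k hu := by
  have hW := hasTraces_evalVec K W
  refine and_congr_right fun _ => and_congr (forall_congr' fun i => ?_) ?_
  · constructor
    · intro h
      refine Subtype.ext (LinearMap.ext fun q => ?_)
      have := h q.1 q.2
      rw [faceFlux_sub_left hu hW (contDiff_evalPoly _), sub_eq_zero] at this
      exact this.symm
    · intro h q hq
      rw [faceFlux_sub_left hu hW (contDiff_evalPoly _), sub_eq_zero]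
      exact (congrArg (fun f => f.1 ⟨q, hq⟩) h).symm
  · have key : ∀ P : Fin n → polyLT n k,
        ∫ x in body K, inner ℝ (u x - evalVec W x) (evalVec (fun j => (P j).1) x)
          = interiorDof k hu P - interiorDof k hW P := fun P => by
      rw [← setIntegral_congr_set (interior_body_ae_eq K), interiorDof_apply, interiorDof_apply,
        ← integral_sub (hu.integrable_inner _) (hW.integrable_inner _)]
      simp only [inner_sub_left]
    constructor
    · intro h
      refine LinearMap.ext fun P => ?_
      have := h (fun j => (P j).1) fun j => mem_polyLT.1 (P j).2
      rw [key, sub_eq_zero] at this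
      exact this.symm
    · intro h P hP
      have := key fun j => ⟨P j, mem_polyLT.2 (hP j)⟩
      rw [this, h, sub_self]

/-- The degrees of freedom of the local Raviart-Thomas space. -/
def dofMap (hn : 1 ≤ n) (K : Simplex n) (k : ℕ) : localRT n k →ₗ[ℝ]
    ((i : Fin (n + 1)) → (vanishing K i k).dualAnnihilator) ×
      Module.Dual ℝ (Fin n → polyLT n k) where
  toFun W := (faceDof hn k (hasTraces_evalVec K W.1), interiorDof k (hasTraces_evalVec K W.1))
  map_add' V W := by
    refine Prod.ext (funext fun i => Subtype.ext (LinearMap.ext fun q => ?_))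
      (LinearMap.ext fun P => ?_)
    · refine Eq.trans ?_ (faceFlux_add_left (hasTraces_evalVec K V.1) (hasTraces_evalVec K W.1)
        (contDiff_evalPoly q.1) i)
      simp only [← evalVec_add, ← evalPoly_divPoly_add]
      rfl
    · refine Eq.trans ?_ (integral_add
        ((hasTraces_evalVec K V.1).integrable_inner fun j => (P j).1)
        ((hasTraces_evalVec K W.1).integrable_inner fun j => (P j).1))
      simp only [← inner_add_left, ← evalVec_add]
      rfl
  map_smul' c W := by
    refine Prod.ext (funext fun i => Subtype.ext (LinearMap.ext fun q => ?_))
      (LinearMap.ext fun P => ?_)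
    · refine Eq.trans ?_ (faceFlux_smul_left c i)
      refine faceFlux_congr_ae i (Eventually.of_forall fun x => ?_)
        (Eventually.of_forall fun x => ?_)
      · exact evalVec_smul c W.1 x
      · exact evalPoly_divPoly_smul c W.1 x
    · refine Eq.trans ?_ (integral_const_mul c _)
      refine integral_congr_ae (Eventually.of_forall fun x => ?_)
      simp only [SetLike.val_smul, evalVec_smul, real_inner_smul_left]

/-- Injectivity is unisolvence. The target has dimension `(n + 1) (dim P_k - dim P_{k-1}) + n dim
P_{k-1} = (n + 1) dim P_k - dim P_{k-1}`, which is at most `dim RT_k`. -/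
lemma dofMap_bijective (hn : 1 ≤ n) (K : Simplex n) (k : ℕ) :
    Function.Bijective (dofMap hn K k) := by
  have hinj : Function.Injective (dofMap hn K k) := by
    refine (injective_iff_map_eq_zero (dofMap hn K k)).2 fun W hW => ?_
    refine Subtype.ext (eq_zero_of_dofs_eq_zero hn K W.2 (fun i q hq => ?_) fun P hP => ?_)
    · exact congrArg (fun f => (f.1 i).1 ⟨q, hq⟩) hW
    · exact congrArg (fun f => f.2 fun j => ⟨P j, hP j⟩) hW
  suffices h : Module.finrank ℝ (localRT n k) = Module.finrank ℝ
      (((i : Fin (n + 1)) → (vanishing K i k).dualAnnihilator) ×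
        Module.Dual ℝ (Fin n → polyLT n k)) by
    have h' := LinearMap.injective_iff_surjective_of_finrank_eq_finrank (V := localRT n k)
      (V₂ := ((i : Fin (n + 1)) → (vanishing K i k).dualAnnihilator) ×
        Module.Dual ℝ (Fin n → polyLT n k)) (f := dofMap hn K k) h
    exact ⟨hinj, h'.1 hinj⟩
  refine le_antisymm (LinearMap.finrank_le_finrank_of_injective hinj) ?_
  have h1 : ∀ i, Module.finrank ℝ (vanishing K i k).dualAnnihilator
      = Module.finrank ℝ (polyLE n k) - Module.finrank ℝ (polyLT n k) := fun i => by
    have := Subspace.finrank_add_finrank_dualAnnihilator_eq (vanishing K i k)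
    rw [finrank_vanishing] at this
    omega
  have h2 := le_finrank_localRT hn k
  have h3 := Submodule.finrank_mono (polyLT_le_polyLE (n := n) k)
  have : ∀ i, Module.Free ℝ (vanishing K i k).dualAnnihilator := fun i => by
    have := Module.Free.of_divisionRing ℝ (V := (vanishing K i k).dualAnnihilator)
    exact this
  rw [Module.finrank_prod, Module.finrank_pi_fintype, Subspace.dual_finrank_eq,
    Module.finrank_pi_fintype]
  simp only [h1, Finset.sum_const, Finset.card_univ, Fintype.card_fin, smul_eq_mul]
  obtain ⟨a, ha⟩ := Nat.exists_eq_add_of_le h3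
  rw [ha] at h2 ⊢
  rw [Nat.add_sub_cancel_left]
  nlinarith

lemma existsUnique_isLocalInterpolant (hn : 1 ≤ n) {K : Simplex n} (k : ℕ) {u : E n → E n}
    {d : E n → ℝ} (hu : HasTraces K u d) : ∃! W, IsLocalInterpolant K k u d W := by
  obtain ⟨W, hW⟩ := (dofMap_bijective hn K k).2 (faceDof hn k hu, interiorDof k hu)
  refine ⟨W.1, (isLocalInterpolant_iff hn hu).2 ⟨W.2, fun i => congrFun (congrArg Prod.fst hW) i,
    congrArg Prod.snd hW⟩, fun V hV => ?_⟩
  obtain ⟨h1, h2, h3⟩ := (isLocalInterpolant_iff hn hu).1 hV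
  have : (⟨V, h1⟩ : localRT n k) = W :=
    (dofMap_bijective hn K k).1 (hW.symm ▸ Prod.ext (funext h2) h3)
  exact congrArg Subtype.val this

/-! ### Simplices with a common face -/

lemma coord_eq_sum (K L : Simplex n) (j : Fin (n + 1)) (x : E n) :
    L.coord j x = ∑ k, K.coord k x * L.coord j (K k) := by
  have h1 : dcoord L j x = ∑ k, K.coord k x * dcoord L j (K k) := by
    conv_lhs => rw [← K.linear_combination_coord_eq_self x, map_sum]
    simp
  have h2 : ∀ y, L.coord j y = dcoord L j y + L.coord j 0 := fun y => by
    simpa using coord_eq L j y 0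
  simp only [h2 x, fun k => h2 (K k), mul_add, Finset.sum_add_distrib, ← Finset.sum_mul,
    sum_coord, h1, one_mul]

lemma mem_facet {K : Simplex n} {i : Fin (n + 1)} {v : E n} :
    v ∈ facet K i ↔ ∃ j, j ≠ i ∧ K j = v := by
  simp [facet]

lemma card_facet (K : Simplex n) (i : Fin (n + 1)) : (facet K i).card = n := by
  rw [facet, Finset.card_image_of_injective _ K.ind.injective,
    Finset.card_erase_of_mem (Finset.mem_univ i), Finset.card_univ, Fintype.card_fin]
  simp

lemma facet_injective (K : Simplex n) : Function.Injective (facet K) := fun i j h => by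
  by_contra hij
  have : K j ∈ facet K i := mem_facet.2 ⟨j, fun h => hij h.symm, rfl⟩
  rw [h, mem_facet] at this
  obtain ⟨k, hk, hk'⟩ := this
  exact hk (K.ind.injective hk')

lemma coord_vertex_eq_zero {K L : Simplex n} {i i' : Fin (n + 1)} (h : facet K i = facet L i')
    {k : Fin (n + 1)} (hk : k ≠ i) : L.coord i' (K k) = 0 := by
  have : K k ∈ facet L i' := h ▸ mem_facet.2 ⟨k, hk, rfl⟩
  obtain ⟨j, hj, hj'⟩ := mem_facet.1 this
  rw [← hj', L.coord_apply_ne hj.symm]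

/-- The barycentric coordinates of a common face are proportional. -/
lemma coord_eq_mul_coord {K L : Simplex n} {i i' : Fin (n + 1)} (h : facet K i = facet L i')
    (x : E n) : L.coord i' x = L.coord i' (K i) * K.coord i x := by
  rw [coord_eq_sum K L, Finset.sum_eq_single i (fun k _ hk => by
    rw [coord_vertex_eq_zero h hk, mul_zero]) (by simp), mul_comm]

lemma coord_vertex_eq {K L : Simplex n} {j j' : Fin (n + 1)} (hj : K j' = L j)
    (k : Fin (n + 1)) {i i' : Fin (n + 1)} (h : facet K i = facet L i') (hk : k ≠ i) :
    L.coord j (K k) = if k = j' then 1 else 0 := by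
  split_ifs with hkj
  · rw [hkj, hj, L.coord_apply_eq]
  · have : K k ∈ facet L i' := h ▸ mem_facet.2 ⟨k, hk, rfl⟩
    obtain ⟨l, _, hl'⟩ := mem_facet.1 this
    rw [← hl', L.coord_apply_ne]
    rintro rfl
    exact hkj (K.ind.injective (hl'.symm.trans hj.symm))

lemma coord_eq_coord_of_face {K L : Simplex n} {i i' : Fin (n + 1)} (h : facet K i = facet L i')
    {x : E n} (hx : K.coord i x = 0) {j j' : Fin (n + 1)} (hj : K j' = L j) :
    L.coord j x = K.coord j' x := by
  rw [coord_eq_sum K L, Finset.sum_eq_single j' (fun k _ hk => ?_) (by simp), hj,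
    L.coord_apply_eq, mul_one]
  by_cases hki : k = i
  · rw [hki, hx, zero_mul]
  · rw [coord_vertex_eq hj k h hki, if_neg hk, mul_zero]

lemma exists_eq_vertex {K L : Simplex n} {i i' : Fin (n + 1)} (h : facet K i = facet L i')
    {j : Fin (n + 1)} (hj : j ≠ i') : ∃ j', j' ≠ i ∧ K j' = L j :=
  mem_facet.1 (h ▸ mem_facet.2 ⟨j, hj, rfl⟩)

lemma mem_body_of_face {K L : Simplex n} {i i' : Fin (n + 1)} (h : facet K i = facet L i')
    {x : E n} (hx : x ∈ body K) (hi : K.coord i x = 0) : x ∈ body L ∧ L.coord i' x = 0 := by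
  have h0 : L.coord i' x = 0 := by rw [coord_eq_mul_coord h, hi, mul_zero]
  refine ⟨mem_body.2 fun j => ?_, h0⟩
  by_cases hj : j = i'
  · rw [hj, h0]
  · obtain ⟨j', _, hj2⟩ := exists_eq_vertex h hj
    rw [coord_eq_coord_of_face h hi hj2]
    exact mem_body.1 hx j'

/-- The barycentric coordinate corresponding to the vertex `v`. -/
def vcoord (K : Simplex n) (v : E n) (x : E n) : ℝ :=
  open Classical in ∑ j, if K j = v then K.coord j x else 0

lemma vcoord_vertex (K : Simplex n) (j : Fin (n + 1)) (x : E n) :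
    vcoord K (K j) x = K.coord j x := by
  classical
  simp [vcoord, K.ind.injective.eq_iff]

/-- Indexing the factors by vertices instead of numbers makes the cutoffs of two simplices with a
common face comparable, as their vertex numberings are unrelated. -/
lemma cutoff_erase (K : Simplex n) (i : Fin (n + 1)) (m : ℕ) (x : E n) :
    cutoff K (Finset.univ.erase i) m x
      = ∏ v ∈ facet K i, Real.smoothTransition (m * vcoord K v x - 1) := by
  rw [facet, Finset.prod_image fun j _ k _ h => K.ind.injective h, cutoff]
  simp only [vcoord_vertex]

lemma cutoff_eq_cutoff_of_face {K L : Simplex n} {i i' : Fin (n + 1)} (h : facet K i = facet L i')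
    {x : E n} (hi : K.coord i x = 0) (m : ℕ) :
    cutoff K (Finset.univ.erase i) m x = cutoff L (Finset.univ.erase i') m x := by
  rw [cutoff_erase, cutoff_erase, ← h]
  refine Finset.prod_congr rfl fun v hv => ?_
  obtain ⟨j, _, rfl⟩ := mem_facet.1 hv
  obtain ⟨j', _, hj'⟩ := mem_facet.1 (h ▸ hv)
  rw [vcoord_vertex, ← hj', vcoord_vertex, coord_eq_coord_of_face h hi hj'.symm]

/-! ### Comparison of the integrals over a common face -/

/-- The affine map which fixes the face of `K` opposite to the vertex `i` and maps this vertex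
to `z`. -/
def shear (K : Simplex n) (i : Fin (n + 1)) (z x : E n) : E n := x + K.coord i x • (z - K i)

lemma hasFDerivAt_shear (K : Simplex n) (i : Fin (n + 1)) (z x : E n) :
    HasFDerivAt (shear K i z)
      (ContinuousLinearMap.id ℝ (E n) + (dcoord K i).smulRight (z - K i)) x :=
  (hasFDerivAt_id x).add ((hasFDerivAt_coord K i x).smul_const (z - K i))

lemma contDiff_shear (K : Simplex n) (i : Fin (n + 1)) (z : E n) :
    ContDiff ℝ ∞ (shear K i z) :=
  contDiff_id.add ((contDiff_coord K i).smul contDiff_const)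

lemma coord_shear (K L : Simplex n) (i i' j : Fin (n + 1)) (x : E n) :
    L.coord j (shear K i (L i') x) = ∑ k ∈ Finset.univ.erase i, K.coord k x * L.coord j (K k)
      + K.coord i x * (if j = i' then 1 else 0) := by
  rw [coord_eq L j _ x, shear, add_sub_cancel_left, map_smul, smul_eq_mul,
    coord_eq_sum K L j x, ← Finset.add_sum_erase _ _ (Finset.mem_univ i), ← L.coord_apply j i',
    coord_eq L j (L i') (K i)]
  ring

section shear

variable {K L : Simplex n} {i i' : Fin (n + 1)}

lemma coord_shear_self (h : facet K i = facet L i') (x : E n) :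
    L.coord i' (shear K i (L i') x) = K.coord i x := by
  rw [coord_shear, if_pos rfl, Finset.sum_eq_zero fun k hk => by
    rw [coord_vertex_eq_zero h (Finset.ne_of_mem_erase hk), mul_zero]]
  ring

lemma coord_shear_of_ne (h : facet K i = facet L i') {j j' : Fin (n + 1)} (hj : K j' = L j)
    (hj' : j' ≠ i) (hji : j ≠ i') (x : E n) :
    L.coord j (shear K i (L i') x) = K.coord j' x := by
  rw [coord_shear, if_neg hji, Finset.sum_eq_single j' (fun k hk hkj => by
    rw [coord_vertex_eq hj k h (Finset.ne_of_mem_erase hk), if_neg hkj, mul_zero])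
    (fun hc => absurd (Finset.mem_erase.2 ⟨hj', Finset.mem_univ _⟩) hc),
    coord_vertex_eq hj j' h hj', if_pos rfl]
  ring

lemma shear_mem_interior (h : facet K i = facet L i') {x : E n} (hx : x ∈ interior (body K)) :
    shear K i (L i') x ∈ interior (body L) := by
  rw [mem_interior_body] at hx ⊢
  intro j
  by_cases hj : j = i'
  · rw [hj, coord_shear_self h]
    exact hx i
  · obtain ⟨j', hj1, hj2⟩ := exists_eq_vertex h hj
    rw [coord_shear_of_ne h hj2 hj1 hj]
    exact hx j'

lemma shear_shear (h : facet K i = facet L i') (x : E n) :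
    shear L i' (K i) (shear K i (L i') x) = x := by
  rw [shear, coord_shear_self h, shear]
  module

/-- The integrals over a common face of two simplices coincide up to a constant factor. -/
lemma exists_faceInt_eq (hn : 1 ≤ n) (h : facet K i = facet L i') :
    ∃ c : ℝ, ∀ g : E n → ℝ, ContDiff ℝ ∞ g → faceInt L i' g = c * faceInt K i g := by
  -- The constant is the Jacobian of the affine map from `K` onto `L` that fixes the common face. It
  -- carries the field `x - v_i` to `x - L i'`.
  refine ⟨|(ContinuousLinearMap.id ℝ (E n) + (dcoord K i).smulRight (L i' - K i)).det|,
    fun g hg => ?_⟩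
  have himage : shear K i (L i') '' interior (body K) = interior (body L) := by
    refine Subset.antisymm ?_ fun y hy => ?_
    · rintro _ ⟨x, hx, rfl⟩
      exact shear_mem_interior h hx
    · exact ⟨shear L i' (K i) y, shear_mem_interior h.symm hy, shear_shear h.symm y⟩
  have hgR : ContDiff ℝ ∞ (fun x => g (shear K i (L i') x)) := hg.comp (contDiff_shear K i (L i'))
  -- The affine map is the identity on the face, and `faceInt` sees only the values there.
  have h1 : faceInt K i g = faceInt K i (fun x => g (shear K i (L i') x)) :=
    faceInt_congr hn K i hg hgR fun x _ hx => by rw [shear, hx, zero_smul, add_zero]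
  rw [h1, faceInt, pair, ← himage, integral_image_eq_integral_abs_det_fderiv_smul volume
    (measurableSet_interior_body K) (fun x _ => (hasFDerivAt_shear K i (L i') x).hasFDerivWithinAt)
    (fun x _ y _ hxy => by
      simpa only [shear_shear h] using congrArg (shear L i' (K i)) hxy),
    faceInt, pair, ← integral_const_mul]
  refine setIntegral_congr_fun (measurableSet_interior_body K) fun x _ => ?_
  have h2 : fderiv ℝ (fun x => g (shear K i (L i') x)) x = (fderiv ℝ g (shear K i (L i') x)).comp
      (ContinuousLinearMap.id ℝ (E n) + (dcoord K i).smulRight (L i' - K i)) :=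
    ((hg.differentiable (by simp)).differentiableAt.hasFDerivAt.comp x
      (hasFDerivAt_shear K i (L i') x)).fderiv
  have h3 : shear K i (L i') x - L i'
      = (ContinuousLinearMap.id ℝ (E n) + (dcoord K i).smulRight (L i' - K i)) (x - K i) := by
    have := coord_eq K i x (K i)
    rw [K.coord_apply_eq] at this
    rw [shear, this]
    simp only [add_apply, ContinuousLinearMap.id_apply, ContinuousLinearMap.smulRight_apply]
    module
  simp only [evalVec_pos, evalPoly_divPoly_pos, smul_eq_mul, h2, ContinuousLinearMap.comp_apply, h3]

end shear

namespace Triangulation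

variable {ι : Type*} (T : Triangulation n ι)

/-! ### The cells of a triangulation -/

lemma interior_body_subset (k : ι) : interior (body (T.cell k)) ⊆ T.Ω :=
  interior_mono (subset_iUnion (fun k => body (T.cell k)) k)

lemma exists_vertex_notMem {k l : ι} (hkl : k ≠ l) :
    ∃ i, T.cell k i ∉ Set.range (T.cell l) := by
  by_contra! hc
  have hsub : Set.range (T.cell k) ⊆ Set.range (T.cell l) := by
    rintro _ ⟨i, rfl⟩
    exact hc i
  have hcard : ∀ k, (Set.range (T.cell k)).ncard = n + 1 := fun k => by
    rw [Set.ncard_range_of_injective (T.cell k).ind.injective]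
    simp
  exact T.distinct k l hkl (Set.eq_of_subset_of_ncard_le hsub (by rw [hcard, hcard])
    (Set.finite_range _))

/-- By conformity the intersection is spanned by the common vertices, and at all of these `λ_i`
vanishes because `v_i` is not among them. -/
lemma coord_eq_zero_of_mem_inter {k l : ι} {i : Fin (n + 1)}
    (hi : T.cell k i ∉ Set.range (T.cell l)) {x : E n} (hk : x ∈ body (T.cell k))
    (hl : x ∈ body (T.cell l)) : (T.cell k).coord i x = 0 := by
  have hx : x ∈ convexHull ℝ (Set.range (T.cell k) ∩ Set.range (T.cell l)) := by
    rw [← T.conforming]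
    exact ⟨hk, hl⟩
  have hconv : Convex ℝ {y | (T.cell k).coord i y = 0} :=
    (convex_singleton (0 : ℝ)).affine_preimage ((T.cell k).coord i)
  refine convexHull_min ?_ hconv hx
  rintro _ ⟨⟨j, rfl⟩, hj⟩
  refine (T.cell k).coord_apply_ne ?_
  rintro rfl
  exact hi hj

lemma notMem_body_of_mem_interior {k l : ι} (hkl : k ≠ l) {x : E n}
    (hx : x ∈ interior (body (T.cell k))) : x ∉ body (T.cell l) := fun hl => by
  obtain ⟨i, hi⟩ := T.exists_vertex_notMem hkl
  exact (mem_interior_body.1 hx i).ne' (T.coord_eq_zero_of_mem_inter hi (interior_subset hx) hl)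

lemma omega_inter_body_ae_eq (k : ι) :
    (T.Ω ∩ body (T.cell k) : Set (E n)) =ᵐ[volume] interior (body (T.cell k)) := by
  refine (LE.le.eventuallyLE inter_subset_right).antisymm ?_ |>.trans
    (interior_body_ae_eq (T.cell k)).symm
  exact (interior_body_ae_eq (T.cell k)).symm.le.trans
    (LE.le.eventuallyLE (subset_inter (T.interior_body_subset k) interior_subset))

lemma restrict_omega_inter_body (k : ι) : volume.restrict (T.Ω ∩ body (T.cell k))
    = volume.restrict (interior (body (T.cell k))) :=
  Measure.restrict_congr_set (T.omega_inter_body_ae_eq k)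

lemma omega_ae_eq [Finite ι] : T.Ω =ᵐ[volume] (⋃ k, interior (body (T.cell k)) : Set (E n)) := by
  refine EventuallyLE.antisymm ?_ (LE.le.eventuallyLE
    (iUnion_subset fun k => T.interior_body_subset k))
  refine (LE.le.eventuallyLE interior_subset).trans ?_
  exact (Filter.EventuallyEq.countable_iUnion fun k => (interior_body_ae_eq (T.cell k)).symm).le

lemma ae_omega [Finite ι] {P : E n → Prop}
    (h : ∀ k, ∀ᵐ x ∂(volume.restrict (interior (body (T.cell k)))), P x) :
    ∀ᵐ x ∂(volume.restrict T.Ω), P x := by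
  rw [Measure.restrict_congr_set T.omega_ae_eq, ae_restrict_iUnion_iff]
  exact h

lemma ae_cell_of_ae_omega {P : E n → Prop} (h : ∀ᵐ x ∂(volume.restrict T.Ω), P x) (k : ι) :
    ∀ᵐ x ∂(volume.restrict (interior (body (T.cell k)))), P x :=
  ae_restrict_of_ae_restrict_of_subset (T.interior_body_subset k) h

lemma setIntegral_omega [Fintype ι] {f : E n → ℝ}
    (hf : ∀ k, IntegrableOn f (interior (body (T.cell k)))) :
    ∫ x in T.Ω, f x = ∑ k, ∫ x in interior (body (T.cell k)), f x := by
  rw [setIntegral_congr_set T.omega_ae_eq, integral_iUnion_fintype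
    (fun k => measurableSet_interior_body _) (fun k l hkl => ?_) hf]
  exact Set.disjoint_left.2 fun x hx hx' =>
    T.notMem_body_of_mem_interior hkl hx (interior_subset hx')

variable [Fintype ι]

lemma mem_sides {e : Finset (E n)} {s : ι × Fin (n + 1)} :
    s ∈ T.sides e ↔ facet (T.cell s.1) s.2 = e := by
  simp [sides]

lemma fst_injOn_sides (e : Finset (E n)) : Set.InjOn Prod.fst (T.sides e : Set (ι × Fin (n + 1))) :=
  fun s hs t ht h => by
    rw [Finset.mem_coe, mem_sides] at hs ht
    refine Prod.ext h (facet_injective (T.cell s.1) ?_)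
    rw [hs, h, ht]

/-- A cell which contains a point of the relative interior of a face has this face as one of its
faces. -/
lemma exists_mem_sides {k l : ι} {i : Fin (n + 1)} {x : E n} (hk : x ∈ body (T.cell k))
    (hx : ∀ j, j ≠ i → (T.cell k).coord j x ≠ 0) (hl : x ∈ body (T.cell l)) :
    ∃ i', (l, i') ∈ T.sides (facet (T.cell k) i) := by
  have hsub : ∀ v ∈ facet (T.cell k) i, ∃ j, T.cell l j = v := fun v hv => by
    obtain ⟨j, hj, rfl⟩ := mem_facet.1 hv
    by_contra hc
    exact hx j hj (T.coord_eq_zero_of_mem_inter hc hk hl)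
  obtain ⟨i', hi'⟩ : ∃ i', T.cell l i' ∉ facet (T.cell k) i := by
    by_contra! hc
    have h1 : (Finset.univ.image (T.cell l)) ⊆ facet (T.cell k) i := by
      intro v hv
      obtain ⟨j, _, rfl⟩ := Finset.mem_image.1 hv
      exact hc j
    have h2 := Finset.card_le_card h1
    rw [Finset.card_image_of_injective _ (T.cell l).ind.injective, card_facet, Finset.card_univ,
      Fintype.card_fin] at h2
    omega
  refine ⟨i', T.mem_sides.2 (Finset.eq_of_subset_of_card_le (fun v hv => ?_) ?_).symm⟩
  · obtain ⟨j, rfl⟩ := hsub v hv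
    refine mem_facet.2 ⟨j, ?_, rfl⟩
    rintro rfl
    exact hi' hv
  · simp only [card_facet, le_refl]

/-- Two cells with a common face lie on different sides of it. -/
lemma coord_vertex_neg {e : Finset (E n)} {s t : ι × Fin (n + 1)} (hs : s ∈ T.sides e)
    (ht : t ∈ T.sides e) (hst : s ≠ t) : (T.cell t.1).coord t.2 (T.cell s.1 s.2) < 0 := by
  -- For `n = 0` the space is a single point, so two distinct cells cannot exist.
  have hn : n ≠ 0 := by
    rintro rfl
    refine hst (T.fst_injOn_sides e hs ht ?_)
    by_contra hne
    refine T.distinct _ _ hne ?_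
    have hE : ∀ x y : E 0, x = y := fun x y => by ext j; exact j.elim0
    ext x
    exact ⟨fun _ => ⟨0, hE _ _⟩, fun _ => ⟨0, hE _ _⟩⟩
  have hn' : (0 : ℝ) < n := by exact_mod_cast Nat.pos_of_ne_zero hn
  have hne : s.1 ≠ t.1 := fun h => hst (T.fst_injOn_sides e hs ht h)
  rw [mem_sides] at hs ht
  set K := T.cell s.1
  set L := T.cell t.1
  set i := s.2
  set i' := t.2
  have h : facet K i = facet L i' := hs.trans ht.symm
  have h0 : L.coord i' (K i) ≠ 0 := fun hc => by
    have := coord_eq_mul_coord h (L i')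
    rw [hc, L.coord_apply_eq] at this
    linarith
  refine lt_of_le_of_ne (le_of_not_gt fun hpos => ?_) h0
  -- These are the weights of the barycentre of the common face. If the coordinate were positive,
  -- moving from there slightly towards `K i` would lead into the interior of both cells.
  set w : Fin (n + 1) → ℝ := fun j => if j = i then 0 else (n : ℝ)⁻¹ with hw
  have hw1 : ∑ j, w j = 1 := by
    have hsum : ∑ j ∈ Finset.univ.erase i, w j = ∑ _j ∈ Finset.univ.erase i, (n : ℝ)⁻¹ :=
      Finset.sum_congr rfl fun j hj => if_neg (Finset.ne_of_mem_erase hj)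
    rw [← Finset.add_sum_erase _ _ (Finset.mem_univ i), hsum, Finset.sum_const,
      Finset.card_erase_of_mem (Finset.mem_univ i), Finset.card_univ, Fintype.card_fin, hw]
    simp [hn'.ne']
  set y : E n := Finset.univ.affineCombination ℝ K w with hy
  have hyc : ∀ j, K.coord j y = w j := fun j =>
    K.coord_apply_combination_of_mem (Finset.mem_univ j) hw1
  have hyi : K.coord i y = 0 := by rw [hyc, hw]; simp
  have hyj : ∀ j, j ≠ i → 0 < K.coord j y := fun j hj => by
    rw [hyc, hw]
    simp only [if_neg hj]
    positivity
  set z : ℝ → E n := fun ε => y + ε • (K i - y) with hz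
  have hzc : Continuous z := by fun_prop
  have hz0 : z 0 = y := by simp [hz]
  have hzi : ∀ ε, K.coord i (z ε) = ε := fun ε => by
    rw [coord_eq K i _ y, hz, add_sub_cancel_left, map_smul, smul_eq_mul]
    have := coord_eq K i (K i) y
    rw [K.coord_apply_eq, hyi] at this
    rw [hyi]
    linear_combination (-ε) * this
  have ev : ∀ (M : Simplex n) (j : Fin (n + 1)), 0 < M.coord j y →
      ∀ᶠ ε in 𝓝[>] (0 : ℝ), 0 < M.coord j (z ε) := fun M j hM => by
    have : Tendsto (fun ε => M.coord j (z ε)) (𝓝[>] 0) (𝓝 (M.coord j y)) := by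
      have := ((continuous_coord M j).comp hzc).tendsto 0
      simp only [Function.comp_def, hz0] at this
      exact this.mono_left nhdsWithin_le_nhds
    exact this.eventually (lt_mem_nhds hM)
  have e1 : ∀ᶠ ε in 𝓝[>] (0 : ℝ), ∀ j, 0 < K.coord j (z ε) := by
    rw [eventually_all]
    intro j
    by_cases hj : j = i
    · filter_upwards [self_mem_nhdsWithin] with ε hε
      rw [hj, hzi]
      exact hε
    · exact ev K j (hyj j hj)
  have e2 : ∀ᶠ ε in 𝓝[>] (0 : ℝ), ∀ j, 0 < L.coord j (z ε) := by
    rw [eventually_all]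
    intro j
    by_cases hj : j = i'
    · filter_upwards [self_mem_nhdsWithin] with ε hε
      rw [hj, coord_eq_mul_coord h, hzi]
      exact mul_pos hpos hε
    · obtain ⟨j', hj1, hj2⟩ := exists_eq_vertex h hj
      refine ev L j ?_
      rw [coord_eq_coord_of_face h hyi hj2]
      exact hyj j' hj1
  obtain ⟨ε, h1, h2⟩ := (e1.and e2).exists
  exact T.notMem_body_of_mem_interior hne (mem_interior_body.2 h1)
    (interior_subset (mem_interior_body.2 h2))

/-- Coordinates belonging to a common face are proportional. With three cells, each pair on opposite
sides, `h4` would make a negative number the product of two negative ones. -/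
lemma card_sides_le_two (e : Finset (E n)) : (T.sides e).card ≤ 2 := by
  by_contra! hc
  obtain ⟨s, t, r, hs, ht, hr, hst, hsr, htr⟩ := Finset.two_lt_card_iff.1 hc
  have h1 := T.coord_vertex_neg hs ht hst
  have h2 := T.coord_vertex_neg hs hr hsr
  have h3 := T.coord_vertex_neg ht hr htr
  rw [mem_sides] at hs ht hr
  have h4 := coord_eq_mul_coord (ht.trans hr.symm) (T.cell s.1 s.2)
  nlinarith [mul_pos_of_neg_of_neg h1 h3]

end Triangulation

namespace Triangulation

variable {ι : Type*} [Fintype ι] (T : Triangulation n ι)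

/-! ### Continuity of the normal trace across faces -/

/-- The part of the face on which the cutoff can be nonzero is compact and has positive distance to
all other faces of the adjacent cells and to all other cells. A bump function around it extends the
cutoff to a global test function that sees only the face `e`. -/
lemma exists_face_cutoff {e : Finset (E n)} {s₀ : ι × Fin (n + 1)} (hs₀ : s₀ ∈ T.sides e)
    (m : ℕ) : ∃ φ : E n → ℝ, ContDiff ℝ ∞ φ ∧ HasCompactSupport φ ∧
      (∀ s ∈ T.sides e, ∀ x ∈ body (T.cell s.1), (T.cell s.1).coord s.2 x = 0 →
        φ x = cutoff (T.cell s.1) (Finset.univ.erase s.2) m x) ∧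
      (∀ l, (∀ i, (l, i) ∉ T.sides e) → ∀ x ∈ body (T.cell l), φ x = 0) ∧
      ∀ s ∈ T.sides e, ∀ j, j ≠ s.2 → ∃ C, ∀ x ∈ interior (body (T.cell s.1)),
        |φ x| ≤ C * (T.cell s.1).coord j x := by
  classical
  set K := T.cell s₀.1 with hK
  set i := s₀.2 with hi
  have hface : ∀ s ∈ T.sides e, facet K i = facet (T.cell s.1) s.2 := fun s hs =>
    (T.mem_sides.1 hs₀).trans (T.mem_sides.1 hs).symm
  -- On the compact set `C` below, `λ_j ≥ 1 / m > δ`. On the open set `O`, where `λ_j > δ`, a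
  -- function bounded by `1` is at most `λ_j / δ = 2 (m + 1) λ_j`.
  set δ : ℝ := (2 * (m + 1) : ℝ)⁻¹ with hδ
  have hδ0 : 0 < δ := by positivity
  set C : Set (E n) := {x | x ∈ body K ∧ K.coord i x = 0 ∧ ∀ j, j ≠ i → 1 ≤ m * K.coord j x} with hC
  have hCc : IsCompact C := by
    refine (isCompact_body K).inter_right (t := {x | K.coord i x = 0 ∧
      ∀ j, j ≠ i → 1 ≤ m * K.coord j x}) ?_
    refine (isClosed_eq (continuous_coord K i) continuous_const).inter ?_
    change IsClosed {x | ∀ j, j ≠ i → 1 ≤ m * K.coord j x}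
    simp only [ofPred_forall]
    exact isClosed_iInter fun j => isClosed_iInter fun _ =>
      isClosed_le continuous_const (continuous_const.mul (continuous_coord K j))
  obtain ⟨R, hR⟩ := hCc.isBounded.subset_ball 0
  set O : Set (E n) := (⋂ s ∈ T.sides e, ⋂ j ∈ Finset.univ.erase s.2,
    {x | δ < (T.cell s.1).coord j x}) ∩
    ((⋂ l ∈ Finset.univ.filter fun l => ∀ i, (l, i) ∉ T.sides e, (body (T.cell l))ᶜ) ∩
      Metric.ball 0 R) with hO
  have hOo : IsOpen O := by
    refine IsOpen.inter ?_ (IsOpen.inter ?_ Metric.isOpen_ball)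
    · exact isOpen_biInter_finset fun s _ => isOpen_biInter_finset fun j _ =>
        isOpen_lt continuous_const (continuous_coord _ j)
    · exact isOpen_biInter_finset fun l _ => (isCompact_body _).isClosed.isOpen_compl
  have hCO : C ⊆ O := by
    rintro x hx
    obtain ⟨hxK, hxi, hxj⟩ := id hx
    have hpos : ∀ j, j ≠ i → δ < K.coord j x := fun j hj => by
      have h1 := hxj j hj
      have h2 := mem_body.1 hxK j
      rw [hδ, inv_lt_iff_one_lt_mul₀ (by positivity)]
      nlinarith
    refine ⟨mem_iInter₂.2 fun s hs => mem_iInter₂.2 fun j hj => ?_,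
      mem_iInter₂.2 fun l hl => ?_, hR hx⟩
    · obtain ⟨j', hj1, hj2⟩ := exists_eq_vertex (hface s hs) (Finset.ne_of_mem_erase hj)
      have := coord_eq_coord_of_face (hface s hs) hxi hj2
      simp only [mem_ofPred_eq, this]
      exact hpos j' hj1
    · intro hxl
      obtain ⟨i', hi'⟩ := T.exists_mem_sides (k := s₀.1) (i := i) hxK
        (fun j hj => (hδ0.trans (hpos j hj)).ne') hxl
      rw [T.mem_sides.1 hs₀] at hi'
      exact (Finset.mem_filter.1 hl).2 i' hi'
  obtain ⟨κ, hκ, hκr, hκO, hκC⟩ := exists_contMDiff_support_eq_eq_one_iff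
    (modelWithCornersSelf ℝ (E n)) (n := ⊤) hOo hCc.isClosed hCO
  have hzero : ∀ x, x ∉ O → κ x = 0 := fun x hx => by
    by_contra hc
    exact hx (hκO ▸ hc)
  have hcut := fun x => cutoff_mem_Icc K (Finset.univ.erase i) m x
  have hle : ∀ x, |κ x * cutoff K (Finset.univ.erase i) m x| ≤ 1 := fun x => by
    have h1 := hκr (mem_range_self x)
    rw [abs_of_nonneg (mul_nonneg h1.1 (hcut x).1)]
    exact mul_le_one₀ h1.2 (hcut x).1 (hcut x).2
  refine ⟨fun x => κ x * cutoff K (Finset.univ.erase i) m x,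
    hκ.contDiff.mul (contDiff_cutoff K _ m), ?_, fun s hs x hx hxs => ?_,
    fun l hl x hx => ?_, fun s hs j hj => ⟨2 * (m + 1), fun x hx => ?_⟩⟩
  · refine HasCompactSupport.mul_right (HasCompactSupport.of_support_subset_isCompact
      (isCompact_closedBall (0 : E n) R) ?_)
    rw [hκO]
    exact (inter_subset_right.trans inter_subset_right).trans Metric.ball_subset_closedBall
  · obtain ⟨hxK, hxi⟩ := mem_body_of_face (hface s hs).symm hx hxs
    rw [← cutoff_eq_cutoff_of_face (hface s hs) hxi]
    by_cases hxC : x ∈ C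
    · simp only [(hκC x).1 hxC, one_mul]
    -- At a point of the face outside `C` the bump function need not be `1`, but there the cutoff is
    -- zero.
    · have : ∃ j, j ≠ i ∧ m * K.coord j x < 1 := by
        by_contra! hc
        exact hxC ⟨hxK, hxi, hc⟩
      obtain ⟨j, hj, hj'⟩ := this
      simp only [cutoff_eq_zero (Finset.mem_erase.2 ⟨hj, Finset.mem_univ j⟩) hj'.le, mul_zero]
  · have : x ∉ O := fun hxO => mem_iInter₂.1 hxO.2.1 l (Finset.mem_filter.2 ⟨Finset.mem_univ l, hl⟩)
      hx
    simp only [hzero x this, zero_mul]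
  · by_cases hxO : x ∈ O
    · have h1 : δ < (T.cell s.1).coord j x :=
        mem_iInter₂.1 (mem_iInter₂.1 hxO.1 s hs) j (Finset.mem_erase.2 ⟨hj, Finset.mem_univ j⟩)
      rw [hδ, inv_lt_iff_one_lt_mul₀ (by positivity)] at h1
      exact (hle x).trans (by linarith)
    · simp only [hzero x hxO, zero_mul, abs_zero]
      have := mem_interior_body.1 hx j
      positivity

/-- The fluxes of a field in `H₀(div)` through a face from all adjacent cells sum up to zero. -/
lemma sum_faceFlux_sides_eq_zero (hn : 1 ≤ n) {u : E n → E n} {d : E n → ℝ}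
    (hz : HasZeroNormalTrace T.Ω u d) (hu : ∀ k, HasTraces (T.cell k) u d) (e : Finset (E n))
    {g : E n → ℝ} (hg : ContDiff ℝ ∞ g) :
    ∑ s ∈ T.sides e, faceFlux (T.cell s.1) s.2 u d g = 0 := by
  rcases (T.sides e).eq_empty_or_nonempty with he | ⟨s₀, hs₀⟩
  · rw [he, Finset.sum_empty]
  refine tendsto_nhds_unique (tendsto_finsetSum _ fun s _ =>
    tendsto_faceFlux_cutoff (hu s.1) hg s.2) ?_
  refine tendsto_const_nhds.congr fun m => ?_
  obtain ⟨φ, hφ, hc, h1, h2, h3⟩ := T.exists_face_cutoff hs₀ m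
  have hsm : ContDiff ℝ ∞ (fun x => g x * φ x) := hg.mul hφ
  have h4 := hz (fun x => g x * φ x) hsm hc.mul_left
  rw [T.setIntegral_omega fun k => (hu k).integrable_pair (Lift.of_contDiff hsm)] at h4
  -- The zero normal trace is tested with `g φ`, which vanishes on every cell not adjacent to `e`.
  have h5 : ∑ s ∈ T.sides e, pair (T.cell s.1) u d (fun x => g x * φ x) = 0 := by
    classical
    rw [← h4, ← Finset.sum_image (g := Prod.fst) (s := T.sides e)
      (f := fun k => pair (T.cell k) u d (fun x => g x * φ x))
      (fun s hs t ht h => T.fst_injOn_sides e hs ht h)]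
    refine Finset.sum_subset (Finset.subset_univ _) fun l _ hl => ?_
    have h6 : pair (T.cell l) u d (fun x => g x * φ x) = pair (T.cell l) u d (fun _ => 0) :=
      pair_congr_right fun x hx => by
        rw [h2 l (fun i hi => hl (Finset.mem_image.2 ⟨_, hi, rfl⟩)) x (interior_subset hx), mul_zero]
    rw [h6]
    simp [pair]
  rw [← h5]
  refine Finset.sum_congr rfl fun s hs => ?_
  obtain ⟨D, hD, hgD⟩ := exists_abs_le_of_continuous (T.cell s.1) hg.continuous
  rw [← faceFlux_eq_pair_of_le (hu s.1) hsm s.2 fun j hj => by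
    obtain ⟨C, hC⟩ := h3 s hs j hj
    refine ⟨D * C, fun x hx => Or.inl ?_⟩
    rw [abs_mul, mul_assoc]
    exact mul_le_mul (hgD x hx) (hC x hx) (abs_nonneg _) hD]
  -- On the face, `φ` coincides with the cutoff of each adjacent cell, so both give the same flux.
  have h6 := faceFlux_eq_zero hn (hu s.1) (g := fun x => g x * φ x
      + (-1) * (g x * cutoff (T.cell s.1) (Finset.univ.erase s.2) m x))
    (hsm.add (contDiff_const.mul (hg.mul (contDiff_cutoff _ _ m)))) s.2
    fun x hx hxs => by rw [h1 s hs x hx hxs]; ring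
  rw [faceFlux_add_right (hu s.1) hsm (contDiff_const.mul (hg.mul (contDiff_cutoff _ _ m))),
    faceFlux_mul_right (hg.mul (contDiff_cutoff _ _ m))] at h6
  linarith

/-- For fields which are in `RT_k` on each cell, the continuity of the normal trace across a face
can be tested with `P_k`. -/
lemma sum_faceFlux_evalVec_eq_zero (hn : 1 ≤ n) {k : ℕ} {W : ι → Fin n → MvPolynomial (Fin n) ℝ}
    (hW : ∀ l, W l ∈ localRT n k) {e : Finset (E n)}
    (h : ∀ q ∈ polyLE n k, ∑ s ∈ T.sides e, faceFlux (T.cell s.1) s.2 (evalVec (W s.1))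
      (evalPoly (divPoly (W s.1))) (evalPoly q) = 0) {g : E n → ℝ} (hg : ContDiff ℝ ∞ g) :
    ∑ s ∈ T.sides e, faceFlux (T.cell s.1) s.2 (evalVec (W s.1))
      (evalPoly (divPoly (W s.1))) g = 0 := by
  rcases (T.sides e).eq_empty_or_nonempty with he | ⟨s₀, hs₀⟩
  · rw [he, Finset.sum_empty]
  have hex : ∀ s : ι × Fin (n + 1), ∃ c : ℝ, s ∈ T.sides e → ∀ g : E n → ℝ, ContDiff ℝ ∞ g →
      faceInt (T.cell s.1) s.2 g = c * faceInt (T.cell s₀.1) s₀.2 g := fun s => by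
    by_cases hs : s ∈ T.sides e
    · obtain ⟨c, hc⟩ := exists_faceInt_eq hn
        ((T.mem_sides.1 hs₀).trans (T.mem_sides.1 hs).symm)
      exact ⟨c, fun _ => hc⟩
    · exact ⟨0, fun hs' => absurd hs' hs⟩
  choose c hc using hex
  choose m hm a ha using fun s : ι × Fin (n + 1) => exists_ncomp_eq (T.cell s.1) s.2 (hW s.1)
  -- After all face integrals are expressed by the one of `s₀`, the sum of the fluxes is represented
  -- by this single density in `P_k`. Testing it against `P_k` shows that it vanishes on the face.
  set M : MvPolynomial (Fin n) ℝ := ∑ s ∈ T.sides e, c s • m s with hM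
  have hMk : M ∈ polyLE n k :=
    Submodule.sum_mem _ fun s _ => Submodule.smul_mem _ _ (hm s)
  have key : ∀ f : E n → ℝ, ContDiff ℝ ∞ f → ∑ s ∈ T.sides e, faceFlux (T.cell s.1) s.2
      (evalVec (W s.1)) (evalPoly (divPoly (W s.1))) f
      = -faceInt (T.cell s₀.1) s₀.2 (fun x => evalPoly M x * f x) := fun f hf => by
    have h1 : (fun x => evalPoly M x * f x)
        = fun x => ∑ s ∈ T.sides e, c s * (evalPoly (m s) x * f x) := by
      funext x
      simp only [hM, evalPoly_sum, evalPoly_smul, Finset.sum_mul, mul_assoc]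
    rw [h1, faceInt_sum _ _ _ fun s _ => contDiff_const.mul ((contDiff_evalPoly _).mul hf),
      ← Finset.sum_neg_distrib]
    refine Finset.sum_congr rfl fun s hs => ?_
    rw [faceFlux_evalVec _ _ _ (ha s) hf, hc s hs _ ((contDiff_evalPoly _).mul hf),
      faceInt_const_mul _ _ ((contDiff_evalPoly _).mul hf)]
  obtain ⟨b, hb⟩ := lam_dvd_of_faceInt_eq_zero hn (T.cell s₀.1) s₀.2 hMk fun q hq => by
    have := h q hq
    rwa [key _ (contDiff_evalPoly q), neg_eq_zero] at this
  rw [key g hg, faceInt_eq_zero hn _ _ ((contDiff_evalPoly M).mul hg) fun x _ hx => by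
    rw [hb, evalPoly_mul, evalPoly_lam, hx]; ring, neg_zero]

/-! ### Piecewise polynomial fields in `H₀(div)` -/

lemma hasWeakDiv_of_hasZeroNormalTrace {U : Set (E n)} {u : Lp (E n) 2 (volume.restrict U)}
    {d : Lp ℝ 2 (volume.restrict U)} (h : HasZeroNormalTrace U u d) : HasWeakDiv U u d := by
  intro φ hφ hc _
  have := h φ hφ hc
  rw [integral_add (integrable_fderiv_apply hφ hc u) (integrable_mul_test hφ hc d)] at this
  linarith

lemma exists_piecewise {F : Type*} [NormedAddCommGroup F] {f : ι → E n → F}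
    (hf : ∀ k, MemLp (f k) 2 (volume.restrict (interior (body (T.cell k))))) :
    ∃ g : Lp F 2 (volume.restrict T.Ω), ∀ k,
      ∀ᵐ x ∂(volume.restrict (interior (body (T.cell k)))), g x = f k x := by
  classical
  have hmem : MemLp (fun x => ∑ k, (interior (body (T.cell k))).indicator (f k) x) 2
      (volume.restrict T.Ω) := by
    refine memLp_finsetSum _ fun k _ => ?_
    rw [memLp_indicator_iff_restrict (measurableSet_interior_body _),
      Measure.restrict_restrict (measurableSet_interior_body _),
      inter_eq_left.2 (T.interior_body_subset k)]
    exact hf k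
  refine ⟨hmem.toLp _, fun k => ?_⟩
  filter_upwards [T.ae_cell_of_ae_omega hmem.coeFn_toLp k,
    ae_restrict_mem (measurableSet_interior_body (T.cell k))] with x hx hxk
  rw [hx, Finset.sum_eq_single k (fun l _ hl => ?_) (by simp), indicator_of_mem hxk]
  exact indicator_of_notMem (fun hxl =>
    T.notMem_body_of_mem_interior hl hxl (interior_subset hxk)) _

/-- The pairs of a cell and one of its faces are regrouped by the vertex set of the face. -/
lemma sum_sides (f : ι × Fin (n + 1) → ℝ) (h : ∀ e, ∑ s ∈ T.sides e, f s = 0) :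
    ∑ k, ∑ i, f (k, i) = 0 := by
  classical
  rw [← Finset.sum_product', Finset.univ_product_univ,
    ← Finset.sum_fiberwise_of_maps_to (g := fun s : ι × Fin (n + 1) => facet (T.cell s.1) s.2)
      (t := Finset.univ.image fun s : ι × Fin (n + 1) => facet (T.cell s.1) s.2)
      (fun s _ => Finset.mem_image_of_mem _ (Finset.mem_univ s))]
  refine Finset.sum_eq_zero fun e _ => ?_
  rw [← h e]
  refine Finset.sum_congr ?_ fun _ _ => rfl
  ext s
  simp [mem_sides]

/-- A field which is in `RT_k` on each cell is in `RT_k(T)` if its normal trace is continuous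
across interior faces and vanishes on boundary faces. -/
lemma exists_mem_RT (hn : 1 ≤ n) {k : ℕ} {W : ι → Fin n → MvPolynomial (Fin n) ℝ}
    (hW : ∀ l, W l ∈ localRT n k)
    (h : ∀ e, ∀ q ∈ polyLE n k, ∑ s ∈ T.sides e, faceFlux (T.cell s.1) s.2 (evalVec (W s.1))
      (evalPoly (divPoly (W s.1))) (evalPoly q) = 0) :
    ∃ w ∈ T.RT k, ∀ l, ∀ᵐ x ∂(volume.restrict (interior (body (T.cell l)))),
      w x = evalVec (W l) x := by
  obtain ⟨w, hw⟩ := T.exists_piecewise (f := fun l => evalVec (W l))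
    fun l => memLp_evalVec (T.cell l) (W l) 2
  obtain ⟨d, hd⟩ := T.exists_piecewise (f := fun l => evalPoly (divPoly (W l)))
    fun l => memLp_evalPoly (T.cell l) _ 2
  have hz : HasZeroNormalTrace T.Ω w d := by
    intro φ hφ hc
    have hae : ∀ l, (fun x => fderiv ℝ φ x (w x) + d x * φ x)
        =ᵐ[volume.restrict (interior (body (T.cell l)))]
        fun x => fderiv ℝ φ x (evalVec (W l) x) + evalPoly (divPoly (W l)) x * φ x := fun l => by
      filter_upwards [hw l, hd l] with x h1 h2
      rw [h1, h2]
    have hint := fun l =>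
      (hasTraces_evalVec (T.cell l) (W l)).integrable_pair (Lift.of_contDiff hφ)
    rw [T.setIntegral_omega fun l => (hint l).congr (hae l).symm]
    simp only [fun l => integral_congr_ae (hae l)]
    refine Eq.trans (Finset.sum_congr rfl fun l _ =>
      (sum_faceFlux (hasTraces_evalVec (T.cell l) (W l)) hφ).symm) ?_
    exact T.sum_sides (fun s => faceFlux (T.cell s.1) s.2 (evalVec (W s.1))
      (evalPoly (divPoly (W s.1))) φ)
      fun e => T.sum_faceFlux_evalVec_eq_zero hn hW (h e) hφ
  refine ⟨w, ⟨⟨d, hasWeakDiv_of_hasZeroNormalTrace hz, hz⟩, fun l => ⟨W l, hW l, ?_⟩⟩, hw⟩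
  rw [T.restrict_omega_inter_body]
  exact hw l

end Triangulation

/-! ### The weak divergence -/

lemma HasWeakDiv.congr {U : Set (E n)} {u v : E n → E n} {d : E n → ℝ} (h : HasWeakDiv U u d)
    (huv : u =ᵐ[volume.restrict U] v) : HasWeakDiv U v d := fun φ hφ hc hs => by
  rw [← h φ hφ hc hs]
  refine integral_congr_ae ?_
  filter_upwards [huv] with x hx
  rw [hx]

lemma HasWeakDiv.ae_eq {U : Set (E n)} (hU : IsOpen U) {u : E n → E n} {d e : E n → ℝ}
    (hd : Integrable d (volume.restrict U)) (he : Integrable e (volume.restrict U))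
    (h : HasWeakDiv U u d) (h' : HasWeakDiv U u e) : d =ᵐ[volume.restrict U] e := by
  have key := hU.ae_eq_zero_of_integral_contDiff_smul_eq_zero (μ := volume) (f := fun x => d x - e x)
    (IntegrableOn.locallyIntegrableOn (hd.sub he)) fun φ hφ hc hs => by
      have h0 : ∀ x, x ∉ U → φ x = 0 := fun x hx =>
        image_eq_zero_of_notMem_tsupport fun h => hx (hs h)
      rw [← setIntegral_eq_integral_of_forall_compl_eq_zero (s := U) fun x hx => by
        rw [h0 x hx, zero_smul]]
      obtain ⟨C, hC⟩ := hφ.continuous.bounded_above_of_compact_support hc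
      have hi : ∀ {f : E n → ℝ}, Integrable f (volume.restrict U) →
          Integrable (fun x => f x * φ x) (volume.restrict U) := fun hf =>
        hf.mul_bdd (c := C) hφ.continuous.aestronglyMeasurable (Eventually.of_forall hC)
      have h1 := h φ hφ hc hs
      have h2 := h' φ hφ hc hs
      simp only [smul_eq_mul, mul_comm (φ _), sub_mul]
      rw [integral_sub (hi hd) (hi he)]
      linarith
  rw [EventuallyEq, ae_restrict_iff' hU.measurableSet]
  filter_upwards [key] with x hx hxU
  exact sub_eq_zero.1 (hx hxU)

lemma HasWeakDiv.mono {U V : Set (E n)} {u : E n → E n} {d : E n → ℝ} (h : HasWeakDiv V u d)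
    (hV : MeasurableSet V) (hUV : U ⊆ V) : HasWeakDiv U u d :=
    fun φ hφ hc hs => by
  have h0 : ∀ x, x ∉ U → φ x = 0 := fun x hx => image_eq_zero_of_notMem_tsupport fun h => hx (hs h)
  have h0' : ∀ x, x ∉ U → fderiv ℝ φ x = 0 := fun x hx =>
    image_eq_zero_of_notMem_tsupport fun h => hx (hs (tsupport_fderiv_subset ℝ h))
  have h1 := h φ hφ hc (hs.trans hUV)
  rwa [setIntegral_eq_of_subset_of_forall_sdiff_eq_zero hV hUV fun x hx => by
      rw [h0' x hx.2, zero_apply],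
    setIntegral_eq_of_subset_of_forall_sdiff_eq_zero hV hUV fun x hx => by
      rw [h0 x hx.2, mul_zero]] at h1

lemma HasTraces.div_ae_eq {K : Simplex n} {u v : E n → E n} {d e : E n → ℝ}
    (hu : HasTraces K u d) (hv : HasTraces K v e)
    (h : u =ᵐ[volume.restrict (interior (body K))] v) :
    d =ᵐ[volume.restrict (interior (body K))] e :=
  (hu.hasWeakDiv.congr h).ae_eq isOpen_interior hu.integrable_div hv.integrable_div hv.hasWeakDiv

lemma hasWeakDiv_weakDiv {U : Set (E n)} {u : Lp (E n) 2 (volume.restrict U)} (hu : u ∈ H0div U) :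
    HasWeakDiv U u (weakDiv U u) := by
  obtain ⟨d, hd, _⟩ := hu
  have h : ∃ d : Lp ℝ 2 (volume.restrict U), HasWeakDiv U u d := ⟨d, hd⟩
  rw [weakDiv, dif_pos h]
  exact h.choose_spec

/-- The divergence picked by `weakDiv` need not be the witness in `H0div`, but weak divergences are
unique almost everywhere. -/
lemma hasZeroNormalTrace_weakDiv {U : Set (E n)} (hU : IsOpen U)
    [IsFiniteMeasure (volume.restrict U)]
    {u : Lp (E n) 2 (volume.restrict U)} (hu : u ∈ H0div U) :
    HasZeroNormalTrace U u (weakDiv U u) := by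
  have h := hasWeakDiv_weakDiv hu
  obtain ⟨d, hd, hd'⟩ := hu
  have hae := hd.ae_eq hU ((Lp.memLp d).integrable (by norm_num))
    ((Lp.memLp (weakDiv U u)).integrable (by norm_num)) h
  intro φ hφ hc
  rw [← hd' φ hφ hc]
  refine integral_congr_ae ?_
  filter_upwards [hae] with x hx
  rw [hx]

/-! ### Linearity of the local interpolation -/

lemma isLocalInterpolant_iff_forall {K : Simplex n} {u : E n → E n} {d : E n → ℝ} (hn : 1 ≤ n)
    {k : ℕ} (hu : HasTraces K u d) {W : Fin n → MvPolynomial (Fin n) ℝ} :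
    IsLocalInterpolant K k u d W ↔ W ∈ localRT n k ∧
      (∀ i, ∀ q ∈ polyLE n k, faceFlux K i (evalVec W) (evalPoly (divPoly W)) (evalPoly q)
        = faceFlux K i u d (evalPoly q)) ∧
      ∀ P : Fin n → MvPolynomial (Fin n) ℝ, (∀ j, P j ∈ polyLT n k) →
        ∫ x in interior (body K), inner ℝ (evalVec W x) (evalVec P x)
          = ∫ x in interior (body K), inner ℝ (u x) (evalVec P x) := by
  rw [isLocalInterpolant_iff hn hu]
  refine and_congr_right fun _ => and_congr (forall_congr' fun i => ⟨fun h q hq => ?_, fun h => ?_⟩)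
    ⟨fun h P hP => ?_, fun h => LinearMap.ext fun P => h _ fun j => (P j).2⟩
  · exact congrArg (fun f => f.1 ⟨q, hq⟩) h
  · exact Subtype.ext (LinearMap.ext fun q => h q.1 q.2)
  · exact congrArg (fun f => f fun j => ⟨P j, hP j⟩) h

lemma IsLocalInterpolant.congr (hn : 1 ≤ n) {K : Simplex n} {k : ℕ} {u v : E n → E n}
    {d e : E n → ℝ} {W : Fin n → MvPolynomial (Fin n) ℝ} (hu : HasTraces K u d)
    (hv : HasTraces K v e) (h : IsLocalInterpolant K k u d W)
    (huv : u =ᵐ[volume.restrict (interior (body K))] v) : IsLocalInterpolant K k v e W := by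
  rw [isLocalInterpolant_iff_forall hn hu] at h
  rw [isLocalInterpolant_iff_forall hn hv]
  refine ⟨h.1, fun i q hq => ?_, fun P hP => ?_⟩
  · rw [h.2.1 i q hq, faceFlux_congr_ae i huv (hu.div_ae_eq hv huv)]
  · rw [h.2.2 P hP]
    refine integral_congr_ae ?_
    filter_upwards [huv] with x hx
    rw [hx]

lemma isLocalInterpolant_self (hn : 1 ≤ n) (K : Simplex n) {k : ℕ}
    {W : Fin n → MvPolynomial (Fin n) ℝ} (hW : W ∈ localRT n k) :
    IsLocalInterpolant K k (evalVec W) (evalPoly (divPoly W)) W :=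
  (isLocalInterpolant_iff_forall hn (hasTraces_evalVec K W)).2
    ⟨hW, fun _ _ _ => rfl, fun _ _ => rfl⟩

lemma IsLocalInterpolant.add (hn : 1 ≤ n) {K : Simplex n} {k : ℕ} {u v : E n → E n}
    {d e : E n → ℝ} {V W : Fin n → MvPolynomial (Fin n) ℝ} (hu : HasTraces K u d)
    (hv : HasTraces K v e) (hV : IsLocalInterpolant K k u d V)
    (hW : IsLocalInterpolant K k v e W) :
    IsLocalInterpolant K k (fun x => u x + v x) (fun x => d x + e x) (V + W) := by
  rw [isLocalInterpolant_iff_forall hn hu] at hV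
  rw [isLocalInterpolant_iff_forall hn hv] at hW
  rw [isLocalInterpolant_iff_forall hn (hu.add hv)]
  refine ⟨Submodule.add_mem _ hV.1 hW.1, fun i q hq => ?_, fun P hP => ?_⟩
  · rw [faceFlux_add_left hu hv (contDiff_evalPoly q), ← hV.2.1 i q hq, ← hW.2.1 i q hq,
      ← faceFlux_add_left (hasTraces_evalVec K V) (hasTraces_evalVec K W) (contDiff_evalPoly q)]
    simp only [← evalVec_add, ← evalPoly_divPoly_add]
    rfl
  · have : ∀ x, evalVec (V + W) x = evalVec V x + evalVec W x := evalVec_add V W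
    simp only [inner_add_left, this]
    rw [integral_add (hu.integrable_inner P) (hv.integrable_inner P), ← hV.2.2 P hP,
      ← hW.2.2 P hP, integral_add ((hasTraces_evalVec K V).integrable_inner P)
        ((hasTraces_evalVec K W).integrable_inner P)]

lemma IsLocalInterpolant.smul (hn : 1 ≤ n) {K : Simplex n} {k : ℕ} {u : E n → E n}
    {d : E n → ℝ} {W : Fin n → MvPolynomial (Fin n) ℝ} (hu : HasTraces K u d)
    (hW : IsLocalInterpolant K k u d W) (c : ℝ) :
    IsLocalInterpolant K k (fun x => c • u x) (fun x => c * d x) (c • W) := by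
  rw [isLocalInterpolant_iff_forall hn hu] at hW
  rw [isLocalInterpolant_iff_forall hn (hu.smul c)]
  refine ⟨Submodule.smul_mem _ c hW.1, fun i q hq => ?_, fun P hP => ?_⟩
  · rw [faceFlux_smul_left, ← hW.2.1 i q hq, ← faceFlux_smul_left]
    simp only [← evalVec_smul, ← evalPoly_divPoly_smul]
  · simp only [real_inner_smul_left, evalVec_smul]
    rw [integral_const_mul, integral_const_mul, hW.2.2 P hP]

namespace Triangulation

variable {ι : Type*} (T : Triangulation n ι)

instance [Finite ι] : IsFiniteMeasure (volume.restrict T.Ω) :=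
  isFiniteMeasure_restrict.2 (ne_of_lt ((measure_mono interior_subset).trans_lt
    (isCompact_iUnion fun l => FEVar.isCompact_body (T.cell l)).measure_lt_top))

variable {T}

lemma hasTraces_weakDiv {p : ENNReal} (hp : 2 < p) {u : Lp (E n) 2 (volume.restrict T.Ω)}
    (hu : u ∈ H0divLp T.Ω p) (l : ι) : HasTraces (T.cell l) u (weakDiv T.Ω u) := by
  have hle := Measure.restrict_mono (T.interior_body_subset l) (le_refl (volume : Measure (E n)))
  exact hasTraces_of_memHDiv hp
    ⟨(Lp.memLp u).mono_measure hle, (Lp.memLp (weakDiv T.Ω u)).mono_measure hle,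
      (hasWeakDiv_weakDiv hu.1).mono isOpen_interior.measurableSet
        (T.interior_body_subset l)⟩ (hu.2.mono_measure hle)

/-! ### The global interpolant -/

variable (T) in
/-- `w` is the Raviart-Thomas interpolant of order `k` of `u`. -/
def IsInterpolant (k : ℕ) (u w : Lp (E n) 2 (volume.restrict T.Ω)) : Prop :=
  ∀ l, ∃ W, IsLocalInterpolant (T.cell l) k u (weakDiv T.Ω u) W ∧
    ∀ᵐ x ∂(volume.restrict (interior (body (T.cell l)))), w x = evalVec W x

lemma IsInterpolant.add (hn : 1 ≤ n) {p : ENNReal} (hp : 2 < p) {k : ℕ}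
    {u v w z : Lp (E n) 2 (volume.restrict T.Ω)} (hu : u ∈ H0divLp T.Ω p)
    (hv : v ∈ H0divLp T.Ω p) (h : T.IsInterpolant k u w) (h' : T.IsInterpolant k v z) :
    T.IsInterpolant k (u + v) (w + z) := fun l => by
  obtain ⟨W, hW, hw⟩ := h l
  obtain ⟨Z, hZ, hz⟩ := h' l
  refine ⟨W + Z, (hW.add hn (hasTraces_weakDiv hp hu l) (hasTraces_weakDiv hp hv l) hZ).congr hn
    ((hasTraces_weakDiv hp hu l).add (hasTraces_weakDiv hp hv l))
    (hasTraces_weakDiv hp (Submodule.add_mem _ hu hv) l) ?_, ?_⟩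
  · exact (T.ae_cell_of_ae_omega (Lp.coeFn_add u v) l).mono fun x hx => hx.symm
  · filter_upwards [hw, hz, T.ae_cell_of_ae_omega (Lp.coeFn_add w z) l] with x h1 h2 h3
    rw [h3, Pi.add_apply, h1, h2]
    exact (evalVec_add W Z x).symm

lemma IsInterpolant.smul (hn : 1 ≤ n) {p : ENNReal} (hp : 2 < p) {k : ℕ}
    {u w : Lp (E n) 2 (volume.restrict T.Ω)} (hu : u ∈ H0divLp T.Ω p)
    (h : T.IsInterpolant k u w) (c : ℝ) : T.IsInterpolant k (c • u) (c • w) := fun l => by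
  obtain ⟨W, hW, hw⟩ := h l
  refine ⟨c • W, (hW.smul hn (hasTraces_weakDiv hp hu l) c).congr hn
    ((hasTraces_weakDiv hp hu l).smul c)
    (hasTraces_weakDiv hp (Submodule.smul_mem _ c hu) l) ?_, ?_⟩
  · exact (T.ae_cell_of_ae_omega (Lp.coeFn_smul c u) l).mono fun x hx => hx.symm
  · filter_upwards [hw, T.ae_cell_of_ae_omega (Lp.coeFn_smul c w) l] with x h1 h3
    rw [h3, Pi.smul_apply, h1, evalVec_smul]

variable [Fintype ι]

lemma IsInterpolant.ext (hn : 1 ≤ n) {p : ENNReal} (hp : 2 < p) {k : ℕ}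
    {u w w' : Lp (E n) 2 (volume.restrict T.Ω)}
    (hu : u ∈ H0divLp T.Ω p) (h : T.IsInterpolant k u w) (h' : T.IsInterpolant k u w') :
    w = w' := by
  refine Lp.ext (T.ae_omega fun l => ?_)
  obtain ⟨W, hW, hw⟩ := h l
  obtain ⟨W', hW', hw'⟩ := h' l
  have := (existsUnique_isLocalInterpolant hn k (hasTraces_weakDiv hp hu l)).unique hW hW'
  subst this
  filter_upwards [hw, hw'] with x h1 h2
  rw [h1, h2]

/-- The local interpolants have the same face moments as `u`, and those of `u` cancel on interior
faces and vanish on boundary faces. So the local fields fit together to a field in `H₀(div)`. -/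
lemma exists_isInterpolant (hn : 1 ≤ n) {p : ENNReal} (hp : 2 < p) (k : ℕ)
    {u : Lp (E n) 2 (volume.restrict T.Ω)} (hu : u ∈ H0divLp T.Ω p) :
    ∃ w ∈ T.RT k, T.IsInterpolant k u w := by
  have hT := hasTraces_weakDiv hp hu
  choose W hW _ using fun l => existsUnique_isLocalInterpolant hn k (hT l)
  have hW' := fun l => (isLocalInterpolant_iff_forall hn (hT l)).1 (hW l)
  obtain ⟨w, hw, hw'⟩ := T.exists_mem_RT hn (fun l => (hW' l).1) fun e q hq => by
    rw [← T.sum_faceFlux_sides_eq_zero hn (hasZeroNormalTrace_weakDiv (U := T.Ω) isOpen_interior hu.1) hT e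
      (contDiff_evalPoly q)]
    exact Finset.sum_congr rfl fun s _ => (hW' s.1).2.1 s.2 q hq
  exact ⟨w, hw, fun l => ⟨W l, hW l, hw' l⟩⟩

lemma isInterpolant_self (hn : 1 ≤ n) {p : ENNReal} (hp : 2 < p) {k : ℕ}
    {v : Lp (E n) 2 (volume.restrict T.Ω)} (hv : v ∈ T.RT k) : T.IsInterpolant k v v := fun l => by
  obtain ⟨W, hW, hw⟩ := hv.2 l
  rw [T.restrict_omega_inter_body] at hw
  exact ⟨W, (isLocalInterpolant_self hn (T.cell l) hW).congr hn (hasTraces_evalVec _ W)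
    (hasTraces_weakDiv hp (T.RT_le k p hv) l) (hw.mono fun x hx => hx.symm), hw⟩

variable (T) in
/-- The global Raviart-Thomas interpolation operator. -/
def interpolation (hn : 1 ≤ n) {p : ENNReal} (hp : 2 < p) (k : ℕ) :
    H0divLp T.Ω p →ₗ[ℝ] T.RT k where
  toFun u := ⟨_, (exists_isInterpolant hn hp k u.2).choose_spec.1⟩
  map_add' u v := Subtype.ext <| IsInterpolant.ext hn hp (u + v).2
    (exists_isInterpolant hn hp k (u + v).2).choose_spec.2
    ((exists_isInterpolant hn hp k u.2).choose_spec.2.add hn hp u.2 v.2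
      (exists_isInterpolant hn hp k v.2).choose_spec.2)
  map_smul' c u := Subtype.ext <| IsInterpolant.ext hn hp (c • u).2
    (exists_isInterpolant hn hp k (c • u).2).choose_spec.2
    ((exists_isInterpolant hn hp k u.2).choose_spec.2.smul hn hp u.2 c)

lemma isInterpolant_interpolation (hn : 1 ≤ n) {p : ENNReal} (hp : 2 < p) (k : ℕ)
    (u : H0divLp T.Ω p) : T.IsInterpolant k u (T.interpolation hn hp k u) :=
  (exists_isInterpolant hn hp k u.2).choose_spec.2

lemma interpolation_inclusion (hn : 1 ≤ n) {p : ENNReal} (hp : 2 < p) (k : ℕ) (v : T.RT k) :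
    T.interpolation hn hp k (Submodule.inclusion (T.RT_le k p) v) = v :=
  Subtype.ext <| IsInterpolant.ext hn hp (T.RT_le k p v.2)
    (isInterpolant_interpolation hn hp k (Submodule.inclusion (T.RT_le k p) v))
    (isInterpolant_self hn hp v.2)

end Triangulation

/-! ### The gradient of a polynomial -/

/-- The gradient of a polynomial. -/
def grad (n : ℕ) : MvPolynomial (Fin n) ℝ →ₗ[ℝ] (Fin n → MvPolynomial (Fin n) ℝ) :=
  LinearMap.pi fun j => (MvPolynomial.pderiv j).toLinearMap

lemma grad_apply (q : MvPolynomial (Fin n) ℝ) (j : Fin n) :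
    grad n q j = MvPolynomial.pderiv j q := rfl

lemma grad_mul (p q : MvPolynomial (Fin n) ℝ) : grad n (p * q) = p • grad n q + q • grad n p := by
  funext j
  simp [grad_apply, Derivation.leibniz]

/-! ### Operators defined by bilinear forms -/

section

variable {V : Type*} [NormedAddCommGroup V] [InnerProductSpace ℝ V]

lemma nondegenerate_innerₗ : LinearMap.BilinForm.Nondegenerate (innerₗ V) :=
  ⟨fun x h => inner_self_eq_zero.1 (h x), fun x h => inner_self_eq_zero.1 (h x)⟩

variable [FiniteDimensional ℝ V]

/-- The operator `A` with `⟨A f, g⟩ = B(f, g)`. -/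
def operatorOfForm : (V →ₗ[ℝ] V →ₗ[ℝ] ℝ) →ₗ[ℝ] (V →ₗ[ℝ] V) where
  toFun B := (LinearMap.BilinForm.toDual (innerₗ V) nondegenerate_innerₗ).symm.toLinearMap ∘ₗ B
  map_add' _ _ := LinearMap.comp_add _ _ _
  map_smul' _ _ := LinearMap.comp_smul _ _ _

lemma inner_operatorOfForm (B : V →ₗ[ℝ] V →ₗ[ℝ] ℝ) (f g : V) :
    inner ℝ (operatorOfForm B f) g = B f g :=
  LinearMap.BilinForm.apply_toDual_symm_apply (hB := nondegenerate_innerₗ) (B f) g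

end

/-! ### Fluxes and moments as functionals -/

namespace HasTraces

variable {K : Simplex n} {u v : E n → E n} {d e : E n → ℝ}

lemma flux_congr (hu : HasTraces K u d) (hv : HasTraces K v e)
    (h : u =ᵐ[volume.restrict (interior (body K))] v) (i : Fin (n + 1)) :
    hu.flux i = hv.flux i :=
  LinearMap.ext fun _ => faceFlux_congr_ae i h (hu.div_ae_eq hv h)

lemma moment_congr (hu : HasTraces K u d) (hv : HasTraces K v e)
    (h : u =ᵐ[volume.restrict (interior (body K))] v) : hu.moment = hv.moment :=
  LinearMap.ext fun P => integral_congr_ae (h.mono fun x hx => by simp only [hx])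

lemma flux_add (hu : HasTraces K u d) (hv : HasTraces K v e) (i : Fin (n + 1)) :
    (hu.add hv).flux i = hu.flux i + hv.flux i :=
  LinearMap.ext fun q => faceFlux_add_left hu hv (contDiff_evalPoly q) i

lemma moment_add (hu : HasTraces K u d) (hv : HasTraces K v e) :
    (hu.add hv).moment = hu.moment + hv.moment := LinearMap.ext fun P => by
  rw [LinearMap.add_apply, moment_apply, moment_apply, moment_apply,
    ← integral_add (hu.integrable_inner _) (hv.integrable_inner _)]
  simp only [inner_add_left]

lemma flux_smul (hu : HasTraces K u d) (c : ℝ) (i : Fin (n + 1)) :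
    (hu.smul c).flux i = c • hu.flux i :=
  LinearMap.ext fun _ => faceFlux_smul_left c i

lemma moment_smul (hu : HasTraces K u d) (c : ℝ) : (hu.smul c).moment = c • hu.moment :=
    LinearMap.ext fun P => by
  rw [LinearMap.smul_apply, moment_apply, moment_apply, smul_eq_mul, ← integral_const_mul]
  simp only [real_inner_smul_left]

end HasTraces

namespace Triangulation

variable {ι : Type*} {T : Triangulation n ι}

/-! ### The discontinuous finite element space -/

lemma exists_represents {r : ℕ} (f : T.V r) :
    ∃ F : ι → MvPolynomial (Fin n) ℝ, (∀ k, F k ∈ polyLE n r) ∧ T.Represents F f := by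
  choose F hF hf using f.2
  exact ⟨F, hF, hf⟩

lemma Represents.unique {f : Lp ℝ 2 (volume.restrict T.Ω)} {F G : ι → MvPolynomial (Fin n) ℝ}
    (hF : T.Represents F f) (hG : T.Represents G f) : F = G := funext fun k => by
  have h1 := hF k
  have h2 := hG k
  rw [T.restrict_omega_inter_body] at h1 h2
  have h3 : evalPoly (F k) =ᵐ[volume.restrict (interior (body (T.cell k)))] evalPoly (G k) := by
    filter_upwards [h1, h2] with x hx hx'
    rw [← hx, hx']
  have h4 := Measure.eqOn_open_of_ae_eq h3 isOpen_interior
    (continuous_evalPoly _).continuousOn (continuous_evalPoly _).continuousOn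
  refine sub_eq_zero.1 (eq_zero_of_evalPoly_eq_zero isOpen_interior
    (interior_body_nonempty (T.cell k)) fun x hx => ?_)
  rw [evalPoly_sub, h4 hx, sub_self]

lemma Represents.add {f g : Lp ℝ 2 (volume.restrict T.Ω)} {F G : ι → MvPolynomial (Fin n) ℝ}
    (hF : T.Represents F f) (hG : T.Represents G g) : T.Represents (F + G) (f + g) := fun k => by
  filter_upwards [hF k, hG k, ae_restrict_of_ae_restrict_of_subset inter_subset_left
    (Lp.coeFn_add f g)] with x h1 h2 h3
  rw [h3, Pi.add_apply, h1, h2, Pi.add_apply, evalPoly_add]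

lemma Represents.smul {f : Lp ℝ 2 (volume.restrict T.Ω)} {F : ι → MvPolynomial (Fin n) ℝ}
    (hF : T.Represents F f) (c : ℝ) : T.Represents (c • F) (c • f) := fun k => by
  filter_upwards [hF k, ae_restrict_of_ae_restrict_of_subset inter_subset_left
    (Lp.coeFn_smul c f)] with x h1 h3
  rw [h3, Pi.smul_apply, h1, Pi.smul_apply, evalPoly_smul, smul_eq_mul]

variable (T) in
/-- The polynomials which represent a function in `V_h^r` on the cells. -/
def poly (r : ℕ) : T.V r →ₗ[ℝ] (ι → MvPolynomial (Fin n) ℝ) where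
  toFun f := (exists_represents f).choose
  map_add' f g := (exists_represents (f + g)).choose_spec.2.unique
    ((exists_represents f).choose_spec.2.add (exists_represents g).choose_spec.2)
  map_smul' c f := (exists_represents (c • f)).choose_spec.2.unique
    ((exists_represents f).choose_spec.2.smul c)

lemma represents_poly {r : ℕ} (f : T.V r) : T.Represents (T.poly r f) f :=
  (exists_represents f).choose_spec.2

lemma poly_mem {r : ℕ} (f : T.V r) (k : ι) : T.poly r f k ∈ polyLE n r :=
  (exists_represents f).choose_spec.1 k

variable [Fintype ι]

lemma Represents.eq {f g : Lp ℝ 2 (volume.restrict T.Ω)} {F : ι → MvPolynomial (Fin n) ℝ}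
    (hF : T.Represents F f) (hG : T.Represents F g) : f = g :=
  Lp.ext (T.ae_omega fun k => by
    rw [← T.restrict_omega_inter_body]
    filter_upwards [hF k, hG k] with x h1 h2
    rw [h1, h2])

instance (r : ℕ) : FiniteDimensional ℝ (T.V r) := by
  refine Module.Finite.of_injective (N := ι → polyLE n r) (LinearMap.pi fun k =>
    ((LinearMap.proj k).comp (T.poly r)).codRestrict _ fun f => poly_mem f k) fun f g h => ?_
  have : T.poly r f = T.poly r g := funext fun k => congrArg Subtype.val (congrFun h k)
  exact Subtype.ext ((represents_poly f).eq (this ▸ represents_poly g))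

lemma exists_poly_eq {r : ℕ} {F : ι → MvPolynomial (Fin n) ℝ} (hF : ∀ k, F k ∈ polyLE n r) :
    ∃ f : T.V r, T.poly r f = F := by
  obtain ⟨f, hf⟩ := T.exists_piecewise (f := fun k => evalPoly (F k))
    fun k => memLp_evalPoly (T.cell k) (F k) 2
  have h : T.Represents F f := fun k => by
    rw [T.restrict_omega_inter_body]
    exact hf k
  exact ⟨⟨f, fun k => ⟨F k, hF k, h k⟩⟩, (represents_poly _).unique h⟩

/-! ### The discrete derivative -/

variable {u v : E n → E n} {d e : E n → ℝ}

variable (T) in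
/-- The form `∑_K ∫_K (u · ∇f) g dx - ∑_{e ∈ E_h⁰} ∫_e u · ⟦f⟧ {g} ds` on piecewise polynomial
functions. -/
def form (hu : ∀ k, HasTraces (T.cell k) u d) :
    (ι → MvPolynomial (Fin n) ℝ) →ₗ[ℝ] (ι → MvPolynomial (Fin n) ℝ) →ₗ[ℝ] ℝ :=
  LinearMap.mk₂ ℝ (fun F G => (∑ k, (hu k).moment (G k • grad n (F k)))
    - ∑ e ∈ T.interiorFaces, ∑ s ∈ T.sides e, (hu s.1).flux s.2
      (F s.1 * ((1 / 2 : ℝ) • ∑ t ∈ T.sides e, G t.1)))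
    (fun F F' G => by
      simp only [Pi.add_apply, map_add, smul_add, add_mul, Finset.sum_add_distrib]; ring)
    (fun c F G => by
      simp only [Pi.smul_apply, map_smul, smul_comm _ c, smul_mul_assoc, ← Finset.smul_sum,
        ← smul_sub])
    (fun F G G' => by
      simp only [Pi.add_apply, map_add, add_smul, mul_add, smul_add, Finset.sum_add_distrib]; ring)
    (fun c F G => by
      simp only [Pi.smul_apply, map_smul, smul_assoc, mul_smul_comm, ← Finset.smul_sum,
        smul_comm _ c, ← smul_sub])

lemma form_apply (hu : ∀ k, HasTraces (T.cell k) u d) (F G : ι → MvPolynomial (Fin n) ℝ) :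
    T.form hu F G = (∑ k, (hu k).moment (G k • grad n (F k)))
      - ∑ e ∈ T.interiorFaces, ∑ s ∈ T.sides e, (hu s.1).flux s.2
        (F s.1 * ((1 / 2 : ℝ) • ∑ t ∈ T.sides e, G t.1)) := rfl

lemma derivForm_eq {u : Lp (E n) 2 (volume.restrict T.Ω)}
    (hu : ∀ k, HasTraces (T.cell k) u (weakDiv T.Ω u)) (F G : ι → MvPolynomial (Fin n) ℝ) :
    T.derivForm u F G = T.form hu F G := by
  rw [derivForm, form_apply]
  congr 1
  · refine Finset.sum_congr rfl fun k _ => ?_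
    rw [← setIntegral_congr_set (interior_body_ae_eq _), HasTraces.moment_apply]
    refine integral_congr_ae (Eventually.of_forall fun x => ?_)
    simp only [fderiv_evalPoly, inner_evalVec, Pi.smul_apply, smul_eq_mul, grad_apply,
      evalPoly_mul, Finset.sum_mul]
    exact Finset.sum_congr rfl fun j _ => by ring
  · refine Finset.sum_congr rfl fun e _ => Finset.sum_congr rfl fun s _ => ?_
    rw [HasTraces.flux_apply]
    congr 1
    funext x
    rw [evalPoly_mul, evalPoly_smul, evalPoly_sum]

lemma form_congr (hu : ∀ k, HasTraces (T.cell k) u d) (hv : ∀ k, HasTraces (T.cell k) v e)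
    (h : u =ᵐ[volume.restrict T.Ω] v) : T.form hu = T.form hv := by
  refine LinearMap.ext₂ fun F G => ?_
  simp only [form_apply, fun k => (hu k).moment_congr (hv k) (T.ae_cell_of_ae_omega h k),
    fun k => (hu k).flux_congr (hv k) (T.ae_cell_of_ae_omega h k)]

lemma form_add (hu : ∀ k, HasTraces (T.cell k) u d) (hv : ∀ k, HasTraces (T.cell k) v e) :
    T.form (fun k => (hu k).add (hv k)) = T.form hu + T.form hv := by
  refine LinearMap.ext₂ fun F G => ?_
  simp only [form_apply, LinearMap.add_apply, fun k => HasTraces.moment_add (hu k) (hv k),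
    fun k => HasTraces.flux_add (hu k) (hv k), Finset.sum_add_distrib]
  ring

lemma form_smul (hu : ∀ k, HasTraces (T.cell k) u d) (c : ℝ) :
    T.form (fun k => (hu k).smul c) = c • T.form hu := by
  refine LinearMap.ext₂ fun F G => ?_
  simp only [form_apply, LinearMap.smul_apply, fun k => HasTraces.moment_smul (hu k),
    fun k => HasTraces.flux_smul (hu k), ← Finset.smul_sum, ← smul_sub]

lemma isDiscreteDerivative_iff {r : ℕ} {u : Lp (E n) 2 (volume.restrict T.Ω)}
    (hu : ∀ k, HasTraces (T.cell k) u (weakDiv T.Ω u)) {B : T.V r →ₗ[ℝ] T.V r} :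
    T.IsDiscreteDerivative r u B ↔
      ∀ f g : T.V r, inner ℝ (B f) g = T.form hu (T.poly r f) (T.poly r g) := by
  simp only [IsDiscreteDerivative, derivForm_eq hu]
  refine ⟨fun h f g => h f g _ _ (represents_poly f) (represents_poly g), fun h f g F G hF hG => ?_⟩
  rw [hF.unique (represents_poly f), hG.unique (represents_poly g), h]

variable (T) in
/-- The bilinear form on `V_h^r` that defines `A_u`. -/
def formOn (r : ℕ) (hu : ∀ k, HasTraces (T.cell k) u d) : T.V r →ₗ[ℝ] T.V r →ₗ[ℝ] ℝ :=
  (T.form hu).compl₁₂ (T.poly r) (T.poly r)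

lemma formOn_apply {r : ℕ} (hu : ∀ k, HasTraces (T.cell k) u d) (f g : T.V r) :
    T.formOn r hu f g = T.form hu (T.poly r f) (T.poly r g) := rfl

variable (T) in
/-- The map which sends `u` to the bilinear form on `V_h^r` that defines `A_u`. -/
def formMap (r : ℕ) {p : ENNReal} (hp : 2 < p) :
    H0divLp T.Ω p →ₗ[ℝ] (T.V r →ₗ[ℝ] T.V r →ₗ[ℝ] ℝ) where
  toFun u := T.formOn r (hasTraces_weakDiv hp u.2)
  map_add' u v := LinearMap.ext₂ fun f g => by
    have h : ((u + v).1 : E n → E n) =ᵐ[volume.restrict T.Ω] fun x => u.1 x + v.1 x :=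
      Lp.coeFn_add u.1 v.1
    simp only [LinearMap.add_apply, formOn_apply]
    rw [form_congr (hasTraces_weakDiv hp (u + v).2)
      (fun k => (hasTraces_weakDiv hp u.2 k).add (hasTraces_weakDiv hp v.2 k)) h, form_add]
    rfl
  map_smul' c u := LinearMap.ext₂ fun f g => by
    have h : ((c • u).1 : E n → E n) =ᵐ[volume.restrict T.Ω] fun x => c • u.1 x :=
      Lp.coeFn_smul c u.1
    simp only [LinearMap.smul_apply, RingHom.id_apply, formOn_apply]
    rw [form_congr (hasTraces_weakDiv hp (c • u).2)
      (fun k => (hasTraces_weakDiv hp u.2 k).smul c) h, form_smul]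
    rfl

variable (T) in
/-- The operator `u ↦ A_u`. -/
def discreteDerivative (r : ℕ) {p : ENNReal} (hp : 2 < p) :
    H0divLp T.Ω p →ₗ[ℝ] (T.V r →ₗ[ℝ] T.V r) :=
  (operatorOfForm (V := T.V r)).comp (T.formMap r hp)

lemma inner_discreteDerivative {r : ℕ} {p : ENNReal} (hp : 2 < p) (u : H0divLp T.Ω p)
    (f g : T.V r) : inner ℝ (T.discreteDerivative r hp u f) g
      = T.form (hasTraces_weakDiv hp u.2) (T.poly r f) (T.poly r g) :=
  inner_operatorOfForm (V := T.V r) (T.formOn r (hasTraces_weakDiv hp u.2)) f g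

lemma isDiscreteDerivative_discreteDerivative (r : ℕ) {p : ENNReal} (hp : 2 < p)
    (u : H0divLp T.Ω p) : T.IsDiscreteDerivative r u (T.discreteDerivative r hp u) :=
  (isDiscreteDerivative_iff (hasTraces_weakDiv hp u.2)).2 (inner_discreteDerivative hp u)

lemma IsDiscreteDerivative.unique {r : ℕ} {p : ENNReal} (hp : 2 < p) {u : H0divLp T.Ω p}
    {B B' : T.V r →ₗ[ℝ] T.V r} (h : T.IsDiscreteDerivative r u B)
    (h' : T.IsDiscreteDerivative r u B') : B = B' := by
  rw [isDiscreteDerivative_iff (hasTraces_weakDiv hp u.2)] at h h'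
  exact LinearMap.ext fun f => ext_inner_right ℝ fun g => by rw [h, h']

lemma discreteDerivative_eq_zero_iff {r : ℕ} {p : ENNReal} (hp : 2 < p) (u : H0divLp T.Ω p) :
    T.discreteDerivative r hp u = 0 ↔
      ∀ F G : ι → MvPolynomial (Fin n) ℝ, (∀ k, F k ∈ polyLE n r) → (∀ k, G k ∈ polyLE n r) →
        T.form (hasTraces_weakDiv hp u.2) F G = 0 := by
  constructor
  · intro h F G hF hG
    obtain ⟨f, rfl⟩ := exists_poly_eq (T := T) hF
    obtain ⟨g, rfl⟩ := exists_poly_eq (T := T) hG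
    rw [← inner_discreteDerivative hp u, h, LinearMap.zero_apply, inner_zero_left]
  · intro h
    refine LinearMap.ext fun f => ext_inner_right ℝ fun g => ?_
    rw [inner_discreteDerivative, h _ _ (poly_mem f) (poly_mem g), LinearMap.zero_apply,
      inner_zero_left]

end Triangulation

/-! ### Spanning sets of polynomials and polynomial vector fields -/

/-- Exchanging one element of an `r`-set for another, possible since `0 < r < |α|`, shows that all
values of `e` are equal. A vanishing sum of `r > 0` equal values then makes them zero. -/
lemma eq_zero_of_sum_card_eq_zero {α : Type*} [Fintype α] {e : α → ℝ} {r : ℕ} (hr : 0 < r)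
    (hr' : r < Fintype.card α) (h : ∀ S : Finset α, S.card = r → ∑ m ∈ S, e m = 0) (a : α) :
    e a = 0 := by
  classical
  have heq : ∀ b, e b = e a := fun b => by
    by_cases hab : a = b
    · rw [hab]
    have hc : r - 1 ≤ ((Finset.univ.erase a).erase b).card := by
      rw [Finset.card_erase_of_mem (Finset.mem_erase.2 ⟨Ne.symm hab, Finset.mem_univ b⟩),
        Finset.card_erase_of_mem (Finset.mem_univ a), Finset.card_univ]
      omega
    obtain ⟨S, hS, hSc⟩ := Finset.exists_subset_card_eq hc
    have ha : a ∉ S := fun h => by simpa using hS h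
    have hb : b ∉ S := fun h => by simpa using hS h
    have h1 := h (insert a S) (by rw [Finset.card_insert_of_notMem ha]; omega)
    have h2 := h (insert b S) (by rw [Finset.card_insert_of_notMem hb]; omega)
    rw [Finset.sum_insert ha] at h1
    rw [Finset.sum_insert hb] at h2
    linarith
  obtain ⟨S, -, hS⟩ := Finset.exists_subset_card_eq (s := (Finset.univ : Finset α)) (n := r)
    (by rw [Finset.card_univ]; exact hr'.le)
  have h1 := h S hS
  simp only [heq, Finset.sum_const, hS, nsmul_eq_mul] at h1
  exact (mul_eq_zero.1 h1).resolve_left (by exact_mod_cast hr.ne')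

lemma grad_prod {α : Type*} [DecidableEq α] (S : Finset α) (L : α → MvPolynomial (Fin n) ℝ) :
    grad n (∏ m ∈ S, L m) = ∑ m ∈ S, (∏ l ∈ S.erase m, L l) • grad n (L m) := by
  induction S using Finset.induction_on with
  | empty =>
    funext j
    simp [grad_apply]
  | insert a S ha ih =>
    rw [Finset.prod_insert ha, Finset.sum_insert ha, grad_mul, ih, Finset.erase_insert ha,
      Finset.smul_sum, add_comm]
    congr 1
    refine Finset.sum_congr rfl fun m hm => ?_
    have hne : a ≠ m := fun h => ha (h ▸ hm)
    rw [Finset.erase_insert_of_ne hne, Finset.prod_insert fun h => ha (Finset.mem_of_mem_erase h),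
      smul_smul]

/-- The products of polynomials in `P_r` span `P_{2r}`. -/
lemma eq_zero_of_forall_mul (J : MvPolynomial (Fin n) ℝ →ₗ[ℝ] ℝ) {r : ℕ}
    (h : ∀ f ∈ polyLE n r, ∀ g ∈ polyLE n r, J (f * g) = 0) {q : MvPolynomial (Fin n) ℝ}
    (hq : q ∈ polyLE n (2 * r)) : J q = 0 := by
  have hle : polyLE n (2 * r) ≤ LinearMap.ker J := by
    rw [two_mul]
    refine (polyLE_le_span _).trans (Submodule.span_le.2 ?_)
    rintro _ ⟨l, rfl⟩
    change J (∏ i, padVar (l i)) = 0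
    rw [Fin.prod_univ_add]
    have h1 : ∀ l : Fin r → Option (Fin n), ∏ i, padVar (l i) ∈ polyLE n r := fun l => by
      simpa using prod_mem_polyLE Finset.univ fun a _ => padVar_mem_polyLE (l a)
    exact h _ (h1 _) _ (h1 _)
  exact hle hq

/-- The fields `g ∇f` with `f`, `g` in `P_r` span `(P_{2r-1})ⁿ`. -/
lemma eq_zero_of_forall_smul_grad (J : (Fin n → MvPolynomial (Fin n) ℝ) →ₗ[ℝ] ℝ) {r : ℕ}
    (h : ∀ f ∈ polyLE n r, ∀ g ∈ polyLE n r, J (g • grad n f) = 0)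
    {P : Fin n → MvPolynomial (Fin n) ℝ} (hP : ∀ j, P j ∈ polyLT n (2 * r)) : J P = 0 := by
  classical
  -- For `r = 0` the space is `P_{-1} = 0`.
  rcases r.eq_zero_or_pos with rfl | hr
  · have : P = 0 := funext hP
    rw [this, map_zero]
  obtain ⟨k, hk⟩ : ∃ k, 2 * r = k + 1 := ⟨2 * r - 1, by omega⟩
  rw [hk] at hP
  have key : ∀ (j : Fin n), ∀ q ∈ polyLE n k, J (Pi.single j q) = 0 := fun j => by
    have hle : polyLE n k ≤ LinearMap.ker (J ∘ₗ LinearMap.single ℝ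
        (fun _ : Fin n => MvPolynomial (Fin n) ℝ) j) := by
      refine (polyLE_le_span _).trans (Submodule.span_le.2 ?_)
      rintro _ ⟨l, rfl⟩
      change J (Pi.single j _) = 0
      -- There are `2r` factors: `X_j` and the `2r - 1` factors of a spanning element of `P_{2r-1}`.
      -- For a set `S` of `r` indices, `f = ∏_S L` and `g = ∏_{Sᶜ} L` are in `P_r`, and `g ∇f` is
      -- the sum over `m ∈ S` of `(∏_{i ≠ m} L_i) ∇L_m`. So `J` has zero sum over every such `S`,
      -- hence kills each term, and the term of `X_j` is the required field.
      set L : Fin (k + 1) → MvPolynomial (Fin n) ℝ :=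
        Fin.cons (MvPolynomial.X j) fun i => padVar (l i) with hL
      have hL1 : ∀ m, L m ∈ polyLE n 1 := Fin.cases (X_mem_polyLE j) fun i => padVar_mem_polyLE _
      have h1 := eq_zero_of_sum_card_eq_zero (e := fun m => J ((∏ i ∈ Finset.univ.erase m, L i) •
        grad n (L m))) hr (by rw [Fintype.card_fin]; omega) (fun S hS => by
          have hSc : Sᶜ.card = r := by rw [Finset.card_compl, hS, Fintype.card_fin]; omega
          rw [← h _ (hS ▸ prod_mem_polyLE S fun m _ => hL1 m) _
            (hSc ▸ prod_mem_polyLE Sᶜ fun m _ => hL1 m), grad_prod, Finset.smul_sum, map_sum]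
          refine Finset.sum_congr rfl fun m hm => ?_
          rw [smul_smul, ← Finset.prod_union (disjoint_compl_left.mono_right
            (Finset.erase_subset m S))]
          congr 3
          ext i
          by_cases hi : i = m
          · simp [hi, hm]
          · simp [hi, or_comm, em]) 0
      convert h1 using 2
      have h2 : ∏ i ∈ Finset.univ.erase 0, L i = ∏ i, padVar (l i) := by
        rw [← Finset.compl_singleton, ← Fin.image_succ_univ,
          Finset.prod_image fun a _ b _ h => Fin.succ_injective _ h]
        simp [hL]
      rw [h2]
      funext j'
      by_cases hj : j' = j
      · subst hj
        simp [hL, grad_apply]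
      · simp [hL, grad_apply, hj, MvPolynomial.pderiv_X_of_ne (Ne.symm hj)]
    exact fun q hq => hle hq
  rw [← Finset.univ_sum_single P, map_sum]
  exact Finset.sum_eq_zero fun j _ => key j _ (hP j)

namespace Triangulation

variable {ι : Type*} [Fintype ι] {T : Triangulation n ι}

/-- A vertex of cell `k` that is not a vertex of cell `l` must be opposite to every face common to
both, so there is at most one such face. -/
lemma eq_of_mem_sides {e e' : Finset (E n)} {k l : ι} (hkl : k ≠ l) {i j i' j' : Fin (n + 1)}
    (h1 : (k, i) ∈ T.sides e) (h2 : (l, j) ∈ T.sides e) (h1' : (k, i') ∈ T.sides e')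
    (h2' : (l, j') ∈ T.sides e') : e = e' := by
  rw [mem_sides] at *
  dsimp only at *
  by_contra hne
  have hi : i ≠ i' := fun h => hne (by rw [← h1, ← h1', h])
  obtain ⟨m, hm⟩ := T.exists_vertex_notMem hkl
  have hsub : ∀ {e i j}, facet (T.cell k) i = e → facet (T.cell l) j = e → m ≠ i → False :=
    fun {e i j} h h' hmi => by
      have : T.cell k m ∈ facet (T.cell l) j := by
        rw [h', ← h]
        exact mem_facet.2 ⟨m, hmi, rfl⟩
      obtain ⟨a, _, ha⟩ := mem_facet.1 this
      exact hm ⟨a, ha⟩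
  by_cases hmi : m = i
  · exact hsub h1' h2' (hmi ▸ hi)
  · exact hsub h1 h2 hmi

/-! ### The kernels -/

section

variable {u : E n → E n} {d : E n → ℝ}

/-- The degrees of freedom on the faces are determined by the discrete derivative. -/
lemma flux_eq_zero_of_form_eq_zero (hn : 1 ≤ n) (hz : HasZeroNormalTrace T.Ω u d)
    (hu : ∀ k, HasTraces (T.cell k) u d) {r : ℕ}
    (h : ∀ F G : ι → MvPolynomial (Fin n) ℝ, (∀ k, F k ∈ polyLE n r) → (∀ k, G k ∈ polyLE n r) →
      T.form hu F G = 0) (k : ι) (i : Fin (n + 1)) {q : MvPolynomial (Fin n) ℝ}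
    (hq : q ∈ polyLE n (2 * r)) : (hu k).flux i q = 0 := by
  classical
  set e := facet (T.cell k) i with he
  have hs : (k, i) ∈ T.sides e := T.mem_sides.2 rfl
  by_cases hc : (T.sides e).card = 2
  · obtain ⟨⟨l, j⟩, ht, hst⟩ := Finset.exists_mem_ne (by omega : 1 < (T.sides e).card) (k, i)
    have hlk : l ≠ k := fun hlk => hst (T.fst_injOn_sides e ht hs hlk)
    have heI : e ∈ T.interiorFaces :=
      Finset.mem_filter.2 ⟨Finset.mem_image.2 ⟨(k, i), Finset.mem_univ _, rfl⟩, hc⟩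
    have hsides : T.sides e = {(k, i), (l, j)} := by
      refine (Finset.eq_of_subset_of_card_le ?_ ?_).symm
      · exact Finset.insert_subset hs (Finset.singleton_subset_iff.2 ht)
      · rw [hc, Finset.card_pair (Ne.symm hst)]
    refine eq_zero_of_forall_mul ((hu k).flux i) (fun f hf g hg => ?_) hq
    have hsingle : ∀ (a : ι) {f : MvPolynomial (Fin n) ℝ}, f ∈ polyLE n r →
        ∀ b, (Pi.single a f : ι → MvPolynomial (Fin n) ℝ) b ∈ polyLE n r := fun a f hf b => by
      by_cases hab : b = a
      · subst hab; rwa [Pi.single_eq_same]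
      · rw [Pi.single_eq_of_ne hab]; exact Submodule.zero_mem _
    -- With `f` on `k` and `g` on `l` the cell integrals vanish, and so do all faces but `e`, the
    -- only one common to both cells. What is left is half the flux of `f g`, up to sign.
    have h1 := h _ _ (hsingle k hf) (hsingle l hg)
    rw [form_apply, Finset.sum_eq_zero fun m _ => ?_, Finset.sum_eq_single_of_mem e heI, hsides,
      Finset.sum_pair (Ne.symm hst), Finset.sum_pair (Ne.symm hst)] at h1
    · simp only [Pi.single_eq_same, Pi.single_eq_of_ne hlk, Pi.single_eq_of_ne hlk.symm, zero_add,
        zero_mul, map_zero, mul_smul_comm, map_smul, smul_eq_mul] at h1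
      linarith
    · rintro e' - hne
      refine Finset.sum_eq_zero fun s hs' => ?_
      by_cases hsk : s.1 = k
      · rw [Finset.sum_eq_zero fun t ht' => ?_, smul_zero, mul_zero, map_zero]
        refine Pi.single_eq_of_ne (fun htl => hne ?_) _
        obtain ⟨a, b⟩ := s
        obtain ⟨a', b'⟩ := t
        dsimp only at hsk htl
        subst hsk htl
        exact eq_of_mem_sides (Ne.symm hlk) hs' ht' hs ht
      · rw [Pi.single_eq_of_ne hsk, zero_mul, map_zero]
    · by_cases hm : m = k
      · rw [Pi.single_eq_of_ne (hm ▸ hlk.symm : m ≠ l), zero_smul, map_zero]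
      · rw [Pi.single_eq_of_ne hm, map_zero, smul_zero, map_zero]
  -- A boundary face has one side only, and the form does not see it. There the flux vanishes by the
  -- zero normal trace.
  · have hc1 : (T.sides e).card = 1 := by
      have h1 := T.card_sides_le_two e
      have h2 := Finset.card_pos.2 ⟨_, hs⟩
      omega
    obtain ⟨s, hs1⟩ := Finset.card_eq_one.1 hc1
    have := T.sum_faceFlux_sides_eq_zero hn hz hu e (contDiff_evalPoly q)
    rw [hs1, Finset.mem_singleton] at hs
    rw [hs1, ← hs, Finset.sum_singleton] at this
    exact this

lemma form_eq_zero_of_flux_eq_zero (hu : ∀ k, HasTraces (T.cell k) u d) {r : ℕ}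
    (h : ∀ k i, ∀ q ∈ polyLE n (2 * r), (hu k).flux i q = 0) {F G : ι → MvPolynomial (Fin n) ℝ}
    (hF : ∀ k, F k ∈ polyLE n r) (hG : ∀ k, G k ∈ polyLE n r) :
    T.form hu F G = ∑ k, (hu k).moment (G k • grad n (F k)) := by
  rw [form_apply, sub_eq_self]
  refine Finset.sum_eq_zero fun e _ => Finset.sum_eq_zero fun s _ => h _ _ _ ?_
  rw [two_mul]
  exact mul_mem_polyLE (hF _) (Submodule.smul_mem _ _ (Submodule.sum_mem _ fun t _ => hG _))

/-- The fluxes come first, by separated supports. After they are known to vanish, the form consists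
of cell integrals only, and `f` supported on one cell isolates the moments of that cell. -/
lemma form_eq_zero_iff (hn : 1 ≤ n) (hz : HasZeroNormalTrace T.Ω u d)
    (hu : ∀ k, HasTraces (T.cell k) u d) {r : ℕ} :
    (∀ F G : ι → MvPolynomial (Fin n) ℝ, (∀ k, F k ∈ polyLE n r) → (∀ k, G k ∈ polyLE n r) →
      T.form hu F G = 0) ↔
    ∀ k, (∀ i, ∀ q ∈ polyLE n (2 * r), (hu k).flux i q = 0) ∧
      ∀ P : Fin n → MvPolynomial (Fin n) ℝ, (∀ j, P j ∈ polyLT n (2 * r)) →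
        (hu k).moment P = 0 := by
  classical
  constructor
  · intro h
    have hflux := fun k i q hq => flux_eq_zero_of_form_eq_zero hn hz hu h k i (q := q) hq
    refine fun k => ⟨hflux k, fun P hP => ?_⟩
    refine eq_zero_of_forall_smul_grad _ (fun f hf g hg => ?_) hP
    have h1 := h (Pi.single k f) (fun _ => g) (fun l => by
      by_cases hl : l = k
      · subst hl; rwa [Pi.single_eq_same]
      · rw [Pi.single_eq_of_ne hl]; exact Submodule.zero_mem _) fun _ => hg
    rw [form_eq_zero_of_flux_eq_zero hu hflux (fun l => by
      by_cases hl : l = k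
      · subst hl; rwa [Pi.single_eq_same]
      · rw [Pi.single_eq_of_ne hl]; exact Submodule.zero_mem _) fun _ => hg,
      Finset.sum_eq_single k (fun l _ hl => by
        rw [Pi.single_eq_of_ne hl, map_zero, smul_zero, map_zero]) (by simp),
      Pi.single_eq_same] at h1
    exact h1
  · intro h F G hF hG
    rw [form_eq_zero_of_flux_eq_zero hu (fun k => (h k).1) hF hG]
    refine Finset.sum_eq_zero fun k _ => (h k).2 _ fun j => ?_
    rw [two_mul]
    exact mul_mem_polyLT (hG k) (pderiv_mem_polyLT (hF k) j)

end

lemma isLocalInterpolant_zero_iff (hn : 1 ≤ n) {K : Simplex n} {u : E n → E n} {d : E n → ℝ}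
    {k : ℕ} (hu : HasTraces K u d) : IsLocalInterpolant K k u d 0 ↔
      (∀ i, ∀ q ∈ polyLE n k, hu.flux i q = 0) ∧
      ∀ P : Fin n → MvPolynomial (Fin n) ℝ, (∀ j, P j ∈ polyLT n k) → hu.moment P = 0 := by
  have h0 : ∀ x : E n, evalVec 0 x = 0 := fun x => by ext j; simp
  have h1 : ∀ x : E n, evalPoly (divPoly (0 : Fin n → MvPolynomial (Fin n) ℝ)) x = 0 :=
    fun x => by simp [divPoly]
  have h2 : ∀ i q, faceFlux K i (evalVec 0) (evalPoly (divPoly 0)) (evalPoly q) = 0 :=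
    fun i q => by simp [faceFlux, h0, h1]
  rw [isLocalInterpolant_iff_forall hn hu]
  simp only [h2, h0, inner_zero_left, integral_zero, Submodule.zero_mem, true_and,
    HasTraces.flux_apply, HasTraces.moment_apply, eq_comm (a := (0 : ℝ))]

lemma interpolation_eq_zero_iff (hn : 1 ≤ n) {p : ENNReal} (hp : 2 < p) {k : ℕ}
    {u : H0divLp T.Ω p} : T.interpolation hn hp k u = 0 ↔
      ∀ l, IsLocalInterpolant (T.cell l) k u.1 (weakDiv T.Ω u.1) 0 := by
  have h0 := Lp.coeFn_zero (E n) 2 (volume.restrict T.Ω)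
  have h := isInterpolant_interpolation hn hp k u
  constructor
  · intro hz l
    rw [hz] at h
    obtain ⟨W, hW, hw⟩ := h l
    have h1 : evalVec W =ᵐ[volume.restrict (interior (body (T.cell l)))] fun _ => 0 := by
      filter_upwards [hw, T.ae_cell_of_ae_omega h0 l] with x hx hx'
      rw [← hx]
      exact hx'
    have h2 := Measure.eqOn_open_of_ae_eq h1 isOpen_interior
      (continuous_evalVec W).continuousOn continuousOn_const
    have h3 : W = 0 := funext fun j => eq_zero_of_evalPoly_eq_zero isOpen_interior
      (interior_body_nonempty (T.cell l)) fun x hx => congrArg (fun v : E n => v j) (h2 hx)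
    exact h3 ▸ hW
  · intro hl
    refine Subtype.ext (h.ext hn hp u.2 fun l => ⟨0, hl l, ?_⟩)
    filter_upwards [T.ae_cell_of_ae_omega h0 l] with x hx
    refine hx.trans ?_
    ext j
    simp

/-- Both kernels consist of the fields all of whose face moments against `P_{2r}` and interior
moments against `(P_{2r-1})ⁿ` vanish. -/
lemma ker_discreteDerivative (hn : 1 ≤ n) {p : ENNReal} (hp : 2 < p) (r : ℕ) :
    LinearMap.ker (T.discreteDerivative r hp) = LinearMap.ker (T.interpolation hn hp (2 * r)) := by
  ext u
  have hu := hasTraces_weakDiv hp u.2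
  rw [LinearMap.mem_ker, LinearMap.mem_ker, discreteDerivative_eq_zero_iff,
    interpolation_eq_zero_iff, form_eq_zero_iff hn
      (hasZeroNormalTrace_weakDiv (U := T.Ω) isOpen_interior u.2.1)]
  exact forall_congr' fun l => (isLocalInterpolant_zero_iff hn (hu l)).symm

end Triangulation

end FEVar

end

/-! ### The main theorem. -/

theorem proposition3p5 {n : ℕ} (hn : 1 ≤ n) {ι : Type*} [Fintype ι]
    (T : FEVar.Triangulation n ι) (r : ℕ) (p : ENNReal) (hp : 2 < p) :
    -- the local interpolation operators are well defined on `H(div, K) ∩ L^p(K)ⁿ`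
    (∀ (k : ι) (u : FEVar.E n → FEVar.E n) (d : FEVar.E n → ℝ),
      FEVar.MemHDiv (interior (FEVar.body (T.cell k))) u d →
      MeasureTheory.MemLp u p
        (MeasureTheory.volume.restrict (interior (FEVar.body (T.cell k)))) →
      ∃! W, FEVar.IsLocalInterpolant (T.cell k) (2 * r) u d W) ∧
    -- the linear map `u ↦ A_u`
    ∃ A : FEVar.H0divLp T.Ω p →ₗ[ℝ] (T.V r →ₗ[ℝ] T.V r),
      (∀ u : FEVar.H0divLp T.Ω p, T.IsDiscreteDerivative r u (A u) ∧
        ∀ B, T.IsDiscreteDerivative r u B → B = A u) ∧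
      -- the global interpolation operator, given by the local ones on each simplex
      ∃ Pi : FEVar.H0divLp T.Ω p →ₗ[ℝ] T.RT (2 * r),
        (∀ (u : FEVar.H0divLp T.Ω p) (k : ι), ∃ W,
          FEVar.IsLocalInterpolant (T.cell k) (2 * r)
            (u : MeasureTheory.Lp (FEVar.E n) 2 (MeasureTheory.volume.restrict T.Ω))
            (FEVar.weakDiv T.Ω u) W ∧
          ∀ᵐ x ∂(MeasureTheory.volume.restrict (T.Ω ∩ FEVar.body (T.cell k))),
            (Pi u : MeasureTheory.Lp (FEVar.E n) 2 (MeasureTheory.volume.restrict T.Ω)) x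
              = FEVar.evalVec W x) ∧
        LinearMap.ker A = LinearMap.ker Pi ∧
        ∀ u : FEVar.H0divLp T.Ω p, A (Submodule.inclusion (T.RT_le (2 * r) p) (Pi u)) = A u ∧
          ∀ v : T.RT (2 * r),
            A (Submodule.inclusion (T.RT_le (2 * r) p) v) = A u → v = Pi u := by
  have hker := FEVar.Triangulation.ker_discreteDerivative (T := T) hn hp r
  -- `A v = A u` means that `v - u` lies in the common kernel, that is `Π v = Π u`, and `Π v = v` on
  -- the Raviart-Thomas space.
  have hiff : ∀ (u : FEVar.H0divLp T.Ω p) (v : T.RT (2 * r)),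
      T.discreteDerivative r hp (Submodule.inclusion (T.RT_le (2 * r) p) v)
        = T.discreteDerivative r hp u ↔ v = T.interpolation hn hp (2 * r) u := fun u v => by
    rw [← sub_eq_zero, ← map_sub, ← LinearMap.mem_ker, hker, LinearMap.mem_ker, map_sub,
      sub_eq_zero, FEVar.Triangulation.interpolation_inclusion]
  refine ⟨fun k u d h hu => FEVar.existsUnique_isLocalInterpolant hn (2 * r)
      (FEVar.hasTraces_of_memHDiv hp h hu), T.discreteDerivative r hp,
    fun u => ⟨FEVar.Triangulation.isDiscreteDerivative_discreteDerivative r hp u,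
      fun B hB => hB.unique hp
        (FEVar.Triangulation.isDiscreteDerivative_discreteDerivative r hp u)⟩,
    T.interpolation hn hp (2 * r), fun u k => ?_, hker,
    fun u => ⟨(hiff u _).2 rfl, fun v => (hiff u v).1⟩⟩
  rw [T.restrict_omega_inter_body]
  exact FEVar.Triangulation.isInterpolant_interpolation hn hp (2 * r) u k
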